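/- **Theorem 1.** If the theory $NBG$ is consistent, then the theory $NBG^{(1)}$ is consistent. This holds both for pure sets and for set theory with individuals; here "consistent" means that no contradiction is derivable in classical first-order logic with equality. *$NBG$.* The variables range over classes and individuals; the primitive notions are $\in$ and "is an individual". An *element* is an object that is a member of some class; a *set* is an element that is not an individual. The axioms are: individuals are elements and have no members; there are no individuals (pure case), respectively there is an individual (case with individuals); extensionality for sets and classes; pairing, union, power set, infinity; replacement (the image of a set under a single-valued class is a set); class comprehension for formulas in which only elements are quantified (class parameters are allowed); the axiom of choice (some single-valued class chooses a member of every nonempty set); and foundation (every nonempty class $X$ has a member that has no member in common with $X$). *Skands.* For ordinals $\alpha_0<\alpha$, a *system of components* on the segment $(\alpha_0,\alpha)=\{\alpha' : \alpha_0\le\alpha'<\alpha\}$ is a function $(X_{\alpha'})_{\alpha_0\le\alpha'<\alpha}$ whose values are well-founded sets (possibly empty; individuals are allowed as members). Its *length* is the order type of $(\alpha_0,\alpha)$. Two systems $(X_{\alpha'})$ on $(\alpha_0,\alpha)$ and $(Y_{\beta'})$ on $(\beta_0,\beta)$ are *similar* if there is an order isomorphism $\varphi:(\alpha_0,\alpha)\to(\beta_0,\beta)$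 with $X_{\alpha'}=Y_{\varphi(\alpha')}$ for all $\alpha'$. *$NBG^{(1)}$.* The language is that of $NBG$ with one more primitive notion, "$X$ is the skand $X_{(\alpha_0,\alpha)}$ with the system of components $(X_{\alpha'})$", which may also occur in comprehension. The axioms are those of $NBG$ without extensionality and foundation, together with: 1. (von Neumann's axiom) the class of all sets is in bijection with the class of all ordinals; 2. (skand existence) every system of components has exactly one skand, which is a set (and only systems of components have skands); the members of $X_{(\alpha_0,\alpha)}$ are the members of $X_{\alpha_0}$ and, if $\alpha_0+1<\alpha$, also the skand $X_{(\alpha_0+1,\alpha)}$ whose system is the restriction to $(\alpha_0+1,\alpha)$; 3. (equality of skands) two skands of length $\ge\omega$ are equal if and only if their systems of components are similar; 4. (strong extensionality) two sets or classes $X,Y$ are equal if and only if every member of $X$ is the same as some member of $Y$ and vice versa, where "the same" means: equal individuals, or equal well-founded sets, or skands of length $\ge\omega$ with similar systems of components, or equal sets; 5. (pseudo-well-foundedness) every nonempty class $X$ has a member that either is a skand of length $\ge\omega$ (a "pseudo-individual") or has no member in common with $X$. -/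

import Mathlib

open FirstOrder FirstOrder.Language

namespace Skands

/-! ### First-order provability and consistency

Formulas are Mathlib's formulas `L.Formula ℕ`, with free variables named by natural numbers.  Bound
variables are nameless, so substitution never captures a variable. -/

section Logic

variable {L : Language}

/-- The formula `∀ x, φ`, binding the named variable `x`. -/
def all (x : ℕ) (φ : L.Formula ℕ) : L.Formula ℕ :=
  BoundedFormula.all
    (BoundedFormula.relabel (n := 1) (k := 0)
      (fun v => if v = x then Sum.inr (0 : Fin 1) else Sum.inl v) φ)

/-- The formula `∃ x, φ`. -/
def ex (x : ℕ) (φ : L.Formula ℕ) : L.Formula ℕ :=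
  ∼(all x (∼φ))

/-- The formula `φ[t/x]`. -/
def inst (φ : L.Formula ℕ) (x : ℕ) (t : L.Term ℕ) : L.Formula ℕ :=
  BoundedFormula.subst φ (Function.update Term.var x t)

/-- Classical natural deduction with equality.  `Provable T Γ φ` says that `φ` is derivable from the
assumptions `Γ` and the axioms `T`; a free variable of an axiom is read as universally
quantified. -/
inductive Provable (T : Set (L.Formula ℕ)) : List (L.Formula ℕ) → L.Formula ℕ → Prop
  | axm {Γ φ} : φ ∈ T → Provable T Γ φ
  | assume {Γ φ} : φ ∈ Γ → Provable T Γ φ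
  | impIntro {Γ φ ψ} : Provable T (φ :: Γ) ψ → Provable T Γ (φ ⟹ ψ)
  | impElim {Γ φ ψ} : Provable T Γ (φ ⟹ ψ) → Provable T Γ φ → Provable T Γ ψ
  | contra {Γ φ} : Provable T (∼φ :: Γ) ⊥ → Provable T Γ φ
  | allIntro {Γ φ} (x : ℕ) : (∀ ψ ∈ Γ, x ∉ ψ.freeVarFinset) → Provable T Γ φ →
      Provable T Γ (all x φ)
  | allElim {Γ φ} (x : ℕ) (t : L.Term ℕ) : Provable T Γ (all x φ) → Provable T Γ (inst φ x t)
  | eqRefl {Γ} (t : L.Term ℕ) : Provable T Γ (t.equal t)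
  | eqSubst {Γ φ} (x : ℕ) (s t : L.Term ℕ) : Provable T Γ (s.equal t) →
      Provable T Γ (inst φ x s) → Provable T Γ (inst φ x t)

/-- A theory is consistent if it does not prove a contradiction. -/
def Consistent (T : Set (L.Formula ℕ)) : Prop :=
  ¬ Provable T [] ⊥

end Logic

/-! ### The languages -/

/-- The relation symbols: membership, "is an individual", and, only if `b = true`, a binary symbol
`skand` whose intended meaning is "`X` is the skand with the system of components `f`". -/
inductive Sym (b : Bool) : ℕ → Type
  | mem : Sym b 2
  | ind : Sym b 1
  | skand : b = true → Sym b 2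

/-- The one-sorted language of class theory with individuals (`b = false`), and its extension by
the symbol for skands (`b = true`). -/
def lang (b : Bool) : Language :=
  ⟨fun _ => Empty, Sym b⟩

/-- Formulas of these languages.  The variables range over classes and individuals. -/
abbrev Fm (b : Bool) : Type :=
  (lang b).Formula ℕ

variable {b : Bool}

/-! In the definitions below the arguments are names of variables; a bound variable gets a name that
exceeds all the arguments, and hence differs from them. -/

/-- `x ∈ y` -/
def mem (x y : ℕ) : Fm b :=
  Relations.formula₂ (L := lang b) Sym.mem (Term.var x) (Term.var y)

/-- `x = y` -/
def eq (x y : ℕ) : Fm b :=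
  Term.equal (Term.var x) (Term.var y)

/-- `x` is an individual -/
def ind (x : ℕ) : Fm b :=
  Relations.formula₁ (L := lang b) Sym.ind (Term.var x)

local infix:100 " ε " => mem
local infix:100 " ≐ " => eq

/-- `x` is a set or an individual (and not a proper class): it is a member of something -/
def elem (x : ℕ) : Fm b :=
  let y := x + 1
  ex y (x ε y)

/-- `x` is a class, possibly a set -/
def cls (x : ℕ) : Fm b :=
  ∼(ind x)

/-- `x` is a set -/
def set (x : ℕ) : Fm b :=
  elem x ⊓ cls x

/-- every member of `x` is a member of `y` -/
def sub (x y : ℕ) : Fm b :=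
  let z := x + y + 1
  all z (z ε x ⟹ z ε y)

/-- `x` has a member -/
def nonempty (x : ℕ) : Fm b :=
  let z := x + 1
  ex z (z ε x)

/-- `z = {x, y}` -/
def upair (z x y : ℕ) : Fm b :=
  let w := z + x + y + 1
  all w (w ε z ⇔ (w ≐ x ⊔ w ≐ y))

/-- `p` is the ordered pair `(x, y) = {{x}, {x, y}}` -/
def opair (p x y : ℕ) : Fm b :=
  let z := p + x + y + 1
  elem x ⊓ elem y ⊓ all z (z ε p ⇔ (upair z x x ⊔ upair z x y))

/-- `(x, y) ∈ f` -/
def app (f x y : ℕ) : Fm b :=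
  let p := f + x + y + 1
  ex p (p ε f ⊓ opair p x y)

/-- `f` is single-valued -/
def functional (f : ℕ) : Fm b :=
  let x := f + 1
  let y := f + 2
  let z := f + 3
  all x <| all y <| all z <| app f x y ⊓ app f x z ⟹ y ≐ z

/-- `f` is one-to-one -/
def injective (f : ℕ) : Fm b :=
  let x := f + 1
  let y := f + 2
  let z := f + 3
  all x <| all y <| all z <| app f x z ⊓ app f y z ⟹ x ≐ y

/-- `s = x ∪ {x}` -/
def succ (s x : ℕ) : Fm b :=
  let w := s + x + 1
  cls s ⊓ all w (w ε s ⇔ (w ε x ⊔ w ≐ x))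

/-- `a` is an ordinal: a transitive set of sets that is well-ordered by membership -/
def ord (a : ℕ) : Fm b :=
  let s := a + 1
  let m := a + 2
  let y := a + 3
  set a ⊓ all y (y ε a ⟹ set y ⊓ sub y a) ⊓
    all s (set s ⊓ sub s a ⊓ nonempty s ⟹
      ex m (m ε s ⊓ all y (y ε s ⟹ ∼(y ε m) ⊓ (y ≐ m ⊔ m ε y))))

/-- `x` is well-founded: every set to which `x` belongs has a membership-minimal member -/
def wf (x : ℕ) : Fm b :=
  let s := x + 1
  let y := x + 2
  let z := x + 3
  all s (set s ⊓ x ε s ⟹ ex y (y ε s ⊓ all z (z ε s ⟹ ∼(z ε y))))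

/-- `x` is a well-founded set -/
def wfSet (x : ℕ) : Fm b :=
  set x ⊓ wf x

/-! ### Axioms common to both theories -/

/-- Individuals are members of classes and have no members. -/
def individuals : Fm b :=
  all 0 <| ind 0 ⟹ elem 0 ⊓ ∼(nonempty 0)

/-- Pairing -/
def pairing : Fm b :=
  all 0 <| all 1 <| elem 0 ⊓ elem 1 ⟹ ex 2 (set 2 ⊓ upair 2 0 1)

/-- Union -/
def union : Fm b :=
  all 0 <| set 0 ⟹ ex 1 (set 1 ⊓ all 2 (2 ε 1 ⇔ ex 3 (3 ε 0 ⊓ 2 ε 3)))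

/-- Power set -/
def power : Fm b :=
  all 0 <| set 0 ⟹ ex 1 (set 1 ⊓ all 2 (2 ε 1 ⇔ set 2 ⊓ sub 2 0))

/-- Replacement: the image of a set under a single-valued class is a set -/
def replacement : Fm b :=
  all 0 <| all 1 <| set 0 ⊓ cls 1 ⊓ functional 1 ⟹
    ex 2 (set 2 ⊓ all 3 (3 ε 2 ⇔ ex 4 (4 ε 0 ⊓ app 1 4 3)))

/-- Infinity -/
def infinity : Fm b :=
  ex 0 <| set 0 ⊓ ex 1 (1 ε 0 ⊓ set 1 ⊓ ∼(nonempty 1)) ⊓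
    all 1 (1 ε 0 ⟹ ex 2 (2 ε 0 ⊓ succ 2 1))

/-- Choice: a single class chooses a member of every nonempty set -/
def choice : Fm b :=
  ex 0 <| cls 0 ⊓ functional 0 ⊓
    all 1 (set 1 ⊓ nonempty 1 ⟹ ex 2 (2 ε 1 ⊓ app 0 1 2))

/-- The last bound variable is a set or an individual. -/
def elemLast (n : ℕ) : (lang b).BoundedFormula ℕ (n + 1) :=
  BoundedFormula.ex
    (Relations.boundedFormula₂ (L := lang b) (n := n + 2) Sym.mem
      (Term.var (Sum.inr (Fin.last n).castSucc)) (Term.var (Sum.inr (Fin.last (n + 1)))))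

/-- Restriction of all quantifiers to sets and individuals -/
def restrict : {n : ℕ} → (lang b).BoundedFormula ℕ n → (lang b).BoundedFormula ℕ n
  | _, .falsum => .falsum
  | _, .equal s t => .equal s t
  | _, .rel R ts => .rel R ts
  | _, .imp φ ψ => .imp (restrict φ) (restrict ψ)
  | n, .all φ => .all (elemLast n ⟹ restrict φ)

/-- Class comprehension `∃ z, ∀ x, (x ∈ z ↔ x is a set or an individual, and φ(x))`, for the
formulas `φ` in which only sets and individuals are quantified; the other free variables of `φ` are
parameters, which may be proper classes. -/
def comprehension : Set (Fm b) :=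
  {ψ | ∃ (φ : Fm b) (x z : ℕ), z ≠ x ∧ z ∉ φ.freeVarFinset ∧
    ψ = ex z (cls z ⊓ all x (x ε z ⇔ elem x ⊓ restrict φ))}

/-- Whether there are individuals (`u = true`) or only pure sets (`u = false`) -/
def existence (u : Bool) : Fm b :=
  if u then ex 0 (ind 0) else ∼(ex 0 (ind 0))

/-- The axioms other than extensionality and foundation -/
def common (u : Bool) : Set (Fm b) :=
  {existence u, individuals, pairing, union, power, replacement, infinity, choice} ∪ comprehension

/-! ### The theory NBG -/

/-- Extensionality for sets and classes -/
def extensionality : Fm false :=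
  all 0 <| all 1 <| cls 0 ⊓ cls 1 ⊓ all 2 (2 ε 0 ⇔ 2 ε 1) ⟹ 0 ≐ 1

/-- Foundation -/
def foundation : Fm false :=
  all 0 <| nonempty 0 ⟹ ex 1 (1 ε 0 ⊓ all 2 (2 ε 1 ⟹ ∼(2 ε 0)))

/-- Von Neumann–Bernays–Gödel class theory, with choice and foundation, with individuals
(`u = true`) or for pure sets (`u = false`) -/
def NBG (u : Bool) : Set (Fm false) :=
  common u ∪ {extensionality, foundation}

/-! ### Skands and the theory `NBG⁽¹⁾` -/

/-- `x` is the skand with the system of components `f` -/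
def skand (f x : ℕ) : Fm true :=
  Relations.formula₂ (L := lang true) (Sym.skand rfl) (Term.var f) (Term.var x)

/-- `a ≤ x < c`, for ordinals -/
def seg (x a c : ℕ) : Fm true :=
  (x ≐ a ⊔ a ε x) ⊓ x ε c

/-- `f` is a system of components with index segment `{x | a ≤ x < c}`, where `a < c` are ordinals:
a function on this segment whose values, the components, are well-founded sets, possibly empty -/
def system (f a c : ℕ) : Fm true :=
  let p := f + a + c + 1
  let x := f + a + c + 2
  let y := f + a + c + 3
  set f ⊓ ord a ⊓ ord c ⊓ a ε c ⊓ all p (p ε f ⟹ ex x (ex y (opair p x y))) ⊓ functional f ⊓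
    all x (seg x a c ⇔ ex y (app f x y)) ⊓ all x (all y (app f x y ⟹ wfSet y))

/-- `f` is a system of components -/
def isSystem (f : ℕ) : Fm true :=
  let a := f + 1
  let c := f + 2
  ex a (ex c (system f a c))

/-- `f` is a system of components of length at least `ω`: there is a limit ordinal `l` with
`a < l ≤ c`, where `{x | a ≤ x < c}` is the index segment of `f` -/
def longSystem (f : ℕ) : Fm true :=
  let a := f + 1
  let c := f + 2
  let l := f + 3
  let x := f + 4
  let y := f + 5
  ex a <| ex c <| system f a c ⊓
    ex l (ord l ⊓ a ε l ⊓ (l ≐ c ⊔ l ε c) ⊓ all x (x ε l ⟹ ex y (y ε l ⊓ x ε y)))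

/-- The systems `f` and `g` agree along an isomorphism `h` of their index segments. -/
def similar (f g : ℕ) : Fm true :=
  let a := f + g + 1
  let c := f + g + 2
  let a' := f + g + 3
  let c' := f + g + 4
  let h := f + g + 5
  let x := f + g + 6
  let y := f + g + 7
  let x' := f + g + 8
  let y' := f + g + 9
  ex a <| ex c <| ex a' <| ex c' <| ex h <|
    system f a c ⊓ system g a' c' ⊓ set h ⊓ functional h ⊓ injective h ⊓
    all x (seg x a c ⇔ ex y (app h x y)) ⊓
    all y (seg y a' c' ⇔ ex x (app h x y)) ⊓
    all x (all y (all x' (all y' (app h x y ⊓ app h x' y' ⟹ (x ε x' ⇔ y ε y'))))) ⊓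
    all x (all y (app h x y ⟹ all x' (app f x x' ⇔ app g y x')))

/-- `x` is a skand of length at least `ω` -/
def longSkand (x : ℕ) : Fm true :=
  let f := x + 1
  ex f (longSystem f ⊓ skand f x)

/-- Skand existence: every system of components has a skand, which is a set; it is determined by
the system, and only systems of components have skands. -/
def skandExistence : Fm true :=
  all 0 (isSystem 0 ⟹ ex 1 (skand 0 1)) ⊓
  all 0 (all 1 (skand 0 1 ⟹ isSystem 0 ⊓ set 1)) ⊓
  all 0 (all 1 (all 2 (skand 0 1 ⊓ skand 0 2 ⟹ 1 ≐ 2)))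

/-- The members of a skand with index segment `{x | a ≤ x < c}` are the members of its first
component and, if `a + 1 < c`, the skand with index segment `{x | a + 1 ≤ x < c}` that has the same
components. -/
def skandMembers : Fm true :=
  all 0 <| all 1 <| all 2 <| all 3 <| system 0 1 2 ⊓ skand 0 3 ⟹
    all 4 (4 ε 3 ⇔
      (ex 5 (app 0 1 5 ⊓ 4 ε 5) ⊔
        ex 5 (ex 6 (succ 5 1 ⊓ system 6 5 2 ⊓ sub 6 0 ⊓ skand 6 4))))

/-- Skands of length at least `ω` are equal if and only if their systems of components agree along
an isomorphism of the index segments. -/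
def skandEquality : Fm true :=
  all 0 <| all 1 <| all 2 <| all 3 <|
    longSystem 0 ⊓ longSystem 1 ⊓ skand 0 2 ⊓ skand 1 3 ⟹ (2 ≐ 3 ⇔ similar 0 1)

/-- Equality of members: equality of individuals, equality of well-founded sets, equality of skands
(of length at least `ω`) in terms of their components, or equality of arbitrary sets -/
def sameMember (x y : ℕ) : Fm true :=
  let f := x + y + 1
  let g := x + y + 2
  (ind x ⊓ ind y ⊓ x ≐ y) ⊔ (wfSet x ⊓ wfSet y ⊓ x ≐ y) ⊔
    ex f (ex g (longSystem f ⊓ longSystem g ⊓ skand f x ⊓ skand g y ⊓ similar f g)) ⊔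
    (set x ⊓ set y ⊓ x ≐ y)

/-- Strong extensionality for sets and classes -/
def strongExtensionality : Fm true :=
  all 0 <| all 1 <| cls 0 ⊓ cls 1 ⟹
    (0 ≐ 1 ⇔
      all 2 (2 ε 0 ⟹ ex 3 (3 ε 1 ⊓ sameMember 2 3)) ⊓
      all 3 (3 ε 1 ⟹ ex 2 (2 ε 0 ⊓ sameMember 2 3)))

/-- Pseudo-well-foundedness: membership is well-founded if the skands of length at least `ω` are
treated like individuals. -/
def pseudoFoundation : Fm true :=
  all 0 <| nonempty 0 ⟹ ex 1 (1 ε 0 ⊓ (longSkand 1 ⊔ all 2 (2 ε 1 ⟹ ∼(2 ε 0))))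

/-- Von Neumann's axiom: the class of all sets is in bijection with the class of all ordinals. -/
def vonNeumann : Fm true :=
  ex 0 <| cls 0 ⊓ functional 0 ⊓ injective 0 ⊓
    all 1 (set 1 ⇔ ex 2 (app 0 1 2)) ⊓ all 2 (ord 2 ⇔ ex 1 (app 0 1 2))

/-- The theory `NBG⁽¹⁾` -/
def NBG1 (u : Bool) : Set (Fm true) :=
  common u ∪ {vonNeumann, skandExistence, skandMembers, skandEquality, strongExtensionality,
    pseudoFoundation}

end Skands

open FirstOrder FirstOrder.Language

namespace Skands

section Logic

variable {L : Language}

/-! ### Semantics of named quantifiers and substitution -/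

section Semantics

variable {M : Type*} [L.Structure M]

/-! From a model of NBG a model of NBG⁽¹⁾ is built; soundness (`Provable.sound`) then excludes a
contradiction. The first model comes from completeness (`exists_model_of_consistent`). It need not
be well-founded from outside, so all set theory is done inside it: its elements form a `Universe`,
and every induction or recursion concerns classes of that universe. The type classes `Def` and
`DefFun` supply the definability proofs.

A skand of length at least ω contains its own tail, that one contains the next tail, and so on,
which contradicts foundation. But such a skand is determined by its system up to similarity, hence
by the system `F` reindexed to begin with 0 (`hat`). So it can be coded by the pair of a reserved
individual `mark` and `F`, where the components in `F` are sets in which `mark` does not occur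
hereditarily (`Tame`). A universe with such a spare individual is provided by
`exists_universe_with_atoms`. Membership is then changed: the code `pair mark F` gets as members
those of the first component of `F` and the code `pair mark (shift F)` of the tail; all other codes
keep their members (`members`).

Extensionality would fail if a set had the same members as a skand. Therefore the sets `unroll x`,
for codes `x` of skands, are removed. Two different codes of skands are never coextensive
(`unroll_injective`), so every set of codes is the extension of exactly one code. Such an
interpretation (`skandInterp`) satisfies all axioms but foundation (`Interp.toUniverse`).

In the new universe the well-founded elements are exactly the tame ones (`SkandUniverse.wfIn_iff`),
and on these membership has not changed. Hence ordinals and systems of components are the same as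
before (`ordIn_iff`, `systemIn_iff`), and the axioms on skands become statements about the old
universe. Skands of finite length are ordinary sets obtained by recursion from the end of the
segment (`exists_unfolds`). Similarity is equality of reindexed systems (`similarIn_iff`). In strong
extensionality "the same" turns out to be equality. A class without long skands has a minimal member
because on it membership is the old one. Von Neumann's axiom follows from global choice along the
cumulative hierarchy (`exists_enumeration`), which exhausts the universe since the individuals form
a set. -/

theorem realize_all_named {φ : L.Formula ℕ} {x : ℕ} {v : ℕ → M} :
    (all x φ).Realize v ↔ ∀ a, φ.Realize (Function.update v x a) := by
  unfold all Formula.Realize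
  rw [BoundedFormula.realize_all]
  refine forall_congr' fun a => ?_
  rw [BoundedFormula.realize_relabel]
  have h : (Sum.elim v ((Fin.snoc default a : Fin 1 → M) ∘ Fin.castAdd 0) ∘
      fun w => if w = x then Sum.inr (0 : Fin 1) else Sum.inl w) = Function.update v x a := by
    funext w
    by_cases hw : w = x
    · subst hw; simp [Fin.snoc]
    · simp [hw]
  rw [h]
  exact iff_of_eq (congrArg _ (Subsingleton.elim _ _))

theorem realize_ex_named {φ : L.Formula ℕ} {x : ℕ} {v : ℕ → M} :
    (ex x φ).Realize v ↔ ∃ a, φ.Realize (Function.update v x a) := by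
  simp [ex, Formula.realize_not, realize_all_named]

theorem realize_inst {φ : L.Formula ℕ} {x : ℕ} {t : L.Term ℕ} {v : ℕ → M} :
    (inst φ x t).Realize v ↔ φ.Realize (Function.update v x (t.realize v)) := by
  unfold inst Formula.Realize
  rw [BoundedFormula.realize_subst]
  have h : (fun a => ((Function.update Term.var x t : ℕ → L.Term ℕ) a).realize v) =
      Function.update v x (t.realize v) := by
    funext w
    by_cases hw : w = x
    · subst hw; simp
    · simp [hw]
  rw [h]

theorem term_realize_congr {n : ℕ} {t : L.Term (ℕ ⊕ Fin n)} {v w : ℕ → M} {xs : Fin n → M}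
    (h : ∀ i ∈ t.varFinsetLeft, v i = w i) :
    t.realize (Sum.elim v xs) = t.realize (Sum.elim w xs) := by
  induction t with
  | var a =>
    cases a with
    | inl a => simpa using h a (by simp)
    | inr a => rfl
  | func f ts ih =>
    simp only [Term.realize_func]
    congr 1
    funext i
    exact ih i fun j hj => h j (by simp only [Term.varFinsetLeft, Finset.mem_biUnion]; exact
      ⟨i, Finset.mem_univ i, hj⟩)

theorem realize_congr {n : ℕ} {φ : L.BoundedFormula ℕ n} {v w : ℕ → M} {xs : Fin n → M}
    (h : ∀ i ∈ φ.freeVarFinset, v i = w i) : φ.Realize v xs ↔ φ.Realize w xs := by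
  induction φ with
  | falsum => rfl
  | equal s t =>
    simp only [BoundedFormula.freeVarFinset, Finset.mem_union] at h
    simp only [BoundedFormula.Realize]
    rw [term_realize_congr fun i hi => h i (.inl hi), term_realize_congr fun i hi => h i (.inr hi)]
  | rel R ts =>
    simp only [BoundedFormula.freeVarFinset, Finset.mem_biUnion] at h
    simp only [BoundedFormula.Realize]
    exact iff_of_eq (congrArg _ (funext fun i =>
      term_realize_congr fun j hj => h j ⟨i, Finset.mem_univ i, hj⟩))
  | imp φ ψ ih₁ ih₂ =>
    simp only [BoundedFormula.freeVarFinset, Finset.mem_union] at h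
    exact imp_congr (ih₁ fun i hi => h i (.inl hi)) (ih₂ fun i hi => h i (.inr hi))
  | all φ ih => exact forall_congr' fun a => ih h

theorem realize_update_of_notMem {φ : L.Formula ℕ} {x : ℕ} {a : M} {v : ℕ → M}
    (h : x ∉ φ.freeVarFinset) : φ.Realize (Function.update v x a) ↔ φ.Realize v :=
  realize_congr fun i hi => Function.update_of_ne (fun e : i = x => h (e ▸ hi)) _ _

/-- Natural deduction is sound. -/
theorem Provable.sound {T : Set (L.Formula ℕ)} (hT : ∀ φ ∈ T, ∀ v : ℕ → M, φ.Realize v)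
    {Γ : List (L.Formula ℕ)} {φ : L.Formula ℕ} (h : Provable T Γ φ) (v : ℕ → M)
    (hΓ : ∀ ψ ∈ Γ, ψ.Realize v) : φ.Realize v := by
  induction h generalizing v with
  | axm h => exact hT _ h v
  | assume h => exact hΓ _ h
  | impIntro _ ih =>
    rw [Formula.realize_imp]
    exact fun h => ih v fun ψ hψ => by
      rcases List.mem_cons.1 hψ with rfl | hψ
      exacts [h, hΓ _ hψ]
  | impElim _ _ ih₁ ih₂ => exact (Formula.realize_imp.1 (ih₁ v hΓ)) (ih₂ v hΓ)
  | contra _ ih =>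
    by_contra hn
    refine ih v fun ψ hψ => ?_
    rcases List.mem_cons.1 hψ with rfl | hψ
    exacts [Formula.realize_not.2 hn, hΓ _ hψ]
  | allIntro x hx _ ih =>
    rw [realize_all_named]
    -- The variable condition concerns the assumptions only. Axioms hold under every assignment, so
    -- they put no restriction on `x`.
    exact fun a => ih _ fun ψ hψ => (realize_update_of_notMem (hx ψ hψ)).2 (hΓ ψ hψ)
  | allElim x t _ ih => exact realize_inst.2 (realize_all_named.1 (ih v hΓ) _)
  | eqRefl t => exact Formula.realize_equal.2 rfl
  | eqSubst x s t _ _ ih₁ ih₂ =>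
    have h₁ := Formula.realize_equal.1 (ih₁ v hΓ)
    have h₂ := ih₂ v hΓ
    rw [realize_inst] at h₂ ⊢
    rwa [← h₁]

theorem consistent_of_model {T : Set (L.Formula ℕ)} [Nonempty M]
    (hT : ∀ φ ∈ T, ∀ v : ℕ → M, φ.Realize v) : Consistent T := fun h =>
  h.sound hT (fun _ => Classical.arbitrary M) (by simp)

end Semantics

/-! ### Syntax of formulas of a relational language -/

section Renaming

/-- The number of connectives and quantifiers of a formula. -/
def size : {n : ℕ} → L.BoundedFormula ℕ n → ℕ
  | _, .falsum => 0
  | _, .equal _ _ => 0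
  | _, .rel _ _ => 0
  | _, .imp φ ψ => size φ + size ψ + 1
  | _, .all φ => size φ + 1

theorem size_subst {n : ℕ} (φ : L.BoundedFormula ℕ n) (f : ℕ → L.Term ℕ) :
    size (φ.subst f) = size φ := by
  induction φ with
  | falsum => rfl
  | equal s t => rfl
  | rel R ts => rfl
  | imp φ ψ ih₁ ih₂ =>
    exact congrArg₂ (fun a b => a + b + 1) ih₁ ih₂
  | all φ ih => exact congrArg (· + 1) ih

theorem size_relabel {n k : ℕ} (g : ℕ → ℕ ⊕ Fin n) (φ : L.BoundedFormula ℕ k) :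
    size (φ.relabel g) = size φ := by
  induction φ with
  | falsum => rfl
  | equal s t => rfl
  | rel R ts => rfl
  | imp φ ψ ih₁ ih₂ =>
    exact congrArg₂ (fun a b => a + b + 1) ih₁ ih₂
  | all φ ih => rw [BoundedFormula.relabel_all]; exact congrArg (· + 1) ih

theorem inst_var_self (φ : L.Formula ℕ) (x : ℕ) : inst φ x (Term.var x) = φ := by
  unfold inst
  rw [Function.update_eq_self]
  unfold BoundedFormula.subst
  have : ∀ n : ℕ, (fun t : L.Term (ℕ ⊕ Fin n) =>
      t.subst (Sum.elim (Term.relabel Sum.inl ∘ Term.var) (Term.var ∘ Sum.inr))) = id := by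
    intro n
    funext t
    induction t with
    | var a => cases a <;> rfl
    | func f ts ih => exact congrArg (Term.func f) (funext ih)
  exact (congrArg (fun ft : ∀ n, L.Term (ℕ ⊕ Fin n) → L.Term (ℕ ⊕ Fin n) =>
    BoundedFormula.mapTermRel (g := fun n => n) ft (fun _ => id) (fun _ => id) φ)
    (funext this)).trans (BoundedFormula.mapTermRel_id_id_id φ)

variable [L.IsRelational]

theorem term_eq_var {α : Type*} (t : L.Term α) : ∃ a, t = Term.var a := by
  cases t with
  | var a => exact ⟨a, rfl⟩
  | func f ts => exact isEmptyElim f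

/-- In a relational language all terms are variables, so a renaming followed by a relabelling is one
relabelling, of which only the values at free variables matter. Renaming of bound variables rests on
this. -/
theorem relabel_subst_congr {n k : ℕ} {φ : L.BoundedFormula ℕ k} {f : ℕ → ℕ}
    {g g' : ℕ → ℕ ⊕ Fin n} (h : ∀ v ∈ φ.freeVarFinset, g (f v) = g' v) :
    (φ.subst (Term.var ∘ f)).relabel g = φ.relabel g' := by
  have key : ∀ {k : ℕ} (t : L.Term (ℕ ⊕ Fin k)), (∀ v ∈ t.varFinsetLeft, g (f v) = g' v) →
      (t.subst (Sum.elim (Term.relabel Sum.inl ∘ Term.var ∘ f) (Term.var ∘ Sum.inr))).relabel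
        (BoundedFormula.relabelAux g k) = t.relabel (BoundedFormula.relabelAux g' k) := by
    intro k t ht
    obtain ⟨a, rfl⟩ := term_eq_var t
    cases a with
    | inl a =>
      have := ht a (by simp)
      simp [Term.subst, Term.relabel, BoundedFormula.relabelAux, this]
    | inr a => simp [Term.subst, Term.relabel, BoundedFormula.relabelAux]
  induction φ with
  | falsum => rfl
  | equal s t =>
    simp only [BoundedFormula.freeVarFinset, Finset.mem_union] at h
    exact congrArg₂ BoundedFormula.equal (key s fun v hv => h v (.inl hv))
      (key t fun v hv => h v (.inr hv))
  | rel R ts =>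
    simp only [BoundedFormula.freeVarFinset, Finset.mem_biUnion] at h
    exact congrArg (BoundedFormula.rel R) (funext fun i =>
      key (ts i) fun v hv => h v ⟨i, Finset.mem_univ i, hv⟩)
  | imp φ ψ ih₁ ih₂ =>
    simp only [BoundedFormula.freeVarFinset, Finset.mem_union] at h
    exact congrArg₂ BoundedFormula.imp (ih₁ fun v hv => h v (.inl hv))
      (ih₂ fun v hv => h v (.inr hv))
  | all φ ih =>
    have : (BoundedFormula.all φ).subst (Term.var ∘ f) =
      BoundedFormula.all (φ.subst (Term.var ∘ f)) := rfl
    rw [this, BoundedFormula.relabel_all, BoundedFormula.relabel_all, ih h]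

/-- Renaming of a bound variable -/
theorem all_inst_var {φ : L.Formula ℕ} {x y : ℕ} (hy : y ∉ φ.freeVarFinset) :
    all y (inst φ x (Term.var y)) = all x φ := by
  have h : (Function.update Term.var x (Term.var y) : ℕ → L.Term ℕ) =
      Term.var ∘ Function.update id x y := by
    funext v
    by_cases hv : v = x
    · subst hv; simp
    · simp [hv]
  unfold all inst
  rw [h, relabel_subst_congr]
  intro v hv
  by_cases hx : v = x
  · subst hx; simp
  · have : v ≠ y := fun e => hy (e ▸ hv)
    simp [hx, this]

theorem mem_freeVarFinset_relabel {n k : ℕ} {φ : L.BoundedFormula ℕ k} {g : ℕ → ℕ ⊕ Fin n} {x : ℕ}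
    (hx : x ∈ (φ.relabel g).freeVarFinset) : ∃ y ∈ φ.freeVarFinset, g y = Sum.inl x := by
  have key : ∀ {k : ℕ} (t : L.Term (ℕ ⊕ Fin k)),
      x ∈ (t.relabel (BoundedFormula.relabelAux g k)).varFinsetLeft →
      ∃ y ∈ t.varFinsetLeft, g y = Sum.inl x := by
    intro k t ht
    obtain ⟨a, rfl⟩ := term_eq_var t
    cases a with
    | inl a =>
      refine ⟨a, by simp, ?_⟩
      cases hg : g a with
      | inl b =>
        simp [Term.relabel, BoundedFormula.relabelAux, hg] at ht
        rw [ht]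
      | inr b => simp [Term.relabel, BoundedFormula.relabelAux, hg] at ht
    | inr a => simp [Term.relabel, BoundedFormula.relabelAux] at ht
  induction φ with
  | falsum => simp at hx
  | equal s t =>
    rcases Finset.mem_union.1 hx with h | h
    · obtain ⟨y, hy, e⟩ := key _ h
      exact ⟨y, Finset.mem_union_left _ hy, e⟩
    · obtain ⟨y, hy, e⟩ := key _ h
      exact ⟨y, Finset.mem_union_right _ hy, e⟩
  | rel R ts =>
    obtain ⟨i, hi, h⟩ := Finset.mem_biUnion.1 hx
    obtain ⟨y, hy, e⟩ := key _ h
    exact ⟨y, Finset.mem_biUnion.2 ⟨i, hi, hy⟩, e⟩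
  | imp φ ψ ih₁ ih₂ =>
    rcases Finset.mem_union.1 hx with h | h
    · obtain ⟨y, hy, e⟩ := ih₁ h
      exact ⟨y, Finset.mem_union_left _ hy, e⟩
    · obtain ⟨y, hy, e⟩ := ih₂ h
      exact ⟨y, Finset.mem_union_right _ hy, e⟩
  | all φ ih => rw [BoundedFormula.relabel_all] at hx; exact ih hx

theorem notMem_freeVarFinset_all (φ : L.Formula ℕ) (x : ℕ) : x ∉ (all x φ).freeVarFinset := by
  intro h
  obtain ⟨y, -, e⟩ := mem_freeVarFinset_relabel (φ := φ) h
  by_cases hy : y = x <;> simp [hy] at e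

/-- A name that is not free in `θ` can be given to the outermost nameless variable, which inverts
the binding in `all`. The induction passes under quantifiers, hence the general `k`; the equation
`hk` is kept as a hypothesis because the induction varies `n`. -/
theorem exists_relabel_eq {n : ℕ} (θ : L.BoundedFormula ℕ n) {k : ℕ} (hk : n = 1 + k) {x : ℕ}
    (hx : x ∉ θ.freeVarFinset) : ∃ φ : L.BoundedFormula ℕ k,
      φ.relabel (fun v => if v = x then Sum.inr (0 : Fin 1) else Sum.inl v) = hk ▸ θ := by
  have key : ∀ {k : ℕ} (t : L.Term (ℕ ⊕ Fin (1 + k))), x ∉ t.varFinsetLeft →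
      ∃ s : L.Term (ℕ ⊕ Fin k), s.relabel (BoundedFormula.relabelAux
        (fun v => if v = x then Sum.inr (0 : Fin 1) else Sum.inl v) k) = t := by
    intro k t ht
    obtain ⟨a, rfl⟩ := term_eq_var t
    cases a with
    | inl a =>
      have : a ≠ x := by rintro rfl; simp at ht
      exact ⟨Term.var (Sum.inl a), by simp [Term.relabel, BoundedFormula.relabelAux, this]⟩
    | inr a =>
      refine Fin.addCases (fun i => ?_) (fun i => ?_) a
      · refine ⟨Term.var (Sum.inl x), ?_⟩
        rw [Subsingleton.elim i 0]
        simp [Term.relabel, BoundedFormula.relabelAux]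
      · exact ⟨Term.var (Sum.inr i), by simp [Term.relabel, BoundedFormula.relabelAux]⟩
  induction θ generalizing k with
  | falsum => subst hk; exact ⟨.falsum, rfl⟩
  | equal s t =>
    subst hk
    simp only [BoundedFormula.freeVarFinset, Finset.mem_union, not_or] at hx
    obtain ⟨s, rfl⟩ := key s hx.1
    obtain ⟨t, rfl⟩ := key t hx.2
    exact ⟨.equal s t, rfl⟩
  | rel R ts =>
    subst hk
    simp only [BoundedFormula.freeVarFinset, Finset.mem_biUnion, not_exists, not_and] at hx
    choose f hf using fun i => key (ts i) (hx i (Finset.mem_univ i))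
    exact ⟨.rel R f, congrArg (BoundedFormula.rel R) (funext hf)⟩
  | imp φ ψ ih₁ ih₂ =>
    simp only [BoundedFormula.freeVarFinset, Finset.mem_union, not_or] at hx
    obtain ⟨φ', h₁⟩ := ih₁ hk hx.1
    obtain ⟨ψ', h₂⟩ := ih₂ hk hx.2
    subst hk
    exact ⟨.imp φ' ψ', congrArg₂ BoundedFormula.imp h₁ h₂⟩
  | all φ ih =>
    subst hk
    obtain ⟨φ', h⟩ := ih (k := k + 1) rfl hx
    exact ⟨.all φ', by rw [BoundedFormula.relabel_all, h]⟩

/-- The deduction rules only mention quantifiers of the named form `all x φ`; this brings every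
quantifier into that form. -/
theorem exists_eq_all (θ : L.BoundedFormula ℕ 1) :
    ∃ (x : ℕ) (φ : L.Formula ℕ), all x φ = BoundedFormula.all θ ∧ size φ = size θ := by
  obtain ⟨x, hx⟩ := Infinite.exists_notMem_finset θ.freeVarFinset
  obtain ⟨φ, h⟩ := exists_relabel_eq θ (k := 0) rfl hx
  refine ⟨x, φ, congrArg BoundedFormula.all h, ?_⟩
  have := size_relabel (fun v => if v = x then Sum.inr (0 : Fin 1) else Sum.inl v) φ
  rw [← this, h]

end Renaming

/-! ### The completeness theorem -/

section Completeness

variable {T : Set (L.Formula ℕ)} {φ ψ χ : L.Formula ℕ}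

theorem provable_imp_self : Provable T [] (φ ⟹ φ) :=
  .impIntro (.assume (by simp))

theorem Provable.const (h : Provable T [] φ) : Provable T [] (ψ ⟹ φ) :=
  .impElim (.impIntro (.impIntro (.assume (by simp)))) h

theorem provable_distrib : Provable T [] ((χ ⟹ φ ⟹ ψ) ⟹ (χ ⟹ φ) ⟹ χ ⟹ ψ) :=
  .impIntro <| .impIntro <| .impIntro <|
    .impElim (φ := φ) (.impElim (φ := χ) (.assume (by simp)) (.assume (by simp)))
      (.impElim (φ := χ) (.assume (by simp)) (.assume (by simp)))

theorem Provable.mp_under (h : Provable T [] (χ ⟹ φ ⟹ ψ)) (h' : Provable T [] (χ ⟹ φ)) :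
    Provable T [] (χ ⟹ ψ) :=
  .impElim (.impElim provable_distrib h) h'

theorem Provable.trans (h : Provable T [] (φ ⟹ ψ)) (h' : Provable T [] (ψ ⟹ χ)) :
    Provable T [] (φ ⟹ χ) :=
  h'.const.mp_under h

theorem provable_and_left : Provable T [] (φ ⊓ ψ ⟹ φ) :=
  .impIntro <| .contra <| .impElim (φ := φ ⟹ ∼ψ) (.assume (by simp; right; rfl)) <|
    .impIntro <| .contra <| .impElim (φ := φ) (.assume (by simp; tauto)) (.assume (by simp))

theorem provable_and_right : Provable T [] (φ ⊓ ψ ⟹ ψ) :=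
  .impIntro <| .contra <| .impElim (φ := φ ⟹ ∼ψ) (.assume (by simp; right; rfl)) <|
    .impIntro <| .assume (by simp)

theorem provable_of_and_imp_bot (h : Provable T [] (χ ⊓ φ ⟹ ⊥)) : Provable T [] (χ ⟹ ∼φ) :=
  .impElim (φ := χ ⊓ φ ⟹ ⊥)
    (.impIntro <| .impIntro <| .impIntro (ψ := ⊥) <|
      .impElim (φ := χ ⊓ φ) (.assume (by simp)) <| .impIntro (ψ := ⊥) <|
        .impElim (φ := φ) (.impElim (φ := χ) (ψ := ∼φ) (.assume (by simp)) (.assume (by simp)))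
          (.assume (by simp))) h

theorem provable_not_not : Provable T [] (∼(∼φ) ⟹ φ) :=
  .impIntro <| .contra <| .impElim (φ := ∼φ) (.assume (by simp; right; rfl)) (.assume (by simp))

theorem provable_of_and_not_imp_bot (h : Provable T [] (χ ⊓ ∼φ ⟹ ⊥)) : Provable T [] (χ ⟹ φ) :=
  (provable_of_and_imp_bot h).trans provable_not_not

theorem provable_imp_all [L.IsRelational] {x : ℕ} (hx : x ∉ χ.freeVarFinset)
    (h : Provable T [] (χ ⟹ φ)) : Provable T [] (χ ⟹ all x φ) := by
  have h₁ : Provable T [] (all x (χ ⟹ φ)) := .allIntro x (by simp) h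
  refine .impElim (φ := all x (χ ⟹ φ)) (.impIntro <| .impIntro <| .allIntro x ?_ ?_) h₁
  · intro ψ hψ
    simp only [List.mem_cons, List.not_mem_nil, or_false] at hψ
    rcases hψ with rfl | rfl
    exacts [hx, notMem_freeVarFinset_all _ _]
  · refine .impElim (φ := χ) ?_ (.assume (by simp))
    have : Provable T [χ, all x (χ ⟹ φ)] (inst (χ ⟹ φ) x (Term.var x)) :=
      .allElim x _ (.assume (by simp))
    rwa [inst_var_self] at this

/-- A maximal consistent set of formulas with witnesses for its existential formulas -/
structure IsHenkin (T Δ : Set (L.Formula ℕ)) : Prop where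
  of_provable {φ : L.Formula ℕ} : Provable T [] φ → φ ∈ Δ
  mp {φ ψ : L.Formula ℕ} : φ ⟹ ψ ∈ Δ → φ ∈ Δ → ψ ∈ Δ
  bot_notMem : ⊥ ∉ Δ
  mem_or_not_mem (φ : L.Formula ℕ) : φ ∈ Δ ∨ ∼φ ∈ Δ
  witness (x : ℕ) (φ : L.Formula ℕ) : all x φ ∈ Δ ∨ ∃ y, ∼(inst φ x (Term.var y)) ∈ Δ

/-- The formulas consistent with a theory, ordered by provable implication -/
def ConsistentWith (T : Set (L.Formula ℕ)) : Type _ :=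
  {γ : L.Formula ℕ // ¬ Provable T [] (γ ⟹ ⊥)}

/-- Stronger formulas are larger. Cofinal sets are then dense sets of conditions, and an ideal is a
directed family of formulas each consistent with `T`. -/
instance : Preorder (ConsistentWith T) where
  le γ δ := Provable T [] (δ.1 ⟹ γ.1)
  le_refl _ := provable_imp_self
  le_trans _ _ _ h h' := h'.trans h

/-- If `φ` cannot be added to `γ` consistently, then `γ` already refutes it. -/
theorem isCofinal_decides (φ : L.Formula ℕ) :
    IsCofinal {γ : ConsistentWith T | Provable T [] (γ.1 ⟹ φ) ∨ Provable T [] (γ.1 ⟹ ∼φ)} := by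
  rintro ⟨γ, hγ⟩
  by_cases h : Provable T [] (γ ⊓ φ ⟹ ⊥)
  · exact ⟨⟨γ, hγ⟩, .inr (provable_of_and_imp_bot h), provable_imp_self⟩
  · exact ⟨⟨γ ⊓ φ, h⟩, .inl provable_and_right, provable_and_left⟩

/-- Henkin witnesses without new constants: a variable `y` that is free neither in `γ` nor in `φ`
serves. If `γ` refuted this counterexample, generalization over `y` would derive `all x φ` from `γ`.
-/
theorem isCofinal_witness [L.IsRelational] (x : ℕ) (φ : L.Formula ℕ) :
    IsCofinal {γ : ConsistentWith T | Provable T [] (γ.1 ⟹ all x φ) ∨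
      ∃ y, Provable T [] (γ.1 ⟹ ∼(inst φ x (Term.var y)))} := by
  rintro ⟨γ, hγ⟩
  obtain ⟨y, hy⟩ := Infinite.exists_notMem_finset (γ.freeVarFinset ∪ φ.freeVarFinset)
  rw [Finset.notMem_union] at hy
  by_cases h : Provable T [] (γ ⊓ ∼(inst φ x (Term.var y)) ⟹ ⊥)
  · refine ⟨⟨γ, hγ⟩, .inl ?_, provable_imp_self⟩
    have := provable_imp_all hy.1 (provable_of_and_not_imp_bot h)
    rwa [all_inst_var hy.2] at this
  · exact ⟨⟨_, h⟩, .inr ⟨y, provable_and_right⟩, provable_and_left⟩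

/-- The Rasiowa–Sikorski argument: there are only countably many formulas, so one ideal meets all
the cofinal sets of `isCofinal_decides` and `isCofinal_witness`; the consequences of its members
form the required set. -/
theorem exists_isHenkin [L.IsRelational] [Countable L.Symbols] (hT : Consistent T) :
    ∃ Δ : Set (L.Formula ℕ), IsHenkin T Δ := by
  have := Encodable.ofCountable (L.Formula ℕ)
  let D : L.Formula ℕ ⊕ ℕ × L.Formula ℕ → Order.Cofinal (ConsistentWith T) :=
    Sum.elim (fun φ => ⟨_, isCofinal_decides φ⟩) fun p => ⟨_, isCofinal_witness p.1 p.2⟩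
  -- The ideal starts from a trivially true formula; that this is a condition is exactly the
  -- consistency of `T`.
  let p : ConsistentWith T := ⟨∼⊥, fun h => hT (h.impElim provable_imp_self)⟩
  let I := Order.idealOfCofinals p D
  refine ⟨{φ | ∃ γ ∈ I, Provable T [] (γ.1 ⟹ φ)}, ?_, ?_, ?_, ?_, ?_⟩
  · exact fun h => ⟨p, Order.mem_idealOfCofinals p D, h.const⟩
  · rintro φ ψ ⟨γ, hγ, h⟩ ⟨δ, hδ, h'⟩
    obtain ⟨ε, hε, hγε, hδε⟩ := I.directed γ hγ δ hδ
    exact ⟨ε, hε, (Provable.trans hγε h).mp_under (Provable.trans hδε h')⟩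
  · rintro ⟨γ, -, h⟩
    exact γ.2 h
  · intro φ
    obtain ⟨γ, h | h, hγ⟩ := Order.cofinal_meets_idealOfCofinals p D (.inl φ)
    exacts [.inl ⟨γ, hγ, h⟩, .inr ⟨γ, hγ, h⟩]
  · intro x φ
    obtain ⟨γ, h | ⟨y, h⟩, hγ⟩ := Order.cofinal_meets_idealOfCofinals p D (.inr (x, φ))
    exacts [.inl ⟨γ, hγ, h⟩, .inr ⟨y, γ, hγ, h⟩]

namespace IsHenkin

variable {Δ : Set (L.Formula ℕ)}

theorem mp_provable (h : IsHenkin T Δ) (h' : Provable T [] (φ ⟹ ψ)) (hφ : φ ∈ Δ) : ψ ∈ Δ :=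
  h.mp (h.of_provable h') hφ

theorem not_mem_iff (h : IsHenkin T Δ) : ∼φ ∈ Δ ↔ φ ∉ Δ :=
  ⟨fun h₁ h₂ => h.bot_notMem (h.mp h₁ h₂), (h.mem_or_not_mem φ).resolve_left⟩

theorem imp_mem_iff (h : IsHenkin T Δ) : φ ⟹ ψ ∈ Δ ↔ (φ ∈ Δ → ψ ∈ Δ) := by
  refine ⟨h.mp, fun h' => ?_⟩
  by_cases hφ : φ ∈ Δ
  · exact h.mp_provable (.impIntro (.impIntro (.assume (by simp)))) (h' hφ)
  · refine h.mp_provable (φ := ∼φ) (.impIntro (.impIntro (.contra ?_))) (h.not_mem_iff.2 hφ)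
    exact .impElim (φ := φ) (.assume (by simp; right; right; rfl)) (.assume (by simp))

theorem all_mem_iff (h : IsHenkin T Δ) {x : ℕ} :
    all x φ ∈ Δ ↔ ∀ y, inst φ x (Term.var y) ∈ Δ := by
  refine ⟨fun h' y => h.mp_provable (.impIntro (.allElim x _ (.assume (by simp)))) h', fun h' => ?_⟩
  refine (h.witness x φ).resolve_right ?_
  rintro ⟨y, hy⟩
  exact h.not_mem_iff.1 hy (h' y)

theorem inst_mem (h : IsHenkin T Δ) {x i j : ℕ}
    (hij : (Term.var i).equal (Term.var j) ∈ Δ) (hi : inst φ x (Term.var i) ∈ Δ) :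
    inst φ x (Term.var j) ∈ Δ :=
  h.mp (h.mp_provable (.impIntro (.impIntro
    (.eqSubst x _ _ (.assume (List.mem_cons_of_mem _ (List.mem_singleton_self _)))
      (.assume (by simp))))) hij) hi

theorem inst_equal_var {x i j : ℕ} (hx : x ≠ j) :
    inst ((Term.var x : L.Term ℕ).equal (Term.var j)) x (Term.var i) =
      (Term.var i).equal (Term.var j) := by
  simp [inst, Term.equal, Term.bdEqual, BoundedFormula.subst, BoundedFormula.mapTermRel,
    Term.subst, Term.relabel, hx.symm]

/-- Provable equality of variables -/
def setoid (h : IsHenkin T Δ) : Setoid ℕ where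
  r i j := (Term.var i).equal (Term.var j) ∈ Δ
  iseqv := by
    have symm : ∀ {i j : ℕ}, (Term.var i : L.Term ℕ).equal (Term.var j) ∈ Δ →
        (Term.var j : L.Term ℕ).equal (Term.var i) ∈ Δ := by
      intro i j hij
      -- The template "`i + 1` equals `i`" has a variable different from `i` in the place to be
      -- substituted: with `i` it becomes reflexivity, with `j` the claim.
      have := h.inst_mem (φ := (Term.var (i + 1)).equal (Term.var i)) (x := i + 1) hij
      rw [inst_equal_var (by simp), inst_equal_var (by simp)] at this
      exact this (h.of_provable (.eqRefl _))
    refine ⟨fun i => h.of_provable (.eqRefl _), symm, fun {i j k} hij hjk => ?_⟩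
    have := h.inst_mem (φ := (Term.var (k + 1)).equal (Term.var k)) (x := k + 1) (symm hij)
    rw [inst_equal_var (by simp), inst_equal_var (by simp)] at this
    exact this hjk

/-- The term model -/
def Model (h : IsHenkin T Δ) : Type :=
  Quotient h.setoid

/-- The element of the term model named by a variable -/
def toModel (h : IsHenkin T Δ) (i : ℕ) : h.Model :=
  Quotient.mk h.setoid i

/-- The rule `eqSubst` exchanges one variable, so the arguments are exchanged one position at a
time, by induction on the set of positions already done. A variable `x` different from all present
arguments marks the next position, lest equal arguments elsewhere be replaced as well. -/
theorem rel_mem (h : IsHenkin T Δ) {n : ℕ} {R : L.Relations n} {is js : Fin n → ℕ}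
    (hij : ∀ k, h.setoid.r (is k) (js k))
    (hi : (BoundedFormula.rel R fun k => Term.var (Sum.inl (is k)) : L.Formula ℕ) ∈ Δ) :
    (BoundedFormula.rel R fun k => Term.var (Sum.inl (js k)) : L.Formula ℕ) ∈ Δ := by
  classical
  suffices H : ∀ s : Finset (Fin n),
      (BoundedFormula.rel R fun k => Term.var (Sum.inl (s.piecewise js is k)) : L.Formula ℕ) ∈ Δ by
    simpa using H Finset.univ
  intro s
  induction s using Finset.induction_on with
  | empty => simpa using hi
  | insert a s ha ih =>
    obtain ⟨x, hx⟩ := Infinite.exists_notMem_finset (Finset.univ.image (s.piecewise js is))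
    have hx' : ∀ k, s.piecewise js is k ≠ x := fun k e =>
      hx (Finset.mem_image.2 ⟨k, Finset.mem_univ k, e⟩)
    have key : ∀ i, inst (BoundedFormula.rel R fun k =>
        Term.var (Sum.inl (Function.update (s.piecewise js is) a x k)) : L.Formula ℕ) x
        (Term.var i) = (BoundedFormula.rel R fun k =>
        Term.var (Sum.inl (Function.update (s.piecewise js is) a i k)) : L.Formula ℕ) := by
      intro i
      refine congrArg (BoundedFormula.rel R) (funext fun k => ?_)
      by_cases hk : k = a
      · subst hk; simp [Term.subst, Term.relabel]
      · simp [hk, Term.subst, Term.relabel, Function.update_of_ne (hx' k)]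
    have h₁ := h.inst_mem (hij a) (x := x) (φ := (BoundedFormula.rel R fun k =>
        Term.var (Sum.inl (Function.update (s.piecewise js is) a x k)) : L.Formula ℕ))
    rw [key, key] at h₁
    rw [Finset.piecewise_insert]
    refine h₁ ?_
    convert ih using 5 with k
    by_cases hk : k = a
    · subst hk; simp [ha]
    · simp [hk]

variable [L.IsRelational]

/-- A relation holds if it is in `Δ` for some representatives; by `rel_mem` it is then in `Δ` for
all. -/
instance (h : IsHenkin T Δ) : L.Structure h.Model where
  funMap f := isEmptyElim f
  RelMap R xs := ∃ is : Fin _ → ℕ, (∀ j, h.toModel (is j) = xs j) ∧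
    BoundedFormula.rel R (fun j => Term.var (Sum.inl (is j))) ∈ Δ

/-- The truth lemma. The induction is on `size`, because the instances of `all x φ` are not its
subformulas but have the size of `φ`. Variables name all elements of the model, so instances by
variables are enough. -/
theorem mem_iff_realize (h : IsHenkin T Δ) (φ : L.Formula ℕ) :
    φ ∈ Δ ↔ φ.Realize h.toModel := by
  induction hn : size φ using Nat.strong_induction_on generalizing φ with
  | h n ih =>
    have atom : ∀ t : L.Term (ℕ ⊕ Fin 0), ∃ i, t = Term.var (Sum.inl i) := by
      intro t
      obtain ⟨i | i, rfl⟩ := term_eq_var t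
      exacts [⟨i, rfl⟩, i.elim0]
    cases φ with
    | falsum => exact iff_of_false h.bot_notMem id
    | equal s t =>
      obtain ⟨i, rfl⟩ := atom s
      obtain ⟨j, rfl⟩ := atom t
      exact (Quotient.eq (r := h.setoid)).symm
    | rel R ts =>
      choose is his using fun i => atom (ts i)
      obtain rfl : ts = fun k => Term.var (Sum.inl (is k)) := funext his
      constructor
      · exact fun h' => ⟨is, fun _ => rfl, h'⟩
      · rintro ⟨js, hjs, h'⟩
        exact h.rel_mem (fun k => Quotient.exact (hjs k)) h'
    | imp φ ψ =>
      simp only [size] at hn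
      exact h.imp_mem_iff.trans (imp_congr (ih _ (by omega) φ rfl) (ih _ (by omega) ψ rfl))
    | all θ =>
      obtain ⟨x, φ, e, hs⟩ := exists_eq_all θ
      simp only [size] at hn
      rw [← e, h.all_mem_iff, realize_all_named]
      constructor
      · intro h' a
        induction a using Quotient.inductionOn with
        | h y =>
          have := (ih (size φ) (by omega) (inst φ x (Term.var y)) (size_subst _ _)).1 (h' y)
          rwa [realize_inst] at this
      · intro h' y
        refine (ih (size φ) (by omega) (inst φ x (Term.var y)) (size_subst _ _)).2 ?_
        rw [realize_inst]
        exact h' _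

end IsHenkin

theorem realize_of_realize_alls {M : Type*} [L.Structure M] {l : List ℕ} {v w : ℕ → M}
    (h : (l.foldr all φ).Realize v) (hw : ∀ i ∉ l, v i = w i) : φ.Realize w := by
  induction l generalizing v with
  | nil => rwa [← funext fun i => hw i (by simp)]
  | cons x l ih =>
    refine ih (realize_all_named.1 h (w x)) fun i hi => ?_
    by_cases hx : i = x
    · subst hx; simp
    · rw [Function.update_of_ne hx]
      exact hw i (by simp [hx, hi])

theorem provable_alls (h : Provable T [] φ) (l : List ℕ) : Provable T [] (l.foldr all φ) := by
  induction l with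
  | nil => exact h
  | cons x l ih => exact .allIntro x (by simp) ih

/-- The completeness theorem for countable relational languages: a consistent theory has a model,
which moreover is countable. -/
theorem exists_model_of_consistent [L.IsRelational] [Countable L.Symbols] (hT : Consistent T) :
    ∃ (M : Type) (_ : L.Structure M), (∀ φ ∈ T, ∀ v : ℕ → M, φ.Realize v) ∧
      ∃ v : ℕ → M, Function.Surjective v := by
  obtain ⟨Δ, h⟩ := exists_isHenkin hT
  refine ⟨h.Model, inferInstance, fun φ hφ v => ?_, h.toModel,
    Quotient.mk_surjective⟩
  -- An axiom has to hold under all assignments, not only the canonical one. This follows from the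
  -- truth of its universal closure, which is derivable.
  have h₁ := (h.mem_iff_realize _).1 (h.of_provable
    (provable_alls (.axm hφ) φ.freeVarFinset.toList))
  let w : ℕ → h.Model := fun i => if i ∈ φ.freeVarFinset then v i else h.toModel i
  have h₂ : φ.Realize w := realize_of_realize_alls h₁ fun i hi => by
    rw [Finset.mem_toList] at hi
    exact (if_neg hi).symm
  exact (realize_congr fun i hi => if_pos hi).1 h₂

end Completeness

end Logic

end Skands

/-! ### Class theory, semantically -/

namespace ClassTheory

/-- A membership relation with atoms, and a notion of class -/
class MemStructure (V : Type) where
  /-- Membership -/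
  E : V → V → Prop
  /-- Being an individual -/
  Atom : V → Prop
  /-- The subsets that are classes -/
  IsClass : Set V → Prop
  /-- The universe is not empty. -/
  nonempty : Nonempty V

open MemStructure (Atom IsClass)

attribute [instance] MemStructure.nonempty

infix:50 " ∊ " => MemStructure.E

section MemStructure

variable {V : Type} [MemStructure V]

/-- `S` is the extension of a set. -/
def Small (S : Set V) : Prop :=
  ∃ x, ¬ Atom x ∧ ∀ y, y ∊ x ↔ y ∈ S

open Classical in
/-- The set with the extension `S`, and the empty set if there is none -/
noncomputable def mkSet (S : Set V) : V :=
  if h : Small S then h.choose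
  else if h : Small (∅ : Set V) then h.choose else Classical.arbitrary V

/-- The ordered pair -/
noncomputable def pair (x y : V) : V :=
  mkSet {z | z = mkSet {w | w = x} ∨ z = mkSet {w | w = x ∨ w = y}}

theorem mem_mkSet {S : Set V} (h : Small S) {y : V} : y ∊ mkSet S ↔ y ∈ S := by
  unfold mkSet
  rw [dif_pos h]
  exact h.choose_spec.2 y

theorem mkSet_injective {S T : Set V} (hS : Small S) (hT : Small T) (h : mkSet S = mkSet T) :
    S = T :=
  Set.ext fun y => by rw [← mem_mkSet hS, h, mem_mkSet hT]

/-- Pairing is the only axiom used, as `mkSet` depends on the extension alone. Thus the lemma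
applies to an interpretation before that is known to be a universe. -/
theorem pair_injective_of (hp : ∀ x y : V, Small {z | z = x ∨ z = y}) {a b c d : V}
    (h : pair a b = pair c d) : a = c ∧ b = d := by
  have hs : ∀ x : V, Small {z | z = x} := fun x => by simpa using hp x x
  have h₁ := mkSet_injective (hp _ _) (hp _ _) h
  have key : ∀ {a b c d : V},
      ({z | z = mkSet {w | w = a} ∨ z = mkSet {w | w = a ∨ w = b}} : Set V) =
      {z | z = mkSet {w | w = c} ∨ z = mkSet {w | w = c ∨ w = d}} → a = c := by
    intro a b c d h
    have h' : mkSet {w | w = a} ∈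
        ({z | z = mkSet {w | w = c} ∨ z = mkSet {w | w = c ∨ w = d}} : Set V) :=
      h ▸ Or.inl rfl
    rcases h' with e | e
    · have := mkSet_injective (hs _) (hs _) e
      exact (this ▸ rfl : a ∈ {w | w = c})
    · have := mkSet_injective (hs _) (hp _ _) e
      exact (this ▸ Or.inl rfl : c ∈ {w | w = a}).symm
  obtain rfl := key h₁
  refine ⟨rfl, ?_⟩
  have key' : ∀ {b d : V}, ({z | z = mkSet {w | w = a} ∨ z = mkSet {w | w = a ∨ w = b}} : Set V) =
      {z | z = mkSet {w | w = a} ∨ z = mkSet {w | w = a ∨ w = d}} → b = a ∨ b = d := by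
    intro b d h
    have h' : mkSet {w | w = a ∨ w = b} ∈
      ({z | z = mkSet {w | w = a} ∨ z = mkSet {w | w = a ∨ w = d}} : Set V) := h ▸ Or.inr rfl
    rcases h' with e | e
    · have := mkSet_injective (hp _ _) (hs _) e
      exact .inl (this ▸ Or.inr rfl : b ∈ {w | w = a})
    · have := mkSet_injective (hp _ _) (hp _ _) e
      exact (this ▸ Or.inr rfl : b ∈ {w | w = a ∨ w = d})
  rcases key' h₁ with e | e
  · rcases key' h₁.symm with e' | e'
    exacts [e.trans e'.symm, e'.symm]
  · exact e

/-- The predicates that are defined by formulas in which only elements are quantified, with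
classes as parameters -/
inductive Predicative : {n : ℕ} → ((Fin n → V) → Prop) → Prop
  | falsum {n} : Predicative fun _ : Fin n → V => False
  | mem {n} (i j : Fin n) : Predicative fun v : Fin n → V => v i ∊ v j
  | eq {n} (i j : Fin n) : Predicative fun v : Fin n → V => v i = v j
  | atom {n} (i : Fin n) : Predicative fun v : Fin n → V => Atom (v i)
  | cls {n} {X : Set V} (hX : IsClass X) (i : Fin n) : Predicative fun v : Fin n → V => v i ∈ X
  | imp {n} {P Q : (Fin n → V) → Prop} : Predicative P → Predicative Q →
      Predicative fun v => P v → Q v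
  | all {n} {P : (Fin (n + 1) → V) → Prop} : Predicative P →
      Predicative fun v : Fin n → V => ∀ x, P (Fin.snoc v x)

end MemStructure

/-- The axioms of class theory without foundation -/
class Universe (V : Type) extends MemStructure V where
  not_mem_of_atom {x y : V} : Atom x → ¬ y ∊ x
  ext' {x y : V} : ¬ Atom x → ¬ Atom y → (∀ z, z ∊ x ↔ z ∊ y) → x = y
  isClass_mem (x : V) : IsClass {y | y ∊ x}
  comprehension {P : (Fin 1 → V) → Prop} : Predicative P → IsClass {x | P fun _ => x}
  pairing (x y : V) : Small {z | z = x ∨ z = y}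
  union {x : V} : ¬ Atom x → Small {z | ∃ y, y ∊ x ∧ z ∊ y}
  power {x : V} : ¬ Atom x → Small {y | ¬ Atom y ∧ ∀ z, z ∊ y → z ∊ x}
  replacement {x : V} {F : Set V} : ¬ Atom x → IsClass F →
    (∀ a b c, pair a b ∈ F → pair a c ∈ F → b = c) → Small {z | ∃ y, y ∊ x ∧ pair y z ∈ F}
  infinity : ∃ x : V, ¬ Atom x ∧ (∃ e, e ∊ x ∧ ¬ Atom e ∧ ∀ y, ¬ y ∊ e) ∧
    ∀ y, y ∊ x → ∃ z, z ∊ x ∧ ¬ Atom z ∧ ∀ w, w ∊ z ↔ w ∊ y ∨ w = y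
  choice : ∃ F : Set V, IsClass F ∧ (∀ a b c, pair a b ∈ F → pair a c ∈ F → b = c) ∧
    ∀ x, ¬ Atom x → (∃ y, y ∊ x) → ∃ y, y ∊ x ∧ pair x y ∈ F

/-- The axiom of foundation for classes -/
class Founded (V : Type) [Universe V] : Prop where
  foundation {X : Set V} : IsClass X → X.Nonempty → ∃ x ∈ X, ∀ y, y ∊ x → y ∉ X

variable {V : Type} [Universe V]

/-! #### Sets from their extensions -/

theorem ext {x y : V} (hx : ¬ Atom x) (hy : ¬ Atom y) (h : ∀ z, z ∊ x ↔ z ∊ y) : x = y :=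
  Universe.ext' hx hy h

theorem not_atom_of_mem {x y : V} (h : y ∊ x) : ¬ Atom x := fun hx =>
  Universe.not_mem_of_atom hx h

theorem small_empty : Small (∅ : Set V) := by
  obtain ⟨x, -, ⟨e, -, he, h⟩, -⟩ := Universe.infinity (V := V)
  exact ⟨e, he, fun y => by simp [h]⟩

theorem not_atom_mkSet (S : Set V) : ¬ Atom (mkSet S) := by
  unfold mkSet
  split_ifs with h h'
  exacts [h.choose_spec.1, h'.choose_spec.1, (h' small_empty).elim]

theorem mkSet_of_not_small {S : Set V} (h : ¬ Small S) : mkSet S = mkSet ∅ := by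
  unfold mkSet
  rw [dif_neg h, dif_pos small_empty, dif_pos small_empty]

theorem not_mem_mkSet_empty {y : V} : ¬ y ∊ mkSet (∅ : Set V) := by
  simp [mem_mkSet small_empty]

theorem eq_mkSet_iff {S : Set V} {x : V} (h : Small S) :
    x = mkSet S ↔ ¬ Atom x ∧ ∀ y, y ∊ x ↔ y ∈ S := by
  constructor
  · rintro rfl
    exact ⟨not_atom_mkSet _, fun _ => mem_mkSet h⟩
  · exact fun ⟨h₁, h₂⟩ => ext h₁ (not_atom_mkSet _) fun y => (h₂ y).trans (mem_mkSet h).symm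

theorem small_singleton (x : V) : Small {z | z = x} := by
  simpa using Universe.pairing x x

theorem small_pair (x y : V) : Small {z | z = mkSet {w | w = x} ∨ z = mkSet {w | w = x ∨ w = y}} :=
  Universe.pairing _ _

theorem mem_pair {x y z : V} :
    z ∊ pair x y ↔ z = mkSet {w | w = x} ∨ z = mkSet {w | w = x ∨ w = y} :=
  mem_mkSet (small_pair x y)

theorem not_atom_pair (x y : V) : ¬ Atom (pair x y) :=
  not_atom_mkSet _

theorem pair_injective {a b c d : V} (h : pair a b = pair c d) : a = c ∧ b = d :=
  pair_injective_of Universe.pairing h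

@[simp]
theorem pair_inj {a b c d : V} : pair a b = pair c d ↔ a = c ∧ b = d :=
  ⟨pair_injective, by rintro ⟨rfl, rfl⟩; rfl⟩

/-! #### Predicative formulas -/

/-- A tuple without its last entry -/
def front {V : Type} {n : ℕ} (v : Fin (n + 1) → V) : Fin n → V :=
  fun i => v i.castSucc

@[simp]
theorem front_snoc {V : Type} {n : ℕ} (v : Fin n → V) (x : V) :
    front (Fin.snoc v x : Fin (n + 1) → V) = v :=
  funext fun i => Fin.snoc_castSucc (α := fun _ => V) x v i

theorem snoc_front {V : Type} {n : ℕ} (v : Fin (n + 1) → V) :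
    (Fin.snoc (front v) (v (Fin.last n)) : Fin (n + 1) → V) = v :=
  Fin.snoc_init_self v

namespace Predicative

variable {n : ℕ} {P Q : (Fin n → V) → Prop}

theorem congr (h : Predicative P) (e : ∀ v, Q v ↔ P v) : Predicative Q := by
  rwa [show Q = P from funext fun v => propext (e v)]

theorem not (h : Predicative P) : Predicative fun v => ¬ P v :=
  h.imp falsum

theorem and (h : Predicative P) (h' : Predicative Q) : Predicative fun v => P v ∧ Q v :=
  (h.imp h'.not).not.congr fun v => by tauto

theorem or (h : Predicative P) (h' : Predicative Q) : Predicative fun v => P v ∨ Q v :=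
  (h.not.imp h').congr fun v => by tauto

theorem iff (h : Predicative P) (h' : Predicative Q) : Predicative fun v => P v ↔ Q v :=
  ((h.imp h').and (h'.imp h)).congr fun v => by tauto

theorem forall' {P : (Fin n → V) → V → Prop}
    (h : Predicative fun v : Fin (n + 1) → V => P (front v) (v (Fin.last n))) :
    Predicative fun v => ∀ x, P v x :=
  h.all.congr fun v => by simp

theorem exists' {P : (Fin n → V) → V → Prop}
    (h : Predicative fun v : Fin (n + 1) → V => P (front v) (v (Fin.last n))) :
    Predicative fun v => ∃ x, P v x :=
  (forall' (P := fun v x => ¬ P v x) h.not).not.congr fun v => by simp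

theorem eq_upair (i j k : Fin n) :
    Predicative fun v : Fin n → V => v k = mkSet {w | w = v i ∨ w = v j} :=
  ((atom k).not.and (forall' (P := fun v x => x ∊ v k ↔ x = v i ∨ x = v j)
    ((mem (Fin.last n) k.castSucc).iff
      ((eq (Fin.last n) i.castSucc).or (eq (Fin.last n) j.castSucc))))).congr
  fun _ => eq_mkSet_iff (Universe.pairing _ _)

theorem eq_pair (i j k : Fin n) : Predicative fun v : Fin n → V => v k = pair (v i) (v j) :=
  ((atom k).not.and (forall' (P := fun v x => x ∊ v k ↔ x = mkSet {w | w = v i ∨ w = v i} ∨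
      x = mkSet {w | w = v i ∨ w = v j})
    ((mem (Fin.last n) k.castSucc).iff
      ((eq_upair i.castSucc i.castSucc (Fin.last n)).or
        (eq_upair i.castSucc j.castSucc (Fin.last n)))))).congr
  fun _ => by simpa [pair] using eq_mkSet_iff (small_pair _ _)

theorem pair_mem {X : Set V} (hX : IsClass X) (i j : Fin n) :
    Predicative fun v : Fin n → V => pair (v i) (v j) ∈ X :=
  (exists' (P := fun v x => x = pair (v i) (v j) ∧ x ∈ X)
    ((eq_pair i.castSucc j.castSucc (Fin.last n)).and (cls hX (Fin.last n)))).congr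
  fun _ => by simp

theorem eq_pair_pair (i j k l : Fin n) :
    Predicative fun v : Fin n → V => v l = pair (v i) (pair (v j) (v k)) :=
  (exists' (P := fun v x => x = pair (v j) (v k) ∧ v l = pair (v i) x)
    ((eq_pair j.castSucc k.castSucc (Fin.last n)).and
      (eq_pair i.castSucc (Fin.last n) l.castSucc))).congr
  fun _ => by simp

theorem isClass {P : V → Prop} (h : Predicative fun v : Fin 1 → V => P (v 0)) :
    IsClass {x | P x} :=
  Universe.comprehension h

end Predicative

open Predicative in
theorem isClass_setOf_exists₂ {P : V → V → V → Prop}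
    (h : Predicative fun v : Fin 3 → V => P (v 0) (v 1) (v 2)) :
    IsClass {z | ∃ x y, P z x y} :=
  Predicative.isClass (exists' (P := fun v x => ∃ y, P (v 0) x y)
    (exists' (P := fun v y => P (v 0) (v 1) y) h))

open Predicative in
theorem isClass_setOf_exists₃ {P : V → V → V → V → Prop}
    (h : Predicative fun v : Fin 4 → V => P (v 0) (v 1) (v 2) (v 3)) :
    IsClass {z | ∃ x y w, P z x y w} :=
  Predicative.isClass (exists' (P := fun v x => ∃ y w, P (v 0) x y w)
    (exists' (P := fun v y => ∃ w, P (v 0) (v 1) y w)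
      (exists' (P := fun v w => P (v 0) (v 1) (v 2) w) h)))

/-! #### Definable predicates and functions -/

/-- A type whose elements are coded by the elements of a class -/
class Coded (V : Type) [Universe V] (α : Type) where
  /-- The code of an element -/
  enc : α → V
  code_injective : Function.Injective enc
  isClass_range : IsClass {x | ∃ a, enc a = x}

/-- The code of an element -/
abbrev code {V : Type} [Universe V] {α : Type} [Coded V α] (a : α) : V :=
  Coded.enc a

theorem isClass_univ : IsClass {_x : V | True} :=
  Predicative.isClass (P := fun _ => True)
    ((Predicative.imp .falsum .falsum).congr fun _ => by simp)

instance : Coded V V where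
  enc := id
  code_injective := Function.injective_id
  isClass_range := by simpa using isClass_univ

noncomputable instance {α β : Type} [Coded V α] [Coded V β] : Coded V (α × β) where
  enc p := pair (code p.1) (code p.2)
  code_injective p q h := by
    have := pair_injective h
    exact Prod.ext (Coded.code_injective this.1) (Coded.code_injective this.2)
  isClass_range := by
    have h := isClass_setOf_exists₂ (V := V) (P := fun z x y => z = pair x y ∧
        (x ∈ {x | ∃ a : α, code a = x} ∧ y ∈ {x | ∃ a : β, code a = x}))
      ((Predicative.eq_pair 1 2 0).and ((Predicative.cls Coded.isClass_range 1).and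
        (Predicative.cls Coded.isClass_range 2)))
    convert h using 1
    ext z
    constructor
    · rintro ⟨p, rfl⟩
      exact ⟨_, _, rfl, ⟨_, rfl⟩, ⟨_, rfl⟩⟩
    · rintro ⟨_, _, rfl, ⟨a, rfl⟩, ⟨b, rfl⟩⟩
      exact ⟨(a, b), rfl⟩

theorem code_self (x : V) : (code x : V) = x := rfl

/-- The predicate `P` defines a class. -/
class Def (V : Type) [Universe V] {α : Type} [Coded V α] (P : α → Prop) : Prop where
  isClass_code : IsClass {x : V | ∃ a, code a = x ∧ P a}

/-- The graph of the function `f` is a class. -/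
class DefFun (V : Type) [Universe V] {α β : Type} [Coded V α] [Coded V β] (f : α → β) : Prop where
  isClass_graph : IsClass {x : V | ∃ a, pair (code a) (code (f a)) = x}

/-! ### Closure properties of definability, applied by instance search -/

section Def

variable {α β γ : Type} [Coded V α] [Coded V β] [Coded V γ]

theorem Def.isClass {P : V → Prop} (h : Def V P) : IsClass {x | P x} := by
  simpa [code_self] using h.isClass_code

theorem def_of_isClass {P : V → Prop} (h : IsClass {x | P x}) : Def V P :=
  ⟨by simpa [code_self] using h⟩

theorem Def.congr {P Q : α → Prop} (h : Def V P) (e : ∀ a, Q a ↔ P a) : Def V Q := by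
  rwa [show Q = P from funext fun v => propext (e v)]

theorem DefFun.congr {f g : α → β} (h : DefFun V f) (e : ∀ a, g a = f a) : DefFun V g := by
  rwa [show g = f from funext e]

instance Def.const (p : Prop) : Def V (fun _ : α => p) := by
  by_cases hp : p
  · exact ⟨by simpa [hp] using Coded.isClass_range⟩
  · exact ⟨by simpa [hp] using Predicative.isClass (V := V) (P := fun _ => False) .falsum⟩

/-- Complements are relative to the class of codes: without the first conjunct the implication would
also hold of elements that code nothing. -/
instance Def.imp (P Q : α → Prop) [hP : Def V P] [hQ : Def V Q] :
    Def V (fun a => P a → Q a) := by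
  constructor
  convert Predicative.isClass (V := V) (P := fun x => x ∈ {x | ∃ a : α, code a = x} ∧
    (x ∈ {x | ∃ a, code a = x ∧ P a} → x ∈ {x | ∃ a, code a = x ∧ Q a}))
    ((Predicative.cls Coded.isClass_range 0).and
      ((Predicative.cls hP.isClass_code 0).imp (Predicative.cls hQ.isClass_code 0))) using 1
  ext x
  constructor
  · rintro ⟨a, rfl, h⟩
    refine ⟨⟨a, rfl⟩, ?_⟩
    rintro ⟨b, e, hb⟩
    obtain rfl := Coded.code_injective e
    exact ⟨_, rfl, h hb⟩
  · rintro ⟨⟨a, rfl⟩, h⟩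
    refine ⟨a, rfl, fun ha => ?_⟩
    obtain ⟨b, e, hb⟩ := h ⟨a, rfl, ha⟩
    obtain rfl := Coded.code_injective e
    exact hb

instance Def.not (P : α → Prop) [Def V P] : Def V (fun a => ¬ P a) :=
  Def.imp P (fun _ => False)

instance Def.and (P Q : α → Prop) [Def V P] [Def V Q] : Def V (fun a => P a ∧ Q a) :=
  (Def.not fun a => P a → ¬ Q a).congr fun a => by tauto

instance Def.or (P Q : α → Prop) [Def V P] [Def V Q] : Def V (fun a => P a ∨ Q a) :=
  (Def.imp (fun a => ¬ P a) Q).congr fun a => by tauto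

instance Def.iff (P Q : α → Prop) [Def V P] [Def V Q] : Def V (fun a => P a ↔ Q a) :=
  (Def.and (fun a => P a → Q a) fun a => Q a → P a).congr fun a => by tauto

instance Def.exists (P : α → β → Prop) [h : Def V (fun p : α × β => P p.1 p.2)] :
    Def V (fun a => ∃ b, P a b) := by
  constructor
  convert Predicative.isClass (V := V)
    (P := fun x => ∃ y, pair x y ∈ {x | ∃ a : α × β, code a = x ∧ P a.1 a.2})
    (.exists' (P := fun v y => pair (v 0) y ∈ {x | ∃ a : α × β, code a = x ∧ P a.1 a.2})
      (.pair_mem h.isClass_code 0 1)) using 1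
  ext x
  constructor
  · rintro ⟨a, rfl, b, h⟩
    exact ⟨code b, (a, b), rfl, h⟩
  · rintro ⟨y, ⟨a, b⟩, e, h⟩
    exact ⟨a, (pair_injective e).1, b, h⟩

instance Def.forall (P : α → β → Prop) [Def V (fun p : α × β => P p.1 p.2)] :
    Def V (fun a => ∀ b, P a b) :=
  (Def.not fun a => ∃ b, ¬ P a b).congr fun a => by simp

theorem Def.comp {P : β → Prop} (hP : Def V P) {f : α → β} [hf : DefFun V f] :
    Def V (fun a => P (f a)) := by
  constructor
  convert Predicative.isClass (V := V)
    (P := fun x => ∃ y, pair x y ∈ {x | ∃ a, pair (code a) (code (f a)) = x} ∧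
      y ∈ {x | ∃ a, code a = x ∧ P a})
    (.exists' (P := fun v y => pair (v 0) y ∈ {x | ∃ a, pair (code a) (code (f a)) = x} ∧
      y ∈ {x | ∃ a, code a = x ∧ P a})
      ((Predicative.pair_mem hf.isClass_graph 0 1).and (.cls hP.isClass_code 1))) using 1
  ext x
  constructor
  · rintro ⟨a, rfl, h⟩
    exact ⟨code (f a), ⟨a, rfl⟩, _, rfl, h⟩
  · rintro ⟨y, ⟨a, e⟩, b, rfl, h⟩
    obtain ⟨h₁, h₂⟩ := pair_injective e
    exact ⟨a, h₁, (Coded.code_injective h₂).symm ▸ h⟩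

theorem Def.of_isClass_mem {X : Set V} (hX : IsClass X) {f : α → V} [DefFun V f] :
    Def V (fun a => f a ∈ X) :=
  Def.comp (P := fun x => x ∈ X) (def_of_isClass hX)

theorem DefFun.comp {g : β → γ} (hg : DefFun V g) {f : α → β} [hf : DefFun V f] :
    DefFun V (fun a => g (f a)) := by
  constructor
  convert isClass_setOf_exists₃ (V := V)
    (P := fun z x y w => z = pair x w ∧ pair x y ∈ {x | ∃ a, pair (code a) (code (f a)) = x} ∧
      pair y w ∈ {x | ∃ a, pair (code a) (code (g a)) = x})
    ((Predicative.eq_pair 1 3 0).and ((Predicative.pair_mem hf.isClass_graph 1 2).and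
      (Predicative.pair_mem hg.isClass_graph 2 3))) using 1
  ext z
  constructor
  · rintro ⟨a, rfl⟩
    exact ⟨_, _, _, rfl, ⟨a, rfl⟩, ⟨f a, rfl⟩⟩
  · rintro ⟨x, y, w, rfl, ⟨a, ea⟩, ⟨b, eb⟩⟩
    obtain ⟨rfl, rfl⟩ := pair_injective ea
    obtain ⟨h, rfl⟩ := pair_injective eb
    obtain rfl := Coded.code_injective h
    exact ⟨a, rfl⟩

instance (priority := 2000) DefFun.id : DefFun V (fun a : α => a) := by
  constructor
  convert isClass_setOf_exists₂ (V := V)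
    (P := fun z x _ => z = pair x x ∧ x ∈ {x | ∃ a : α, code a = x})
    ((Predicative.eq_pair 1 1 0).and (.cls Coded.isClass_range 1)) using 1
  ext z
  constructor
  · rintro ⟨a, rfl⟩
    exact ⟨_, code a, rfl, a, rfl⟩
  · rintro ⟨_, _, rfl, a, rfl⟩
    exact ⟨a, rfl⟩

instance (priority := 1950) DefFun.const (b : β) : DefFun V (fun _ : α => b) := by
  constructor
  have hb : IsClass {x : V | x = code b} := by
    have := Universe.isClass_mem (mkSet {x : V | x = code b})
    simp only [mem_mkSet (small_singleton _)] at this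
    exact this
  convert isClass_setOf_exists₂ (V := V)
    (P := fun z x y => z = pair x y ∧ x ∈ {x | ∃ a : α, code a = x} ∧ y ∈ {x : V | x = code b})
    ((Predicative.eq_pair 1 2 0).and ((Predicative.cls Coded.isClass_range 1).and
      (.cls hb 2))) using 1
  ext z
  constructor
  · rintro ⟨a, rfl⟩
    exact ⟨_, _, rfl, ⟨a, rfl⟩, rfl⟩
  · rintro ⟨_, _, rfl, ⟨a, rfl⟩, rfl⟩
    exact ⟨a, rfl⟩

theorem defFun_fst : DefFun V (fun p : α × β => p.1) := by
  constructor
  convert isClass_setOf_exists₃ (V := V)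
    (P := fun z x y _ => (∃ q, q = pair x y ∧ z = pair q x) ∧ x ∈ {x | ∃ a : α, code a = x} ∧
      y ∈ {x | ∃ b : β, code b = x})
    ((Predicative.exists' (P := fun v q => q = pair (v 1) (v 2) ∧ v 0 = pair q (v 1))
      ((Predicative.eq_pair 1 2 4).and (.eq_pair 4 1 0))).and
        ((Predicative.cls Coded.isClass_range 1).and (.cls Coded.isClass_range 2))) using 1
  ext z
  constructor
  · rintro ⟨⟨a, b⟩, rfl⟩
    exact ⟨_, _, code a, ⟨_, rfl, rfl⟩, ⟨a, rfl⟩, b, rfl⟩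
  · rintro ⟨_, _, _, ⟨_, rfl, rfl⟩, ⟨a, rfl⟩, b, rfl⟩
    exact ⟨(a, b), rfl⟩

theorem defFun_snd : DefFun V (fun p : α × β => p.2) := by
  constructor
  convert isClass_setOf_exists₃ (V := V)
    (P := fun z x y _ => (∃ q, q = pair x y ∧ z = pair q y) ∧ x ∈ {x | ∃ a : α, code a = x} ∧
      y ∈ {x | ∃ b : β, code b = x})
    ((Predicative.exists' (P := fun v q => q = pair (v 1) (v 2) ∧ v 0 = pair q (v 2))
      ((Predicative.eq_pair 1 2 4).and (.eq_pair 4 2 0))).and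
        ((Predicative.cls Coded.isClass_range 1).and (.cls Coded.isClass_range 2))) using 1
  ext z
  constructor
  · rintro ⟨⟨a, b⟩, rfl⟩
    exact ⟨_, _, code a, ⟨_, rfl, rfl⟩, ⟨a, rfl⟩, b, rfl⟩
  · rintro ⟨_, _, _, ⟨_, rfl, rfl⟩, ⟨a, rfl⟩, b, rfl⟩
    exact ⟨(a, b), rfl⟩

instance (priority := 1900) DefFun.fst (f : α → β × γ) [DefFun V f] : DefFun V (fun a => (f a).1) :=
  defFun_fst.comp

instance (priority := 1900) DefFun.snd (f : α → β × γ) [DefFun V f] : DefFun V (fun a => (f a).2) :=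
  defFun_snd.comp

instance (priority := 100) DefFun.prodMk (f : α → β) (g : α → γ) [hf : DefFun V f]
    [hg : DefFun V g] : DefFun V (fun a => (f a, g a)) := by
  constructor
  convert isClass_setOf_exists₃ (V := V)
    (P := fun z x y w => z = pair x (pair y w) ∧
      pair x y ∈ {x | ∃ a, pair (code a) (code (f a)) = x} ∧
      pair x w ∈ {x | ∃ a, pair (code a) (code (g a)) = x})
    ((Predicative.eq_pair_pair 1 2 3 0).and ((Predicative.pair_mem hf.isClass_graph 1 2).and
      (Predicative.pair_mem hg.isClass_graph 1 3))) using 1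
  ext z
  constructor
  · rintro ⟨a, rfl⟩
    exact ⟨_, _, _, rfl, ⟨a, rfl⟩, ⟨a, rfl⟩⟩
  · rintro ⟨x, y, w, rfl, ⟨a, ea⟩, ⟨b, eb⟩⟩
    obtain ⟨rfl, rfl⟩ := pair_injective ea
    obtain ⟨h, rfl⟩ := pair_injective eb
    obtain rfl := Coded.code_injective h
    exact ⟨_, rfl⟩

instance (b : β) : DefFun V (Prod.mk b : γ → β × γ) := DefFun.prodMk (fun _ => b) fun c => c

theorem def_mem : Def V (fun p : V × V => p.1 ∊ p.2) := by
  constructor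
  convert isClass_setOf_exists₂ (V := V) (P := fun z x y => z = pair x y ∧ x ∊ y)
    ((Predicative.eq_pair 1 2 0).and (.mem 1 2)) using 1
  ext z
  constructor
  · rintro ⟨p, rfl, h⟩
    exact ⟨_, _, rfl, h⟩
  · rintro ⟨x, y, rfl, h⟩
    exact ⟨(x, y), rfl, h⟩

theorem def_eq : Def V (fun p : α × α => p.1 = p.2) := by
  constructor
  convert isClass_setOf_exists₂ (V := V)
    (P := fun z x y => z = pair x y ∧ x = y ∧ x ∈ {x | ∃ a : α, code a = x})
    ((Predicative.eq_pair 1 2 0).and ((Predicative.eq 1 2).and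
      (.cls Coded.isClass_range 1))) using 1
  ext z
  constructor
  · rintro ⟨⟨a, b⟩, rfl, h⟩
    exact ⟨_, _, rfl, congrArg code h, a, rfl⟩
  · rintro ⟨_, _, rfl, rfl, a, rfl⟩
    exact ⟨(a, a), rfl, rfl⟩

instance Def.mem (f g : α → V) [DefFun V f] [DefFun V g] : Def V (fun a => f a ∊ g a) :=
  def_mem.comp (f := fun a => (f a, g a))

instance Def.eq (f g : α → β) [DefFun V f] [DefFun V g] : Def V (fun a => f a = g a) :=
  def_eq.comp (f := fun a => (f a, g a))

instance (b : β) : Def V (Eq b) := Def.eq (fun _ => b) fun y => y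

theorem def_atom : Def V (fun x : V => Atom x) :=
  def_of_isClass (Predicative.isClass (.atom 0))

instance Def.atom (f : α → V) [DefFun V f] : Def V (fun a => Atom (f a)) :=
  def_atom.comp

instance : Def V (Atom : V → Prop) := def_atom

instance (x : V) : Def V (MemStructure.E x) := Def.mem (fun _ => x) fun y => y

theorem DefFun.of_graph {f : α → β} (h : Def V (fun p : α × β => p.2 = f p.1)) : DefFun V f := by
  constructor
  convert h.isClass_code using 1
  ext z
  constructor
  · rintro ⟨a, rfl⟩
    exact ⟨(a, f a), rfl, rfl⟩
  · rintro ⟨⟨a, b⟩, rfl, h⟩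
    exact ⟨a, by rw [← h]; rfl⟩

/-- Smallness quantifies over elements only, hence is predicative. The second disjunct of the graph
accounts for the default value of `mkSet` at extensions that are not sets. -/
instance DefFun.mkSet (P : α → V → Prop) [Def V (fun p : α × V => P p.1 p.2)] :
    DefFun V (fun a => mkSet {y | P a y}) := by
  apply DefFun.of_graph
  have h : Def V (fun p : α × V => (¬ Atom p.2 ∧ ∀ y, y ∊ p.2 ↔ P p.1 y) ∨
      ((¬ ∃ x, ¬ Atom x ∧ ∀ y, y ∊ x ↔ P p.1 y) ∧ p.2 = ClassTheory.mkSet ∅)) := by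
    have : Def V (fun p : (α × V) × V => P p.1.1 p.2) :=
      Def.comp (P := fun p : α × V => P p.1 p.2) ‹_› (f := fun p : (α × V) × V => (p.1.1, p.2))
    have : Def V (fun p : ((α × V) × V) × V => P p.1.1.1 p.2) :=
      Def.comp (P := fun p : α × V => P p.1 p.2) ‹_›
        (f := fun p : ((α × V) × V) × V => (p.1.1.1, p.2))
    infer_instance
  refine h.congr fun p => ?_
  by_cases hs : Small {y | P p.1 y}
  · rw [eq_mkSet_iff hs]
    have : ∃ x, ¬ Atom x ∧ ∀ y, y ∊ x ↔ P p.1 y := hs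
    simp [this]
  · rw [mkSet_of_not_small hs]
    have : ¬ ∃ x, ¬ Atom x ∧ ∀ y, y ∊ x ↔ P p.1 y := hs
    constructor
    · exact fun h => .inr ⟨this, h⟩
    · rintro (h | h)
      exacts [(this ⟨_, h⟩).elim, h.2]

instance DefFun.pair (f g : α → V) [DefFun V f] [DefFun V g] :
    DefFun V (fun a => pair (f a) (g a)) := by
  have : DefFun V (fun p : V × V => ClassTheory.pair p.1 p.2) := by
    unfold ClassTheory.pair
    infer_instance
  exact this.comp (f := fun a => (f a, g a))

open Classical in
instance DefFun.ite (P : α → Prop) (f g : α → β) [Def V P] [DefFun V f] [DefFun V g] :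
    DefFun V (fun a => if P a then f a else g a) := by
  apply DefFun.of_graph
  have hP : Def V (fun p : α × β => P p.1) := Def.comp (P := P) ‹_›
  have hf : DefFun V (fun p : α × β => f p.1) := DefFun.comp (g := f) ‹_›
  have hg : DefFun V (fun p : α × β => g p.1) := DefFun.comp (g := g) ‹_›
  have h : Def V (fun p : α × β => (P p.1 ∧ p.2 = f p.1) ∨ (¬ P p.1 ∧ p.2 = g p.1)) :=
    inferInstance
  refine h.congr fun p => ?_
  by_cases hp : P p.1 <;> simp [hp]

open Classical in
/-- The unique element with the property `P`, and the empty set if there is none -/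
noncomputable def iota (P : V → Prop) : V :=
  if h : ∃! x, P x then h.choose else mkSet ∅

theorem iota_eq {P : V → Prop} {x : V} (hx : P x) (h : ∀ y, P y → y = x) : iota P = x := by
  have h' : ∃! x, P x := ⟨x, hx, h⟩
  unfold iota
  rw [dif_pos h']
  exact h _ h'.choose_spec.1

instance DefFun.iota (P : α → V → Prop) [hP : Def V (fun p : α × V => P p.1 p.2)] :
    DefFun V (fun a => iota fun y => P a y) := by
  apply DefFun.of_graph
  have h : Def V (fun p : α × V => (P p.1 p.2 ∧ ∀ y, P p.1 y → y = p.2) ∨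
      ((¬ ∃ x, P p.1 x ∧ ∀ y, P p.1 y → y = x) ∧ p.2 = ClassTheory.mkSet ∅)) := by
    have : Def V (fun p : (α × V) × V => P p.1.1 p.2) :=
      hP.comp (f := fun p : (α × V) × V => (p.1.1, p.2))
    have : Def V (fun p : ((α × V) × V) × V => P p.1.1.1 p.2) :=
      hP.comp (f := fun p : ((α × V) × V) × V => (p.1.1.1, p.2))
    infer_instance
  refine h.congr fun p => ?_
  by_cases hs : ∃ x, P p.1 x ∧ ∀ y, P p.1 y → y = x
  · obtain ⟨x, hx, hu⟩ := hs
    rw [iota_eq hx hu]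
    constructor
    · intro e
      exact .inl (e ▸ ⟨hx, hu⟩)
    · rintro (h | h)
      exacts [hu _ h.1, (h.1 ⟨x, hx, hu⟩).elim]
  · have : ¬ ∃! x, P p.1 x := hs
    rw [ClassTheory.iota, dif_neg this]
    constructor
    · exact fun h => .inr ⟨hs, h⟩
    · rintro (h | h)
      exacts [(hs ⟨_, h⟩).elim, h.2]

end Def

end ClassTheory

namespace ClassTheory

open MemStructure (Atom IsClass)

variable {V : Type} [Universe V]

/-! ### Substitution in relations and functions of several arguments -/

section Comp

variable {α β γ δ ε : Type} [Coded V α] [Coded V β] [Coded V γ] [Coded V δ] [Coded V ε]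

theorem Def.comp₂ {P : β → γ → Prop} (h : Def V (fun p : β × γ => P p.1 p.2)) (f : α → β)
    (g : α → γ) [DefFun V f] [DefFun V g] : Def V (fun a => P (f a) (g a)) :=
  h.comp (f := fun a => (f a, g a))

theorem Def.comp₃ {P : β → γ → δ → Prop} (h : Def V (fun p : β × γ × δ => P p.1 p.2.1 p.2.2))
    (f : α → β) (g : α → γ) (k : α → δ) [DefFun V f] [DefFun V g] [DefFun V k] :
    Def V (fun a => P (f a) (g a) (k a)) :=
  h.comp (f := fun a => (f a, g a, k a))

theorem DefFun.comp₂ {F : β → γ → δ} (h : DefFun V (fun p : β × γ => F p.1 p.2)) (f : α → β)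
    (g : α → γ) [DefFun V f] [DefFun V g] : DefFun V (fun a => F (f a) (g a)) :=
  h.comp (f := fun a => (f a, g a))

theorem DefFun.comp₃ {F : β → γ → δ → ε} (h : DefFun V (fun p : β × γ × δ => F p.1 p.2.1 p.2.2))
    (f : α → β) (g : α → γ) (k : α → δ) [DefFun V f] [DefFun V g] [DefFun V k] :
    DefFun V (fun a => F (f a) (g a) (k a)) :=
  h.comp (f := fun a => (f a, g a, k a))

end Comp

/-! #### Existence of sets -/

theorem small_image (a : V) (f : V → V) [hf : DefFun V f] : Small {y | ∃ x, x ∊ a ∧ y = f x} := by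
  by_cases ha : Atom a
  · convert small_empty (V := V)
    ext y
    simp [Universe.not_mem_of_atom ha]
  · have := hf.comp (f := fun p : V × V => p.2)
    have h := Universe.replacement ha (F := {z | ∃ x, z = pair x (f x)}) (Def.isClass inferInstance)
      (by
        rintro x y z ⟨b, hb⟩ ⟨c, hc⟩
        simp only [pair_inj] at hb hc
        rw [hb.2, hc.2, ← hb.1, ← hc.1])
    convert h using 1
    ext y
    simp only [Set.mem_ofPred_eq, pair_inj]
    constructor
    · rintro ⟨x, hx, rfl⟩
      exact ⟨x, hx, x, rfl, rfl⟩
    · rintro ⟨x, hx, _, rfl, rfl⟩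
      exact ⟨x, hx, rfl⟩

/-- Separation from replacement: elements outside `P` are sent to a fixed `b` in the set that
satisfies `P`. If there is no such `b`, the result is empty. -/
theorem small_sep (a : V) (P : V → Prop) [hP : Def V P] : Small {y | y ∊ a ∧ P y} := by
  classical
  by_cases h : ∃ b, b ∊ a ∧ P b
  · obtain ⟨b, hb, hPb⟩ := h
    convert small_image a (fun x => if P x then x else b) using 1
    ext y
    constructor
    · rintro ⟨hy, hPy⟩
      exact ⟨y, hy, by simp [hPy]⟩
    · rintro ⟨x, hx, rfl⟩
      show _ ∊ a ∧ P _
      split_ifs with hPx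
      exacts [⟨hx, hPx⟩, ⟨hb, hPb⟩]
  · convert small_empty (V := V)
    ext y
    simp only [Set.mem_ofPred_eq, Set.mem_empty_iff_false, iff_false]
    exact fun hy => h ⟨y, hy⟩

theorem small_of_subset {P : V → Prop} (hP : Def V P) {a : V} (h : ∀ y, P y → y ∊ a) :
    Small {y | P y} := by
  convert small_sep a P using 1
  ext y
  exact ⟨fun hy => ⟨h y hy, hy⟩, fun hy => hy.2⟩

theorem small_sUnion (a : V) : Small {z | ∃ y, y ∊ a ∧ z ∊ y} := by
  by_cases ha : Atom a
  · convert small_empty (V := V)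
    ext y
    simp [Universe.not_mem_of_atom ha]
  · exact Universe.union ha

theorem small_biUnion (a : V) (f : V → V) [DefFun V f] : Small {z | ∃ x, x ∊ a ∧ z ∊ f x} := by
  convert small_sUnion (mkSet {y | ∃ x, x ∊ a ∧ y = f x}) using 1
  ext z
  simp only [mem_mkSet (small_image a f), Set.mem_ofPred_eq]
  constructor
  · rintro ⟨x, hx, hz⟩
    exact ⟨_, ⟨x, hx, rfl⟩, hz⟩
  · rintro ⟨_, ⟨x, hx, rfl⟩, hz⟩
    exact ⟨x, hx, hz⟩

theorem small_union (a b : V) : Small {z | z ∊ a ∨ z ∊ b} := by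
  convert small_sUnion (mkSet {y | y = a ∨ y = b}) using 1
  ext z
  simp only [mem_mkSet (Universe.pairing a b), Set.mem_ofPred_eq]
  constructor
  · rintro (h | h)
    exacts [⟨a, .inl rfl, h⟩, ⟨b, .inr rfl, h⟩]
  · rintro ⟨_, rfl | rfl, h⟩
    exacts [.inl h, .inr h]

theorem small_insert (a b : V) : Small {z | z ∊ a ∨ z = b} := by
  convert small_union a (mkSet {z | z = b}) using 1
  ext z
  simp only [mem_mkSet (small_singleton b), Set.mem_ofPred_eq]

theorem small_powerset (a : V) : Small {y | ¬ Atom y ∧ ∀ z, z ∊ y → z ∊ a} := by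
  by_cases ha : Atom a
  · convert Universe.power (not_atom_mkSet (V := V) ∅) using 1
    ext y
    simp [not_mem_mkSet_empty, Universe.not_mem_of_atom ha]
  · exact Universe.power ha

/-- A choice function -/
theorem exists_choice : ∃ f : V → V, DefFun V f ∧ ∀ x y, y ∊ x → f x ∊ x := by
  obtain ⟨F, hF, hu, h⟩ := Universe.choice (V := V)
  refine ⟨fun x => iota fun y => pair x y ∈ F, ?_, fun x y hy => ?_⟩
  · have : Def V (fun p : V × V => pair p.1 p.2 ∈ F) := Def.of_isClass_mem hF
    infer_instance
  · obtain ⟨z, hz, hp⟩ := h x (not_atom_of_mem hy) ⟨y, hy⟩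
    dsimp only
    rwa [iota_eq (P := fun y => pair x y ∈ F) hp fun w hw => hu _ _ _ hw hp]

/-! #### Set functions -/

/-- The value of the set function `g` at `x` -/
noncomputable def ap (g x : V) : V :=
  iota fun w => pair x w ∊ g

/-- The restriction of `f` to the set `x`, as a set of pairs -/
noncomputable def graphOn (f : V → V) (x : V) : V :=
  mkSet {p | ∃ y, y ∊ x ∧ p = pair y (f y)}

instance {α : Type} [Coded V α] (f g : α → V) [DefFun V f] [DefFun V g] :
    DefFun V (fun a => ap (f a) (g a)) := by
  have : DefFun V (fun p : V × V => ap p.1 p.2) := by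
    unfold ap
    infer_instance
  exact this.comp₂ f g

instance (g : V) : DefFun V (ap g) :=
  inferInstanceAs (DefFun V fun x => ap ((fun _ => g) x) ((fun y => y) x))

instance {α : Type} [Coded V α] (f : α → V → V) (g : α → V)
    [hf : DefFun V (fun p : α × V => f p.1 p.2)] [hg : DefFun V g] :
    DefFun V (fun a => graphOn (f a) (g a)) := by
  unfold graphOn
  have : DefFun V (fun p : (α × V) × V => f p.1.1 p.2) :=
    hf.comp₂ (fun p : (α × V) × V => p.1.1) (fun p => p.2)
  have : DefFun V (fun p : (α × V) × V => g p.1.1) := hg.comp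
  infer_instance

theorem mem_graphOn {f : V → V} [hf : DefFun V f] {x p : V} :
    p ∊ graphOn f x ↔ ∃ y, y ∊ x ∧ p = pair y (f y) := by
  have : DefFun V (fun y => pair y (f y)) := inferInstance
  exact mem_mkSet (small_image x fun y => pair y (f y))

theorem pair_mem_graphOn {f : V → V} [hf : DefFun V f] {x y z : V} :
    pair y z ∊ graphOn f x ↔ y ∊ x ∧ z = f y := by
  rw [mem_graphOn]
  simp only [pair_inj]
  constructor
  · rintro ⟨w, hw, rfl, rfl⟩
    exact ⟨hw, rfl⟩
  · rintro ⟨hy, rfl⟩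
    exact ⟨y, hy, rfl, rfl⟩

theorem ap_eq {g x y : V} (h : pair x y ∊ g) (hu : ∀ z, pair x z ∊ g → z = y) : ap g x = y :=
  iota_eq h hu

theorem ap_graphOn {f : V → V} [DefFun V f] {x y : V} (hy : y ∊ x) : ap (graphOn f x) y = f y :=
  ap_eq (pair_mem_graphOn.2 ⟨hy, rfl⟩) fun _ hz => (pair_mem_graphOn.1 hz).2

theorem graphOn_congr {f g : V → V} {x : V} (h : ∀ y, y ∊ x → f y = g y) :
    graphOn f x = graphOn g x := by
  unfold graphOn
  congr 1
  ext p
  constructor <;> rintro ⟨y, hy, rfl⟩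
  exacts [⟨y, hy, by rw [h y hy]⟩, ⟨y, hy, by rw [h y hy]⟩]

/-! #### Foundation and recursion -/

/-- Every member of a member of `t` is a member of `t`. -/
def Transitive (t : V) : Prop :=
  ∀ x y, x ∊ t → y ∊ x → y ∊ t

instance {α : Type} [Coded V α] (f : α → V) [DefFun V f] : Def V (fun a => Transitive (f a)) := by
  have : Def V (fun x : V => Transitive x) := by
    unfold Transitive
    infer_instance
  exact this.comp

instance : Def V (Transitive : V → Prop) :=
  inferInstanceAs (Def V fun x : V => Transitive ((fun y => y) x))

/-- The transitive closure -/
noncomputable def tc (x : V) : V :=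
  mkSet {z | ∀ t, Transitive t → (∀ y, y ∊ x → y ∊ t) → z ∊ t}

instance : DefFun V (tc : V → V) := by
  unfold tc
  infer_instance

instance {α : Type} [Coded V α] (f : α → V) [DefFun V f] : DefFun V (fun a => tc (f a)) :=
  DefFun.comp (g := tc) inferInstance

/-- The set `t` bounds the intersection in the definition of `tc`, which is therefore a set. Without
such a bound, `tc x` might be the default value of `mkSet`. -/
theorem mem_tc_of_transitive {x t : V} (ht : Transitive t) (h : ∀ y, y ∊ x → y ∊ t) {z : V} :
    z ∊ tc x ↔ ∀ t, Transitive t → (∀ y, y ∊ x → y ∊ t) → z ∊ t :=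
  mem_mkSet (small_of_subset (P := fun z => ∀ t, Transitive t → (∀ y, y ∊ x → y ∊ t) → z ∊ t)
    inferInstance fun _ hz => hz t ht h)

variable [Founded V]

theorem exists_minimal {P : V → Prop} [hP : Def V P] (h : ∃ x, P x) :
    ∃ x, P x ∧ ∀ y, y ∊ x → ¬ P y :=
  Founded.foundation hP.isClass h

theorem mem_induction {P : V → Prop} (hP : Def V P) (h : ∀ x, (∀ y, y ∊ x → P y) → P x) (x : V) :
    P x := by
  by_contra hx
  obtain ⟨y, hy, hm⟩ := exists_minimal (P := fun x => ¬ P x) ⟨x, hx⟩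
  exact hy (h y fun z hz => not_not.1 (hm z hz))

theorem not_mem_self (x : V) : ¬ x ∊ x := by
  induction x using mem_induction with
  | hP => infer_instance
  | h x ih => exact fun h => ih x h h

theorem mem_asymm {x y : V} (h : x ∊ y) : ¬ y ∊ x := by
  intro h'
  obtain ⟨z, hz, hm⟩ := exists_minimal (P := fun z => z = x ∨ z = y) ⟨x, .inl rfl⟩
  rcases hz with rfl | rfl
  exacts [hm _ h' (.inr rfl), hm _ h (.inl rfl)]

theorem not_mem_cycle {x y z : V} (h : x ∊ y) (h' : y ∊ z) : ¬ z ∊ x := by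
  intro h''
  obtain ⟨w, hw, hm⟩ := exists_minimal (P := fun w => w = x ∨ w = y ∨ w = z) ⟨x, .inl rfl⟩
  rcases hw with rfl | rfl | rfl
  exacts [hm _ h'' (.inr (.inr rfl)), hm _ h (.inl rfl), hm _ h' (.inr (.inl rfl))]

/-- No iteration along ω is needed: by induction the members of `x` have transitive closures, and
these together with `x` form a transitive set. -/
theorem exists_transitive (x : V) : ∃ t, Transitive t ∧ ∀ y, y ∊ x → y ∊ t := by
  induction x using mem_induction with
  | hP => infer_instance
  | h x ih =>
    have h := small_union x (mkSet {z | ∃ y, y ∊ x ∧ z ∊ tc y})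
    simp only [mem_mkSet (small_biUnion x fun y => tc y), Set.mem_ofPred_eq] at h
    refine ⟨mkSet {z | z ∊ x ∨ ∃ y, y ∊ x ∧ z ∊ tc y}, ?_, fun y hy => ?_⟩
    · intro z w hz hw
      rw [mem_mkSet h] at hz ⊢
      rcases hz with hz | ⟨y, hy, hz⟩
      · obtain ⟨t, ht, h'⟩ := ih z hz
        exact .inr ⟨z, hz, (mem_tc_of_transitive ht h').2 fun s _ h'' => h'' w hw⟩
      · obtain ⟨t, ht, h'⟩ := ih y hy
        refine .inr ⟨y, hy, (mem_tc_of_transitive ht h').2 fun s hs h'' => hs z w ?_ hw⟩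
        exact (mem_tc_of_transitive ht h').1 hz s hs h''
    · rw [mem_mkSet h]
      exact .inl hy

theorem mem_tc {x z : V} : z ∊ tc x ↔ ∀ t, Transitive t → (∀ y, y ∊ x → y ∊ t) → z ∊ t := by
  obtain ⟨t, ht, h⟩ := exists_transitive x
  exact mem_tc_of_transitive ht h

theorem transitive_tc (x : V) : Transitive (tc x) := fun y z hy hz =>
  mem_tc.2 fun t ht h => ht y z (mem_tc.1 hy t ht h) hz

theorem mem_tc_of_mem {x y : V} (h : y ∊ x) : y ∊ tc x :=
  mem_tc.2 fun _ _ ht => ht y h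

/-- Recursion along membership, with a parameter -/
theorem exists_recursion {α : Type} [Coded V α] (H : α → V → V → V)
    [hH : DefFun V (fun p : α × V × V => H p.1 p.2.1 p.2.2)] :
    ∃ F : α → V → V, DefFun V (fun p : α × V => F p.1 p.2) ∧
      ∀ a x, F a x = H a x (graphOn (F a) x) := by
  have hH' {β : Type} [Coded V β] (f : β → α) (g k : β → V) [DefFun V f] [DefFun V g]
    [DefFun V k] : DefFun V (fun b => H (f b) (g b) (k b)) := hH.comp₃ f g k
  -- Approximations are set functions `g` obeying the recursion on a transitive set `t`. Because
  -- they are sets, their existence is a predicative condition, and this makes `F` definable.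
  let At : α → V → V → Prop := fun a t g =>
    Transitive t ∧ ∀ z, z ∊ t → ap g z = H a z (graphOn (ap g) z)
  have dAt {β : Type} [Coded V β] (f : β → α) (g k : β → V) [DefFun V f] [DefFun V g]
      [DefFun V k] : Def V (fun b => At (f b) (g b) (k b)) :=
    Def.comp₃ (P := At) (by dsimp only [At]; infer_instance) f g k
  have agree : ∀ {a t g t' g'}, At a t g → At a t' g' → ∀ z, z ∊ t → z ∊ t' →
      ap g z = ap g' z := by
    intro a t g t' g' h h' z
    induction z using mem_induction with
    | hP => infer_instance
    | h z ih =>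
      intro hz hz'
      rw [h.2 z hz, h'.2 z hz']
      congr 1
      exact graphOn_congr fun y hy => ih y hy (h.1 z y hz hy) (h'.1 z y hz' hy)
  let F : α → V → V := fun a x => iota fun w => ∃ t g, At a t g ∧ x ∊ t ∧ w = ap g x
  have dF : DefFun V (fun p : α × V => F p.1 p.2) := by
    dsimp only [F]
    infer_instance
  have dF' (a : α) : DefFun V (F a) := dF.comp₂ (fun _ : V => a) fun x => x
  have F_eq : ∀ {a t g x}, At a t g → x ∊ t → F a x = ap g x := by
    intro a t g x h hx
    refine iota_eq ⟨t, g, h, hx, rfl⟩ ?_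
    rintro _ ⟨t', g', h', hx', rfl⟩
    exact agree h' h x hx' hx
  have total : ∀ a x, ∃ t g, At a t g ∧ x ∊ t := by
    intro a x
    induction x using mem_induction with
    | hP => infer_instance
    | h x ih =>
      -- If no approximation reaches `x`, then one can be built on the set `s` of `x` and of all
      -- elements of its transitive closure that are reached. On these `F` already has the right
      -- value, and the assumption keeps `x` apart from them.
      by_contra hx
      have hs := small_sep (tc x) fun z => ∃ t g, At a t g ∧ z ∊ t
      have hs' := small_insert (mkSet {z | z ∊ tc x ∧ ∃ t g, At a t g ∧ z ∊ t}) x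
      let s := mkSet {z | z ∊ mkSet {z | z ∊ tc x ∧ ∃ t g, At a t g ∧ z ∊ t} ∨ z = x}
      have mem_s : ∀ z, z ∊ s ↔ (z ∊ tc x ∧ ∃ t g, At a t g ∧ z ∊ t) ∨ z = x := by
        intro z
        rw [mem_mkSet hs', Set.mem_ofPred_eq, mem_mkSet hs, Set.mem_ofPred_eq]
      classical
      let f : V → V := fun z => if z = x then H a x (graphOn (F a) x) else F a z
      have f_eq : ∀ y, y ≠ x → f y = F a y := fun y hy => if_neg hy
      refine hx ⟨s, graphOn f s, ⟨?_, fun z hz => ?_⟩, (mem_s x).2 (.inr rfl)⟩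
      · intro z w hz hw
        rw [mem_s] at hz ⊢
        rcases hz with ⟨hz, t, g, h, hzt⟩ | rfl
        · exact .inl ⟨transitive_tc x z w hz hw, t, g, h, h.1 z w hzt hw⟩
        · exact .inl ⟨mem_tc_of_mem hw, ih w hw⟩
      · have key : graphOn (ap (graphOn f s)) z = graphOn (F a) z := by
          refine graphOn_congr fun y hy => ?_
          have hyx : (y ∊ tc x ∧ ∃ t g, At a t g ∧ y ∊ t) ∧ y ≠ x := by
            rcases (mem_s z).1 hz with ⟨hz, t, g, h, hzt⟩ | rfl
            · refine ⟨⟨transitive_tc x z y hz hy, t, g, h, h.1 z y hzt hy⟩, ?_⟩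
              rintro rfl
              exact hx ⟨t, g, h, h.1 z y hzt hy⟩
            · refine ⟨⟨mem_tc_of_mem hy, ih y hy⟩, ?_⟩
              rintro rfl
              exact not_mem_self y hy
          rw [ap_graphOn ((mem_s y).2 (.inl hyx.1)), f_eq y hyx.2]
        rw [ap_graphOn hz, key]
        rcases (mem_s z).1 hz with ⟨-, t, g, h, hzt⟩ | rfl
        · have hzx : z ≠ x := by
            rintro rfl
            exact hx ⟨t, g, h, hzt⟩
          rw [f_eq z hzx, F_eq h hzt, h.2 z hzt]
          congr 1
          exact graphOn_congr fun y hy => (F_eq h (h.1 z y hzt hy)).symm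
        · exact if_pos rfl
  refine ⟨F, dF, fun a x => ?_⟩
  obtain ⟨t, g, h, hx⟩ := total a x
  rw [F_eq h hx, h.2 x hx]
  congr 1
  exact graphOn_congr fun y hy => (F_eq h (h.1 x y hx hy)).symm

/-- Every element belongs to a set that is closed under a given function. -/
theorem exists_closed_set (c : V) (g : V → V) [hg : DefFun V g] :
    ∃ s, c ∊ s ∧ ∀ x, x ∊ s → g x ∊ s := by
  classical
  have hg' {β : Type} [Coded V β] (f : β → V) [DefFun V f] : DefFun V (fun b => g (f b)) := hg.comp
  -- Recursion along membership has to find `y` in `y ∪ {y}`, and `pred` does this; asymmetry of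
  -- membership makes the predecessor unique.
  let pred : V → V := fun x => iota fun y => ¬ Atom x ∧ ∀ w, w ∊ x ↔ w ∊ y ∨ w = y
  have dpred {β : Type} [Coded V β] (f : β → V) [DefFun V f] : DefFun V (fun b => pred (f b)) :=
    DefFun.comp (g := pred) (by dsimp only [pred]; infer_instance)
  obtain ⟨i, hi, ⟨e, hei, hea, he⟩, hs⟩ := Universe.infinity (V := V)
  -- On an inductive set this sends the empty set to `c` and each successor to `g` of the value at
  -- its predecessor; the image is the closed set sought.
  obtain ⟨F, hF, h⟩ := exists_recursion (V := V) (α := V)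
    (fun _ x k => if ∃ y, y ∊ x then g (ap k (pred x)) else c)
  have hF' : DefFun V (F c) := hF.comp₂ (fun _ : V => c) fun x => x
  have mem := @mem_mkSet V _ _ (small_image i (F c))
  refine ⟨mkSet {y | ∃ x, x ∊ i ∧ y = F c x}, ?_, ?_⟩
  · rw [mem]
    refine ⟨e, hei, ?_⟩
    rw [h, if_neg]
    rintro ⟨y, hy⟩
    exact he y hy
  · intro y hy
    rw [mem] at hy ⊢
    obtain ⟨x, hx, rfl⟩ := hy
    obtain ⟨z, hz, hza, hzx⟩ := hs x hx
    have hxz : x ∊ z := (hzx x).2 (.inr rfl)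
    refine ⟨z, hz, ?_⟩
    have : pred z = x := by
      refine iota_eq ⟨hza, hzx⟩ ?_
      rintro w ⟨-, hw⟩
      by_contra hne
      have h₁ : w ∊ x := ((hzx w).1 ((hw w).2 (.inr rfl))).resolve_right hne
      have h₂ : x ∊ w := ((hw x).1 hxz).resolve_right (Ne.symm hne)
      exact mem_asymm h₁ h₂
    rw [h c z, if_pos ⟨x, hxz⟩, this, ap_graphOn hxz]

end ClassTheory

namespace ClassTheory

open MemStructure (Atom IsClass)

/-! #### Tuples -/

section Tuples

variable {V : Type} [Universe V]

/-- The code of a tuple -/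
noncomputable def tupleCode : {n : ℕ} → (Fin n → V) → V
  | 0, _ => mkSet ∅
  | _ + 1, v => pair (tupleCode (front v)) (v (Fin.last _))

theorem tupleCode_injective {n : ℕ} : Function.Injective (tupleCode : (Fin n → V) → V) := by
  induction n with
  | zero => exact fun v w _ => Subsingleton.elim v w
  | succ n ih =>
    intro v w h
    obtain ⟨h₁, h₂⟩ := pair_injective h
    rw [← snoc_front v, ← snoc_front w, ih h₁, h₂]

theorem isClass_range_tupleCode {n : ℕ} : IsClass {x : V | ∃ v : Fin n → V, tupleCode v = x} := by
  induction n with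
  | zero =>
    refine Def.isClass (Def.congr (P := fun x : V => x = mkSet ∅) inferInstance fun x => ?_)
    simp [tupleCode, eq_comm]
  | succ n ih =>
    have : Def V (fun p : (V × V) × V => p.1.2 ∈ {x : V | ∃ v : Fin n → V, tupleCode v = x}) :=
      Def.of_isClass_mem ih
    refine Def.isClass (Def.congr (P := fun x : V =>
      ∃ y z, y ∈ {x : V | ∃ v : Fin n → V, tupleCode v = x} ∧ x = pair y z) inferInstance
      fun x => ?_)
    constructor
    · rintro ⟨v, rfl⟩
      exact ⟨_, _, ⟨_, rfl⟩, rfl⟩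
    · rintro ⟨_, z, ⟨v, rfl⟩, rfl⟩
      exact ⟨Fin.snoc v z, by simp [tupleCode]⟩

noncomputable instance {n : ℕ} : Coded V (Fin n → V) where
  enc := tupleCode
  code_injective := tupleCode_injective
  isClass_range := isClass_range_tupleCode

/-- A longer tuple and the pair of its front and last entry have the same code, so the graph is that
of the identity. -/
theorem defFun_snoc {n : ℕ} :
    DefFun V (fun p : (Fin n → V) × V => (Fin.snoc p.1 p.2 : Fin (n + 1) → V)) := by
  constructor
  have key : ∀ p : (Fin n → V) × V,
      (code (Fin.snoc p.1 p.2 : Fin (n + 1) → V) : V) = code p := by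
    intro p
    show pair (tupleCode (front (Fin.snoc p.1 p.2 : Fin (n + 1) → V))) _ = pair (tupleCode _) _
    simp
    rfl
  simp only [key]
  exact (DefFun.id (V := V) (α := (Fin n → V) × V)).isClass_graph

instance {α : Type} [Coded V α] {n : ℕ} (f : α → Fin n → V) (g : α → V) [DefFun V f] [DefFun V g] :
    DefFun V (fun a => (Fin.snoc (f a) (g a) : Fin (n + 1) → V)) :=
  defFun_snoc.comp (f := fun a => (f a, g a))

theorem defFun_apply {n : ℕ} (i : Fin n) : DefFun V (fun v : Fin n → V => v i) := by
  induction n with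
  | zero => exact i.elim0
  | succ n ih =>
    have hg : ∀ {f : (Fin n → V) × V → V} {g : (Fin (n + 1) → V) → V},
        (∀ v, g v = f (front v, v (Fin.last n))) → DefFun V f → DefFun V g := by
      intro f g hfg hf
      constructor
      convert hf.isClass_graph using 1
      ext x
      constructor
      · rintro ⟨v, rfl⟩
        exact ⟨(front v, v (Fin.last n)), by rw [hfg]; rfl⟩
      · rintro ⟨p, rfl⟩
        refine ⟨Fin.snoc p.1 p.2, ?_⟩
        rw [hfg]
        simp only [front_snoc, Fin.snoc_last]
        congr 1
        show pair (tupleCode (front (Fin.snoc p.1 p.2 : Fin (n + 1) → V))) _ =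
          pair (tupleCode _) p.2
        simp
    refine Fin.lastCases ?_ (fun i => ?_) i
    · exact hg (f := fun p => p.2) (fun _ => rfl) inferInstance
    · exact hg (f := fun p => p.1 i) (fun _ => rfl)
        ((ih i).comp (f := fun p : (Fin n → V) × V => p.1))

instance {α : Type} [Coded V α] {n : ℕ} (f : α → Fin n → V) [DefFun V f] (i : Fin n) :
    DefFun V (fun a => f a i) :=
  (defFun_apply i).comp (f := f)

end Tuples

/-! #### Interpretations -/

/-- An interpretation of class theory in a universe: a class `C` of codes, a class `A` of codes for
individuals, and a bijection of the other codes with the sets of codes -/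
structure Interp (V : Type) [Universe V] where
  /-- The codes -/
  C : V → Prop
  /-- The codes of individuals -/
  A : V → Prop
  /-- The set of the codes of members -/
  mem : V → V
  defC : Def V C
  defA : Def V A
  defMem : DefFun V mem
  not_atom {x : V} : C x → ¬ A x → ¬ Atom (mem x)
  mem_C {x y : V} : C x → ¬ A x → y ∊ mem x → C y
  mem_inj {x y : V} : C x → ¬ A x → C y → ¬ A y → mem x = mem y → x = y
  mem_surj {s : V} : ¬ Atom s → (∀ y, y ∊ s → C y) → ∃ x, C x ∧ ¬ A x ∧ mem x = s

namespace Interp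

variable {V : Type} [Universe V] (I : Interp V)

/-- The type of codes -/
@[ext]
structure Carrier where
  /-- The underlying element -/
  val : V
  prop : I.C val

instance {α : Type} [Coded V α] (f : α → V) [DefFun V f] : Def V (fun a => I.C (f a)) :=
  I.defC.comp

instance {α : Type} [Coded V α] (f : α → V) [DefFun V f] : Def V (fun a => I.A (f a)) :=
  I.defA.comp

instance {α : Type} [Coded V α] (f : α → V) [DefFun V f] : DefFun V (fun a => I.mem (f a)) :=
  I.defMem.comp

instance : Def V I.C := I.defC

instance : Def V I.A := I.defA

instance : DefFun V I.mem := I.defMem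

theorem exists_empty : ∃ x, I.C x ∧ ¬ I.A x ∧ I.mem x = mkSet ∅ :=
  I.mem_surj (not_atom_mkSet _) fun _ hy => (not_mem_mkSet_empty hy).elim

/-- Classes of the interpretation are the ground classes of codes. Individuals get no members,
whatever `mem` yields for them. -/
instance memStructure : MemStructure I.Carrier where
  E x y := ¬ I.A y.1 ∧ x.1 ∊ I.mem y.1
  Atom x := I.A x.1
  IsClass X := IsClass {x : V | ∃ h : I.C x, (⟨x, h⟩ : I.Carrier) ∈ X}
  nonempty := let ⟨x, hx, _⟩ := I.exists_empty; ⟨⟨x, hx⟩⟩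

variable {I}

theorem E_iff {x y : I.Carrier} : x ∊ y ↔ ¬ I.A y.1 ∧ x.1 ∊ I.mem y.1 := Iff.rfl

theorem isClass_iff {X : Set I.Carrier} :
    IsClass X ↔ IsClass {x : V | ∃ h : I.C x, (⟨x, h⟩ : I.Carrier) ∈ X} := Iff.rfl

theorem carrier_ext {x y : I.Carrier} (hx : ¬ Atom x) (hy : ¬ Atom y) (h : ∀ z, z ∊ x ↔ z ∊ y) :
    x = y := by
  refine Carrier.ext (I.mem_inj x.2 hx y.2 hy
    (ext (I.not_atom x.2 hx) (I.not_atom y.2 hy) fun z => ?_))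
  constructor
  · exact fun hz => ((h ⟨z, I.mem_C x.2 hx hz⟩).1 ⟨hx, hz⟩).2
  · exact fun hz => ((h ⟨z, I.mem_C y.2 hy hz⟩).2 ⟨hy, hz⟩).2

/-- By `mem_surj` every ground set of codes is the extension of a code. The axioms of set existence
are thereby reduced to the ground universe. -/
theorem small_iff {S : Set I.Carrier} :
    Small S ↔ Small {x : V | ∃ h : I.C x, (⟨x, h⟩ : I.Carrier) ∈ S} := by
  constructor
  · rintro ⟨x, hx, h⟩
    refine ⟨I.mem x.1, I.not_atom x.2 hx, fun y => ⟨fun hy => ?_, ?_⟩⟩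
    · exact ⟨I.mem_C x.2 hx hy, (h _).1 ⟨hx, hy⟩⟩
    · rintro ⟨h₁, h₂⟩
      exact ((h _).2 h₂).2
  · rintro ⟨s, hs, h⟩
    obtain ⟨x, hx, hA, rfl⟩ := I.mem_surj hs fun y hy => ((h y).1 hy).1
    refine ⟨⟨x, hx⟩, hA, fun y => ⟨fun hy => ((h _).1 hy.2).2, fun hy => ⟨hA, (h _).2 ⟨y.2, hy⟩⟩⟩⟩

theorem carrier_small_pair (x y : I.Carrier) : Small {z | z = x ∨ z = y} := by
  rw [small_iff]
  convert Universe.pairing x.1 y.1 using 1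
  ext z
  constructor
  · rintro ⟨h, rfl | rfl⟩
    exacts [.inl rfl, .inr rfl]
  · rintro (rfl | rfl)
    exacts [⟨x.2, .inl rfl⟩, ⟨y.2, .inr rfl⟩]

theorem carrier_eq_mkSet_iff {S : Set I.Carrier} {x : I.Carrier} (h : Small S) :
    x = mkSet S ↔ ¬ Atom x ∧ ∀ y, y ∊ x ↔ y ∈ S := by
  have h' : ¬ Atom (mkSet S) ∧ ∀ y, y ∊ mkSet S ↔ y ∈ S := by
    unfold mkSet
    rw [dif_pos h]
    exact h.choose_spec
  constructor
  · rintro rfl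
    exact h'
  · exact fun ⟨h₁, h₂⟩ => carrier_ext h₁ h'.1 fun y => (h₂ y).trans (h'.2 y).symm

/-- A code for `w = {x, y}` -/
def UPair (I : Interp V) (w x y : V) : Prop :=
  ¬ I.A w ∧ ∀ v, I.C v → (v ∊ I.mem w ↔ v = x ∨ v = y)

/-- A code for `p = (x, y)` -/
def OPair (I : Interp V) (p x y : V) : Prop :=
  ¬ I.A p ∧ ∀ w, I.C w → (w ∊ I.mem p ↔ I.UPair w x x ∨ I.UPair w x y)

instance {α : Type} [Coded V α] (f g k : α → V) [DefFun V f] [DefFun V g] [DefFun V k] :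
    Def V (fun a => I.UPair (f a) (g a) (k a)) :=
  Def.comp₃ (P := I.UPair) (by unfold UPair; infer_instance) f g k

instance {α : Type} [Coded V α] (f g k : α → V) [DefFun V f] [DefFun V g] [DefFun V k] :
    Def V (fun a => I.OPair (f a) (g a) (k a)) :=
  Def.comp₃ (P := I.OPair) (by unfold OPair; infer_instance) f g k

theorem uPair_iff {w x y : I.Carrier} : I.UPair w.1 x.1 y.1 ↔ w = mkSet {z | z = x ∨ z = y} := by
  rw [carrier_eq_mkSet_iff (carrier_small_pair x y)]
  refine and_congr_right fun hw => ⟨fun h z => ?_, fun h v hv => ?_⟩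
  · rw [E_iff, h z.1 z.2]
    simp only [Set.mem_ofPred_eq, Carrier.ext_iff]
    exact and_iff_right hw
  · have := h ⟨v, hv⟩
    rw [E_iff] at this
    simp only [Set.mem_ofPred_eq, Carrier.ext_iff] at this
    exact (and_iff_right hw).symm.trans this

/-- Pairs in the sense of the interpretation are not ground pairs. Describing them by the ground
predicate `OPair` allows classes of pairs to be translated. -/
theorem oPair_iff {p x y : I.Carrier} : I.OPair p.1 x.1 y.1 ↔ p = pair x y := by
  unfold pair
  rw [carrier_eq_mkSet_iff (carrier_small_pair _ _)]
  have h₁ : ({w | w = x} : Set I.Carrier) = {w | w = x ∨ w = x} := by simp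
  refine and_congr_right fun hp => ⟨fun h z => ?_, fun h w hw => ?_⟩
  · rw [E_iff, h z.1 z.2, uPair_iff, uPair_iff, h₁]
    exact and_iff_right hp
  · have := h ⟨w, hw⟩
    rw [E_iff, Set.mem_ofPred_eq, h₁, ← uPair_iff, ← uPair_iff] at this
    exact (and_iff_right hp).symm.trans this

open Classical in
/-- A retraction to the codes -/
noncomputable def retract (I : Interp V) (x : V) : V :=
  if I.C x then x else I.exists_empty.choose

theorem retract_C (x : V) : I.C (I.retract x) := by
  unfold retract
  split_ifs with h
  exacts [h, I.exists_empty.choose_spec.1]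

theorem retract_eq {x : V} (h : I.C x) : I.retract x = x :=
  if_pos h

instance {α : Type} [Coded V α] (f : α → V) [DefFun V f] : DefFun V (fun a => I.retract (f a)) := by
  unfold retract
  infer_instance

/-- The code to which an element retracts -/
noncomputable def toCarrier (I : Interp V) (x : V) : I.Carrier :=
  ⟨I.retract x, retract_C x⟩

theorem toCarrier_val (x : I.Carrier) : I.toCarrier x.1 = x :=
  Carrier.ext (retract_eq x.2)

theorem toCarrier_eq {x : V} (h : I.C x) : I.toCarrier x = ⟨x, h⟩ :=
  Carrier.ext (retract_eq h)

/-- The translation of formulas. The retraction `toCarrier` turns quantifiers over codes into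
unrestricted ones. -/
theorem def_of_predicative {n : ℕ} {P : (Fin n → I.Carrier) → Prop} (h : Predicative P) :
    Def V (fun v : Fin n → V => P fun i => I.toCarrier (v i)) := by
  induction h with
  | falsum => exact Def.const False
  | mem i j =>
    exact inferInstanceAs (Def V fun v : Fin _ → V =>
      ¬ I.A (I.retract (v j)) ∧ I.retract (v i) ∊ I.mem (I.retract (v j)))
  | eq i j =>
    refine Def.congr (P := fun v : Fin _ → V => I.retract (v i) = I.retract (v j))
      inferInstance fun v => Carrier.ext_iff
  | atom i => exact inferInstanceAs (Def V fun v : Fin _ → V => I.A (I.retract (v i)))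
  | @cls n X hX i =>
    have : Def V (fun v : Fin n → V => I.retract (v i) ∈ {x : V | ∃ h : I.C x, ⟨x, h⟩ ∈ X}) :=
      Def.of_isClass_mem hX
    exact this.congr fun v => ⟨fun h => ⟨retract_C _, h⟩, fun h => h.2⟩
  | imp _ _ ih₁ ih₂ => infer_instance
  | @all n P _ ih =>
    have : Def V (fun p : (Fin n → V) × V =>
        P fun i => I.toCarrier ((Fin.snoc p.1 p.2 : Fin (n + 1) → V) i)) := ih.comp
    refine Def.congr (P := fun v : Fin n → V =>
      ∀ x : V, P fun i => I.toCarrier ((Fin.snoc v x : Fin (n + 1) → V) i))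
      inferInstance fun v => ?_
    have key : ∀ x : V, (fun i => I.toCarrier ((Fin.snoc v x : Fin (n + 1) → V) i)) =
        (Fin.snoc (fun i => I.toCarrier (v i)) (I.toCarrier x) : Fin (n + 1) → I.Carrier) := by
      intro x
      funext i
      refine Fin.lastCases ?_ (fun i => ?_) i <;> simp
    simp only [key]
    exact ⟨fun h x => h _, fun h x => by simpa [toCarrier_val] using h x.1⟩

/-- The code of a set -/
noncomputable def ofSet (I : Interp V) (s : V) : V :=
  iota fun x => I.C x ∧ ¬ I.A x ∧ I.mem x = s

instance {α : Type} [Coded V α] (f : α → V) [DefFun V f] : DefFun V (fun a => I.ofSet (f a)) :=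
  DefFun.comp (g := I.ofSet) (by unfold ofSet; infer_instance)

instance : DefFun V I.ofSet :=
  (inferInstance : DefFun V fun x => I.ofSet ((fun y => y) x))

theorem ofSet_spec {s : V} (hs : ¬ Atom s) (h : ∀ y, y ∊ s → I.C y) :
    I.C (I.ofSet s) ∧ ¬ I.A (I.ofSet s) ∧ I.mem (I.ofSet s) = s := by
  obtain ⟨x, hx, hA, e⟩ := I.mem_surj hs h
  have : I.ofSet s = x := iota_eq (P := fun x => I.C x ∧ ¬ I.A x ∧ I.mem x = s) ⟨hx, hA, e⟩
    fun y hy => I.mem_inj hy.1 hy.2.1 hx hA (hy.2.2.trans e.symm)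
  rw [this]
  exact ⟨hx, hA, e⟩

theorem ofSet_mem {x : V} (hx : I.C x) (hA : ¬ I.A x) : I.ofSet (I.mem x) = x := by
  have h := ofSet_spec (I.not_atom hx hA) fun y => I.mem_C hx hA
  exact I.mem_inj h.1 h.2.1 hx hA h.2.2

/-- The image of a set under a definable single-valued relation -/
theorem small_of_functional {a : V} {R : V → V → Prop}
    (hR : Def V (fun p : V × V => R p.1 p.2)) (hu : ∀ x y z, R x y → R x z → y = z) :
    Small {z | ∃ y, y ∊ a ∧ R y z} := by
  have hf : DefFun V (fun y => iota fun z => R y z) := inferInstance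
  have : Def V (fun p : V × V => R p.2 p.1) := hR.comp₂ (fun p : V × V => p.2) fun p => p.1
  refine small_of_subset (P := fun z => ∃ y, y ∊ a ∧ R y z) inferInstance
    (a := mkSet {z | ∃ y, y ∊ a ∧ z = iota fun z => R y z}) ?_
  rintro z ⟨y, hy, hz⟩
  rw [mem_mkSet (small_image a fun y => iota fun z => R y z)]
  exact ⟨y, hy, (iota_eq hz fun w hw => hu y w z hw hz).symm⟩

open Classical in
/-- The successor of a code -/
noncomputable def succCode (I : Interp V) (x : V) : V :=
  I.ofSet (mkSet {z | z ∊ (if I.A x then mkSet ∅ else I.mem x) ∨ z = x})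

instance : DefFun V I.succCode := by
  unfold succCode
  infer_instance

theorem succCode_spec {x : V} (hx : I.C x) : I.C (I.succCode x) ∧ ¬ I.A (I.succCode x) ∧
    ∀ w, w ∊ I.mem (I.succCode x) ↔ (¬ I.A x ∧ w ∊ I.mem x) ∨ w = x := by
  classical
  have hm : ∀ w, w ∊ mkSet {z | z ∊ (if I.A x then mkSet ∅ else I.mem x) ∨ z = x} ↔
      (¬ I.A x ∧ w ∊ I.mem x) ∨ w = x := by
    intro w
    rw [mem_mkSet (small_insert _ _)]
    by_cases hA : I.A x
    · simp [hA, not_mem_mkSet_empty]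
    · simp [hA]
  have h := ofSet_spec (I := I) (not_atom_mkSet _) fun y hy => by
    rcases (hm y).1 hy with h | rfl
    exacts [I.mem_C hx h.1 h.2, hx]
  refine ⟨h.1, h.2.1, fun w => ?_⟩
  rw [← hm w, ← h.2.2]
  rfl

/-- A ground set that contains the code of the empty set and is closed under the successor of codes
is cut down to its codes. -/
theorem carrier_infinity [Founded V] : ∃ x : I.Carrier, ¬ Atom x ∧
    (∃ e, e ∊ x ∧ ¬ Atom e ∧ ∀ y, ¬ y ∊ e) ∧
    ∀ y, y ∊ x → ∃ z, z ∊ x ∧ ¬ Atom z ∧ ∀ w, w ∊ z ↔ w ∊ y ∨ w = y := by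
  obtain ⟨e, he, hA, h⟩ := I.exists_empty
  obtain ⟨s, hes, hs⟩ := exists_closed_set e I.succCode
  have hsm := small_sep s I.C
  obtain ⟨x, hx, hxA, hxs⟩ := I.mem_surj (not_atom_mkSet {y | y ∊ s ∧ I.C y}) fun y hy =>
    ((mem_mkSet hsm).1 hy).2
  have hm : ∀ y : I.Carrier, y ∊ (⟨x, hx⟩ : I.Carrier) ↔ y.1 ∊ s := by
    intro y
    rw [E_iff, hxs, mem_mkSet hsm]
    exact ⟨fun h => h.2.1, fun h => ⟨hxA, h, y.2⟩⟩
  refine ⟨⟨x, hx⟩, hxA, ⟨⟨e, he⟩, (hm _).2 hes, hA, fun y hy => ?_⟩, fun y hy => ?_⟩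
  · have := hy.2
    rw [h] at this
    exact not_mem_mkSet_empty this
  · have hz := succCode_spec y.2
    refine ⟨⟨_, hz.1⟩, (hm _).2 (hs _ ((hm y).1 hy)), hz.2.1, fun w => ?_⟩
    rw [E_iff, hz.2.2, E_iff, Carrier.ext_iff]
    exact and_iff_right hz.2.1

/-- The interpretation itself may be ill-founded, as the one with skands will be. Foundation in the
ground universe is needed for `infinity` only. -/
instance toUniverse [Founded V] : Universe I.Carrier where
  toMemStructure := I.memStructure
  not_mem_of_atom h h' := h'.1 h
  ext' := carrier_ext
  isClass_mem x := isClass_iff.2 <| Def.isClass <|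
    Def.congr (P := fun y => ¬ I.A x.1 ∧ y ∊ I.mem x.1) inferInstance fun y =>
      ⟨fun h => h.2, fun h => ⟨I.mem_C x.2 h.1 h.2, h⟩⟩
  comprehension {P} hP := isClass_iff.2 <| by
    have h := def_of_predicative hP
    have : DefFun V (fun x : V => (fun _ => x : Fin 1 → V)) :=
      (defFun_snoc.comp (f := fun x : V => ((fun i => i.elim0 : Fin 0 → V), x))).congr fun x => by
          funext i
          rw [Subsingleton.elim i (Fin.last 0), Fin.snoc_last]
    have h' := h.comp (f := fun x : V => (fun _ => x : Fin 1 → V))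
    refine Def.isClass (Def.congr (P := fun x => I.C x ∧ P fun _ => I.toCarrier x) inferInstance
      fun x => ⟨?_, ?_⟩)
    · rintro ⟨hx, h⟩
      refine ⟨hx, ?_⟩
      rwa [toCarrier_eq hx]
    · rintro ⟨hx, h⟩
      refine ⟨hx, ?_⟩
      rwa [toCarrier_eq hx] at h
  pairing := carrier_small_pair
  union {x} hx := by
    classical
    rw [small_iff]
    convert small_biUnion (I.mem x.1) (fun y => if I.A y then mkSet ∅ else I.mem y) using 1
    ext z
    constructor
    · rintro ⟨hz, y, hy, hzy⟩
      refine ⟨y.1, hy.2, ?_⟩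
      rw [if_neg hzy.1]
      exact hzy.2
    · rintro ⟨y, hy, hz⟩
      have hyC := I.mem_C x.2 hx hy
      split_ifs at hz with hA
      · exact (not_mem_mkSet_empty hz).elim
      · exact ⟨I.mem_C hyC hA hz, ⟨y, hyC⟩, ⟨hx, hy⟩, hA, hz⟩
  power {x} hx := by
    rw [small_iff]
    have hs := small_powerset (I.mem x.1)
    refine small_of_subset (P := fun y => ∃ h : I.C y, (⟨y, h⟩ : I.Carrier) ∈
        {y : I.Carrier | ¬ Atom y ∧ ∀ z, z ∊ y → z ∊ x})
      (a := mkSet {y | ∃ s, s ∊ mkSet {y | ¬ Atom y ∧ ∀ z, z ∊ y → z ∊ I.mem x.1} ∧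
        y = I.ofSet s}) ?_ ?_
    · refine Def.congr (P := fun y => I.C y ∧ ¬ I.A y ∧ ∀ z, z ∊ I.mem y → z ∊ I.mem x.1)
        inferInstance fun y => ⟨?_, ?_⟩
      · rintro ⟨hy, hA, h⟩
        exact ⟨hy, hA, fun z hz => (h ⟨z, I.mem_C hy hA hz⟩ ⟨hA, hz⟩).2⟩
      · rintro ⟨hy, hA, h⟩
        exact ⟨hy, hA, fun z hz => ⟨hx, h _ hz.2⟩⟩
    · rintro y ⟨hy, hA, h⟩
      rw [mem_mkSet (small_image _ fun s => I.ofSet s)]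
      refine ⟨I.mem y, (mem_mkSet hs).2 ⟨I.not_atom hy hA, fun z hz => ?_⟩, (ofSet_mem hy hA).symm⟩
      exact (h ⟨z, I.mem_C hy hA hz⟩ ⟨hA, hz⟩).2
  replacement {x F} hx hF hu := by
    rw [small_iff]
    have hD : Def V (fun p : (V × V) × V => p.2 ∈ {p : V | ∃ h : I.C p, ⟨p, h⟩ ∈ F}) :=
      Def.of_isClass_mem hF
    convert small_of_functional (a := I.mem x.1)
      (R := fun y z => I.C y ∧ I.C z ∧ ∃ p, p ∈ {p : V | ∃ h : I.C p, ⟨p, h⟩ ∈ F} ∧ I.OPair p y z)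
      inferInstance ?_ using 1
    · ext z
      constructor
      · rintro ⟨hz, y, hy, h⟩
        exact ⟨y.1, hy.2, y.2, hz, _, ⟨(pair y ⟨z, hz⟩ : I.Carrier).2, h⟩, oPair_iff.2 rfl⟩
      · rintro ⟨y, hy, hyC, hzC, p, ⟨hp, hpF⟩, h⟩
        refine ⟨hzC, ⟨y, hyC⟩, ⟨hx, hy⟩, ?_⟩
        rwa [← (oPair_iff (p := ⟨p, hp⟩) (x := ⟨y, hyC⟩) (y := ⟨z, hzC⟩)).1 h]
    · rintro a b c ⟨ha, hb, p, ⟨hp, hpF⟩, h⟩ ⟨-, hc, q, ⟨hq, hqF⟩, h'⟩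
      rw [(oPair_iff (p := ⟨p, hp⟩) (x := ⟨a, ha⟩) (y := ⟨b, hb⟩)).1 h] at hpF
      rw [(oPair_iff (p := ⟨q, hq⟩) (x := ⟨a, ha⟩) (y := ⟨c, hc⟩)).1 h'] at hqF
      exact congrArg Carrier.val (hu _ _ _ hpF hqF)
  infinity := carrier_infinity
  choice := by
    obtain ⟨ch, hch, h⟩ := exists_choice (V := V)
    have hch' {β : Type} [Coded V β] (f : β → V) [DefFun V f] : DefFun V (fun b => ch (f b)) :=
      hch.comp
    refine ⟨{p | ∃ x y : I.Carrier, p = pair x y ∧ ¬ Atom x ∧ y.1 = ch (I.mem x.1)}, ?_, ?_, ?_⟩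
    · refine isClass_iff.2 (Def.isClass (Def.congr (P := fun p => I.C p ∧ ∃ x y, I.C x ∧ I.C y ∧
        I.OPair p x y ∧ ¬ I.A x ∧ y = ch (I.mem x)) inferInstance fun p => ⟨?_, ?_⟩))
      · rintro ⟨hp, x, y, e, hx, hy⟩
        exact ⟨hp, x.1, y.1, x.2, y.2, oPair_iff.2 e, hx, hy⟩
      · rintro ⟨hp, x, y, hx, hy, e, hA, h⟩
        exact ⟨hp, ⟨x, hx⟩, ⟨y, hy⟩,
          (oPair_iff (p := ⟨p, hp⟩) (x := ⟨x, hx⟩) (y := ⟨y, hy⟩)).1 e, hA, h⟩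
    · rintro a b c ⟨x, y, e, -, hy⟩ ⟨x', y', e', -, hy'⟩
      obtain ⟨rfl, rfl⟩ := pair_injective_of carrier_small_pair e
      obtain ⟨rfl, rfl⟩ := pair_injective_of carrier_small_pair e'
      exact Carrier.ext (hy.trans hy'.symm)
    · rintro x hx ⟨y, hy⟩
      have := h _ _ hy.2
      exact ⟨⟨_, I.mem_C x.2 hx this⟩, ⟨hx, this⟩, x, _, rfl, hx, rfl⟩

variable [Founded V]

theorem def_iff {P : I.Carrier → Prop} :
    Def I.Carrier P ↔ Def V (fun x => ∃ h : I.C x, P ⟨x, h⟩) :=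
  ⟨fun h => def_of_isClass (isClass_iff.1 h.isClass),
    fun h => def_of_isClass (isClass_iff.2 h.isClass)⟩

theorem def₂_of {P : I.Carrier → I.Carrier → Prop}
    (h : Def V (fun p : V × V => ∃ (h : I.C p.1) (h' : I.C p.2), P ⟨p.1, h⟩ ⟨p.2, h'⟩)) :
    Def I.Carrier (fun p : I.Carrier × I.Carrier => P p.1 p.2) := by
  have h' : Def V (fun p : (V × V) × V =>
    ∃ (h : I.C p.1.2) (h' : I.C p.2), P ⟨p.1.2, h⟩ ⟨p.2, h'⟩) :=
    h.comp (f := fun p : (V × V) × V => (p.1.2, p.2))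
  refine ⟨isClass_iff.2 (Def.isClass (Def.congr (P := fun p : V => ∃ x y : V, I.C p ∧
    I.OPair p x y ∧ ∃ (h : I.C x) (h' : I.C y), P ⟨x, h⟩ ⟨y, h'⟩) inferInstance fun p => ⟨?_, ?_⟩))⟩
  · rintro ⟨hp, ⟨x, y⟩, e, hP⟩
    exact ⟨x.1, y.1, hp, oPair_iff.2 e.symm, x.2, y.2, hP⟩
  · rintro ⟨x, y, hp, e, hx, hy, hP⟩
    exact ⟨hp, (⟨x, hx⟩, ⟨y, hy⟩),
      ((oPair_iff (p := ⟨p, hp⟩) (x := ⟨x, hx⟩) (y := ⟨y, hy⟩)).1 e).symm, hP⟩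

end Interp

end ClassTheory

namespace ClassTheory

open MemStructure (Atom IsClass)

/-! #### A universe with a given number of individuals -/

section AddAtoms

variable {V : Type} [Universe V]

/-- The set `{x}` -/
noncomputable def single (x : V) : V :=
  mkSet {z | z = x}

theorem mem_single {x y : V} : y ∊ single x ↔ y = x :=
  mem_mkSet (small_singleton x)

theorem single_injective {x y : V} (h : single x = single y) : x = y := by
  rw [← mem_single, ← h, mem_single]

instance : DefFun V (single : V → V) := by
  unfold single
  infer_instance

instance {α : Type} [Coded V α] (f : α → V) [DefFun V f] : DefFun V (fun a => single (f a)) :=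
  DefFun.comp (g := single) inferInstance

/-- The codes of individuals: the empty set and, if `u = true`, a two-element set -/
def AtomCode (V : Type) [Universe V] (u : Bool) (x : V) : Prop :=
  x = mkSet ∅ ∨ (u = true ∧ x = mkSet {z | z = mkSet ∅ ∨ z = single (mkSet ∅)})

instance {α : Type} [Coded V α] (u : Bool) (f : α → V) [DefFun V f] :
    Def V (fun a => AtomCode V u (f a)) :=
  Def.comp (P := AtomCode V u) (by unfold AtomCode; infer_instance)

instance (u : Bool) : Def V (AtomCode V u) :=
  inferInstanceAs (Def V fun x => AtomCode V u ((fun y => y) x))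

/-- A set of codes that contains the codes of members of its members; the code of a set `s` of codes
is `{s}`. -/
def CodeClosed (u : Bool) (t : V) : Prop :=
  ∀ y, y ∊ t → AtomCode V u y ∨ ∃ s, ¬ Atom s ∧ y = single s ∧ ∀ z, z ∊ s → z ∊ t

instance {α : Type} [Coded V α] (u : Bool) (f : α → V) [DefFun V f] :
    Def V (fun a => CodeClosed u (f a)) :=
  Def.comp (P := CodeClosed u) (by unfold CodeClosed; infer_instance)

/-- The code of an individual has no member or two different ones, the code of a set exactly one. -/
theorem not_atomCode_single {u : Bool} {x : V} : ¬ AtomCode V u (single x) := by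
  rintro (h | ⟨-, h⟩)
  · exact not_mem_mkSet_empty (h ▸ mem_single.2 rfl)
  · have h₁ : mkSet ∅ ∊ single x := h ▸ (mem_mkSet (Universe.pairing _ _)).2 (.inl rfl)
    have h₂ : single (mkSet ∅) ∊ single x := h ▸ (mem_mkSet (Universe.pairing _ _)).2 (.inr rfl)
    rw [mem_single] at h₁ h₂
    exact not_mem_mkSet_empty (h₁.trans h₂.symm ▸ mem_single.2 rfl)

theorem codeClosed_atom {u : Bool} {x : V} (h : AtomCode V u x) : ∃ t, CodeClosed u t ∧ x ∊ t :=
  ⟨single x, fun _ hy => .inl (mem_single.1 hy ▸ h), mem_single.2 rfl⟩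

/-- Being a code is meant inductively; membership in some closed set is its predicative form. This
is the inversion rule, and `codeClosed_atom` and `codeClosed_single` are the introduction rules. -/
theorem codeClosed_cases {u : Bool} {x : V} (h : ∃ t, CodeClosed u t ∧ x ∊ t)
    (hx : ¬ AtomCode V u x) : ∃ s, ¬ Atom s ∧ x = single s ∧
      ∀ z, z ∊ s → ∃ t, CodeClosed u t ∧ z ∊ t := by
  obtain ⟨t, ht, hxt⟩ := h
  obtain ⟨s, hs, e, h⟩ := (ht x hxt).resolve_left hx
  exact ⟨s, hs, e, fun z hz => ⟨t, ht, h z hz⟩⟩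

theorem codeClosed_single [Founded V] {u : Bool} {s : V} (hs : ¬ Atom s)
    (h : ∀ z, z ∊ s → ∃ t, CodeClosed u t ∧ z ∊ t) : ∃ t, CodeClosed u t ∧ single s ∊ t := by
  -- Rather than choosing a closed set for each member of `s`, all codes in the transitive closure
  -- of `s` are taken.
  have h₁ := small_sep (tc s) fun z => ∃ t, CodeClosed u t ∧ z ∊ t
  have h₂ := small_insert (mkSet {z | z ∊ tc s ∧ ∃ t, CodeClosed u t ∧ z ∊ t}) (single s)
  simp only [mem_mkSet h₁, Set.mem_ofPred_eq] at h₂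
  refine ⟨mkSet {z | (z ∊ tc s ∧ ∃ t, CodeClosed u t ∧ z ∊ t) ∨ z = single s}, ?_,
    (mem_mkSet h₂).2 (.inr rfl)⟩
  intro y hy
  rw [mem_mkSet h₂] at hy
  rcases hy with ⟨hy, t, ht, hyt⟩ | rfl
  · refine (ht y hyt).imp_right ?_
    rintro ⟨r, hr, rfl, h'⟩
    refine ⟨r, hr, rfl, fun z hz => (mem_mkSet h₂).2 (.inl ⟨?_, t, ht, h' z hz⟩)⟩
    exact transitive_tc s r z (transitive_tc s _ r hy (mem_single.2 rfl)) hz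
  · exact .inr ⟨s, hs, rfl, fun z hz => (mem_mkSet h₂).2 (.inl ⟨mem_tc_of_mem hz, h z hz⟩)⟩

theorem iota_single (s : V) : (iota fun r => single s = single r) = s :=
  iota_eq rfl fun _ h => (single_injective h).symm

/-- The interpretation of a universe with one or two individuals -/
noncomputable def atomInterp (V : Type) [Universe V] [Founded V] (u : Bool) : Interp V where
  C x := ∃ t, CodeClosed u t ∧ x ∊ t
  A x := AtomCode V u x
  mem x := iota fun s => x = single s
  defC := inferInstance
  defA := inferInstance
  defMem := inferInstance
  not_atom hx hA := by
    obtain ⟨s, hs, rfl, -⟩ := codeClosed_cases hx hA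
    rwa [iota_single]
  mem_C hx hA h := by
    obtain ⟨s, hs, rfl, h'⟩ := codeClosed_cases hx hA
    rw [iota_single] at h
    exact h' _ h
  mem_inj hx hA hy hB h := by
    obtain ⟨s, -, rfl, -⟩ := codeClosed_cases hx hA
    obtain ⟨r, -, rfl, -⟩ := codeClosed_cases hy hB
    rw [iota_single, iota_single] at h
    rw [h]
  mem_surj {s} hs h := ⟨single s, codeClosed_single hs h, not_atomCode_single, iota_single s⟩

/-- One step of membership between codes is two steps in the ground universe, from `single s` to `s`
to a member of `s`. So the class in which a minimal element is sought also contains the intermediate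
sets `s`. -/
instance (u : Bool) [Founded V] : Founded (atomInterp V u).Carrier where
  foundation {X} hX hne := by
    have hX' := Interp.isClass_iff.1 hX
    let Y : Set V := {x : V | ∃ h : (atomInterp V u).C x, (⟨x, h⟩ : (atomInterp V u).Carrier) ∈ X}
    have hY {α : Type} [Coded V α] (f : α → V) [DefFun V f] : Def V (fun a => f a ∈ Y) :=
      Def.of_isClass_mem hX'
    have hY' : Def V (fun a => a ∈ Y) := Def.of_isClass_mem hX'
    by_contra hcon
    push Not at hcon
    obtain ⟨x, hx⟩ := hne
    obtain ⟨m, hm, hmin⟩ := exists_minimal (P := fun x => x ∈ Y ∨ single x ∈ Y)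
      ⟨x.1, .inl ⟨x.2, hx⟩⟩
    have key : ∀ {y : V}, y ∈ Y → ∃ s, y = single s ∧ ∃ z, z ∊ s ∧ z ∈ Y := by
      rintro y ⟨hy, hyX⟩
      obtain ⟨z, hz, hzX⟩ := hcon _ hyX
      obtain ⟨s, -, e, -⟩ := codeClosed_cases hy hz.1
      refine ⟨s, e, z.1, ?_, z.2, hzX⟩
      have := hz.2
      change z.1 ∊ iota fun s => y = single s at this
      rwa [e, iota_single] at this
    rcases hm with hm | hm
    · obtain ⟨s, rfl, -⟩ := key hm
      exact hmin s (mem_single.2 rfl) (.inr hm)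
    · obtain ⟨s, e, z, hz, hzY⟩ := key hm
      obtain rfl := single_injective e
      exact hmin z hz (.inl hzY)

/-- There is a universe with foundation that has one individual, or two if `u = true`; the
individual `s` is distinguished. -/
theorem exists_universe_with_atoms [Founded V] (u : Bool) :
    ∃ (U : Type) (_ : Universe U) (_ : Founded U) (s : U), Atom s ∧ Small {x : U | Atom x} ∧
      ((∃ x : U, Atom x ∧ x ≠ s) ↔ u = true) := by
  have h₀ : AtomCode V u (mkSet ∅) := .inl rfl
  refine ⟨(atomInterp V u).Carrier, inferInstance, inferInstance, ⟨mkSet ∅, codeClosed_atom h₀⟩,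
    h₀, ?_, ?_⟩
  · rw [Interp.small_iff]
    refine small_of_subset (P := fun x => ∃ h : (atomInterp V u).C x,
      (⟨x, h⟩ : (atomInterp V u).Carrier) ∈ {x : (atomInterp V u).Carrier | Atom x})
      (a := mkSet {x | x = mkSet ∅ ∨ x = mkSet {z | z = mkSet ∅ ∨ z = single (mkSet ∅)}}) ?_ ?_
    · refine Def.congr (P := fun x => (atomInterp V u).C x ∧ AtomCode V u x) inferInstance
        fun x => ⟨fun ⟨h, h'⟩ => ⟨h, h'⟩, fun ⟨h, h'⟩ => ⟨h, h'⟩⟩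
    · rintro x ⟨_, h⟩
      exact (mem_mkSet (Universe.pairing _ _)).2 (Or.imp_right And.right h)
  · constructor
    · rintro ⟨x, h | h, hne⟩
      · exact (hne (Interp.Carrier.ext h)).elim
      · exact h.1
    · rintro rfl
      have h₁ : AtomCode V true (mkSet {z | z = mkSet ∅ ∨ z = single (mkSet ∅)}) := .inr ⟨rfl, rfl⟩
      refine ⟨⟨_, codeClosed_atom h₁⟩, h₁, fun e => ?_⟩
      have e' := congrArg Interp.Carrier.val e
      refine not_mem_mkSet_empty (y := mkSet (∅ : Set V)) ?_
      simp only at e'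
      rw [← e', mem_mkSet (Universe.pairing _ _)]
      exact .inl (by rw [e'])

end AddAtoms

end ClassTheory

namespace ClassTheory

open MemStructure (Atom IsClass)

/-! #### Ordinals -/

section Ordinals

variable {V : Type} [Universe V]

/-- Ordinals, as transitive sets of transitive sets -/
def IsOrd (x : V) : Prop :=
  ¬ Atom x ∧ Transitive x ∧ ∀ y, y ∊ x → ¬ Atom y ∧ Transitive y

instance : Def V (IsOrd : V → Prop) := by
  unfold IsOrd
  infer_instance

instance {α : Type} [Coded V α] (f : α → V) [DefFun V f] : Def V (fun a => IsOrd (f a)) :=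
  Def.comp (P := IsOrd) inferInstance

theorem IsOrd.of_mem {a b : V} (ha : IsOrd a) (hb : b ∊ a) : IsOrd b :=
  ⟨(ha.2.2 b hb).1, (ha.2.2 b hb).2, fun y hy => ha.2.2 y (ha.2.1 b y hb hy)⟩

theorem isOrd_of_transitive {a : V} (ha : ¬ Atom a) (ht : Transitive a)
    (h : ∀ y, y ∊ a → IsOrd y) : IsOrd a :=
  ⟨ha, ht, fun y hy => ⟨(h y hy).1, (h y hy).2.1⟩⟩

theorem isOrd_zero : IsOrd (mkSet ∅ : V) :=
  ⟨not_atom_mkSet _, fun _ _ h => (not_mem_mkSet_empty h).elim,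
    fun _ h => (not_mem_mkSet_empty h).elim⟩

/-- The successor `a ∪ {a}` -/
noncomputable def osucc (a : V) : V :=
  mkSet {z | z ∊ a ∨ z = a}

instance : DefFun V (osucc : V → V) := by
  unfold osucc
  infer_instance

instance {α : Type} [Coded V α] (f : α → V) [DefFun V f] : DefFun V (fun a => osucc (f a)) :=
  DefFun.comp (g := osucc) inferInstance

theorem mem_osucc {a z : V} : z ∊ osucc a ↔ z ∊ a ∨ z = a :=
  mem_mkSet (small_insert a a)

theorem IsOrd.osucc {a : V} (ha : IsOrd a) : IsOrd (osucc a) := by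
  refine isOrd_of_transitive (not_atom_mkSet _) (fun x y hx hy => ?_) fun y hy => ?_
  · rw [mem_osucc] at hx ⊢
    rcases hx with hx | rfl
    exacts [.inl (ha.2.1 x y hx hy), .inl hy]
  · rcases mem_osucc.1 hy with hy | rfl
    exacts [ha.of_mem hy, ha]

/-- `a ≤ x`, for ordinals -/
def Le (a x : V) : Prop :=
  x = a ∨ a ∊ x

instance {α : Type} [Coded V α] (f g : α → V) [DefFun V f] [DefFun V g] :
    Def V (fun a => Le (f a) (g a)) := by
  unfold Le
  infer_instance

instance (a : V) : Def V (Le a) :=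
  inferInstanceAs (Def V fun x => Le ((fun _ => a) x) ((fun y => y) x))

theorem Le.trans_mem {a x y : V} (hy : IsOrd y) (h : Le a x) (h' : x ∊ y) : a ∊ y := by
  rcases h with rfl | h
  exacts [h', hy.2.1 x a h' h]

theorem mem_of_mem_le {a x y : V} (hy : IsOrd y) (h : a ∊ x) (h' : Le x y) : a ∊ y := by
  rcases h' with rfl | h'
  exacts [h, hy.2.1 x a h' h]

/-- The ordinal values of a function on a set are bounded. -/
theorem exists_upper_bound (s : V) (f : V → V) [hf : DefFun V f] (h : ∀ x, x ∊ s → IsOrd (f x)) :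
    ∃ b, IsOrd b ∧ ∀ x, x ∊ s → f x ∊ b := by
  have hs := small_biUnion s fun x => osucc (f x)
  refine ⟨mkSet {z | ∃ x, x ∊ s ∧ z ∊ osucc (f x)},
    isOrd_of_transitive (not_atom_mkSet _) ?_ ?_, ?_⟩
  · intro y z hy hz
    rw [mem_mkSet hs] at hy ⊢
    obtain ⟨x, hx, hy⟩ := hy
    exact ⟨x, hx, (h x hx).osucc.2.1 y z hy hz⟩
  · intro y hy
    obtain ⟨x, hx, hy⟩ := (mem_mkSet hs).1 hy
    exact (h x hx).osucc.of_mem hy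
  · exact fun x hx => (mem_mkSet hs).2 ⟨x, hx, mem_osucc.2 (.inr rfl)⟩

variable [Founded V]

/-- Double induction: incomparable `a` and `b` all of whose members are comparable with the other
one would have the same members. -/
theorem IsOrd.trichotomy {a b : V} (ha : IsOrd a) (hb : IsOrd b) : a ∊ b ∨ a = b ∨ b ∊ a := by
  have key : ∀ a : V, IsOrd a → ∀ b, IsOrd b → a ∊ b ∨ a = b ∨ b ∊ a := by
    intro a
    induction a using mem_induction with
    | hP => infer_instance
    | h a iha =>
      intro ha b
      induction b using mem_induction with
      | hP => infer_instance
      | h b ihb =>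
        intro hb
        by_contra h
        push Not at h
        refine h.2.1 (ext ha.1 hb.1 fun z => ⟨fun hz => ?_, fun hz => ?_⟩)
        · rcases iha z hz (ha.of_mem hz) b hb with h' | rfl | h'
          exacts [h', (h.2.2 hz).elim, (h.2.2 (ha.2.1 z b hz h')).elim]
        · rcases ihb z hz (hb.of_mem hz) with h' | rfl | h'
          exacts [(h.1 (hb.2.1 z a hz h')).elim, (h.1 hz).elim, h']
  exact key a ha b hb

/-- The Burali-Forti argument. -/
theorem not_small_isOrd : ¬ Small {x : V | IsOrd x} := by
  rintro ⟨a, ha, h⟩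
  have : IsOrd a := isOrd_of_transitive ha
    (fun x y hx hy => (h y).2 (((h x).1 hx : IsOrd x).of_mem hy)) fun y hy => (h y).1 hy
  exact not_mem_self a ((h a).2 this)

theorem le_or_mem {a x : V} (ha : IsOrd a) (hx : IsOrd x) : Le a x ∨ x ∊ a := by
  rcases ha.trichotomy hx with h | h | h
  exacts [.inl (.inr h), .inl (.inl h.symm), .inr h]

theorem not_mem_of_le {a x : V} (h : Le a x) : ¬ x ∊ a := by
  rcases h with rfl | h
  exacts [not_mem_self x, mem_asymm h]

theorem osucc_le_iff {a x : V} (ha : IsOrd a) (hx : IsOrd x) : Le (osucc a) x ↔ a ∊ x := by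
  constructor
  · exact mem_of_mem_le hx (mem_osucc.2 (.inr rfl))
  · intro h
    rcases le_or_mem ha.osucc hx with h' | h'
    · exact h'
    · rcases mem_osucc.1 h' with h' | rfl
      exacts [(mem_asymm h h').elim, (not_mem_self _ h).elim]

theorem exists_least {P : V → Prop} [hP : Def V P] (h : ∃ a, IsOrd a ∧ P a) :
    ∃ a, IsOrd a ∧ P a ∧ ∀ b, IsOrd b → P b → Le a b := by
  obtain ⟨a, ⟨ha, hPa⟩, hmin⟩ := exists_minimal (P := fun a => IsOrd a ∧ P a) h
  refine ⟨a, ha, hPa, fun b hb hPb => (le_or_mem ha hb).resolve_right fun h' => ?_⟩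
  exact hmin b h' ⟨hb, hPb⟩

/-! #### The collapse of a segment of ordinals -/

/-- The Mostowski collapse of the elements `≥ a`. As `a` is a parameter of the recursion, the result
is definable in both arguments. -/
theorem exists_collapse : ∃ F : V → V → V, DefFun V (fun p : V × V => F p.1 p.2) ∧
    (∀ a x, ¬ Atom (F a x)) ∧ ∀ a x z, z ∊ F a x ↔ ∃ y, y ∊ x ∧ Le a y ∧ z = F a y := by
  obtain ⟨F, hF, h⟩ := exists_recursion (V := V) (α := V)
    fun a x g => mkSet {z | ∃ y, (y ∊ x ∧ Le a y) ∧ z = ap g y}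
  refine ⟨F, hF, fun a x => h a x ▸ not_atom_mkSet _, fun a x z => ?_⟩
  have hFa : DefFun V (F a) := hF.comp₂ (fun _ : V => a) fun x => x
  have hs := small_image (mkSet {y | y ∊ x ∧ Le a y}) (F a)
  simp only [mem_mkSet (small_sep x (Le a)), Set.mem_ofPred_eq] at hs
  rw [h]
  have e : ({z | ∃ y, (y ∊ x ∧ Le a y) ∧ z = ap (graphOn (F a) x) y} : Set V) =
      {z | ∃ y, (y ∊ x ∧ Le a y) ∧ z = F a y} := by
    ext z
    constructor <;> rintro ⟨y, hy, rfl⟩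
    · exact ⟨y, hy, ap_graphOn hy.1⟩
    · exact ⟨y, hy, (ap_graphOn hy.1).symm⟩
  rw [e, mem_mkSet hs]
  simp only [Set.mem_ofPred_eq, and_assoc]

/-- The order type of the segment from `a` to `x` -/
noncomputable def col (a x : V) : V :=
  exists_collapse.choose a x

theorem mem_col {a x z : V} : z ∊ col a x ↔ ∃ y, y ∊ x ∧ Le a y ∧ z = col a y :=
  exists_collapse.choose_spec.2.2 a x z

theorem not_atom_col (a x : V) : ¬ Atom (col a x) :=
  exists_collapse.choose_spec.2.1 a x

instance {α : Type} [Coded V α] (f g : α → V) [DefFun V f] [DefFun V g] :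
    DefFun V (fun a => col (f a) (g a)) :=
  exists_collapse.choose_spec.1.comp₂ f g

instance (a : V) : DefFun V (col a) :=
  exists_collapse.choose_spec.1.comp₂ (fun _ => a) fun y => y

theorem isOrd_col {a x : V} (hx : IsOrd x) : IsOrd (col a x) := by
  induction x using mem_induction with
  | hP => infer_instance
  | h x ih =>
    refine isOrd_of_transitive (not_atom_col a x) ?_ ?_
    · intro y z hy hz
      obtain ⟨y', hy', -, rfl⟩ := mem_col.1 hy
      obtain ⟨z', hz', haz, rfl⟩ := mem_col.1 hz
      exact mem_col.2 ⟨z', hx.2.1 y' z' hy' hz', haz, rfl⟩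
    · intro y hy
      obtain ⟨y', hy', -, rfl⟩ := mem_col.1 hy
      exact ih y' hy' (hx.of_mem hy')

theorem col_mem_col {a x y : V} (h : x ∊ y) (hx : Le a x) : col a x ∊ col a y :=
  mem_col.2 ⟨x, h, hx, rfl⟩

theorem col_injective {a x y : V} (hx : IsOrd x) (hy : IsOrd y) (hax : Le a x) (hay : Le a y)
    (h : col a x = col a y) : x = y := by
  rcases hx.trichotomy hy with h' | h' | h'
  · exact (not_mem_self _ (h ▸ col_mem_col h' hax)).elim
  · exact h'
  · exact (not_mem_self _ (h ▸ col_mem_col h' hay)).elim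

theorem col_mem_col_iff {a x y : V} (hx : IsOrd x) (hy : IsOrd y) (hax : Le a x) (hay : Le a y) :
    col a x ∊ col a y ↔ x ∊ y := by
  refine ⟨fun h => ?_, fun h => col_mem_col h hax⟩
  rcases hx.trichotomy hy with h' | rfl | h'
  exacts [h', (not_mem_self _ h).elim, (mem_asymm h (col_mem_col h' hay)).elim]

theorem col_self {a : V} : col a a = mkSet ∅ := by
  refine (eq_mkSet_iff small_empty).2 ⟨not_atom_col a a, fun y => ?_⟩
  rw [mem_col]
  simp only [Set.mem_empty_iff_false, iff_false]
  rintro ⟨z, hz, haz, -⟩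
  exact not_mem_of_le haz hz

theorem col_zero {x : V} (hx : IsOrd x) : col (mkSet ∅) x = x := by
  induction x using mem_induction with
  | hP => infer_instance
  | h x ih =>
    refine ext (isOrd_col hx).1 hx.1 fun z => ?_
    rw [mem_col]
    constructor
    · rintro ⟨y, hy, -, rfl⟩
      rwa [ih y hy (hx.of_mem hy)]
    · intro hz
      have hz' := hx.of_mem hz
      exact ⟨z, hz, (le_or_mem isOrd_zero hz').resolve_right not_mem_mkSet_empty,
        (ih z hz hz').symm⟩

theorem zero_le {x : V} (hx : IsOrd x) : Le (mkSet ∅) x :=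
  (le_or_mem isOrd_zero hx).resolve_right not_mem_mkSet_empty

/-- Reindexing commutes with dropping the first index. Thus the tail of a system can be formed
before or after passing to the normal form. -/
theorem col_one_col {a x : V} (ha : IsOrd a) (hx : IsOrd x) :
    col (osucc (mkSet ∅)) (col a x) = col (osucc a) x := by
  induction x using mem_induction with
  | hP => infer_instance
  | h x ih =>
    refine ext (isOrd_col (isOrd_col hx)).1 (isOrd_col hx).1 fun z => ?_
    rw [mem_col, mem_col]
    have key : ∀ {y}, IsOrd y → Le a y → (Le (osucc (mkSet ∅)) (col a y) ↔ Le (osucc a) y) := by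
      intro y hy hay
      rw [osucc_le_iff isOrd_zero (isOrd_col hy), osucc_le_iff ha hy, ← col_self (a := a),
        col_mem_col_iff ha hy (.inl rfl) hay]
    constructor
    · rintro ⟨_, hw, h1, rfl⟩
      obtain ⟨y, hy, hay, rfl⟩ := mem_col.1 hw
      have hyo := hx.of_mem hy
      exact ⟨y, hy, (key hyo hay).1 h1, ih y hy hyo⟩
    · rintro ⟨y, hy, hay, rfl⟩
      have hyo := hx.of_mem hy
      have hay' : Le a y := .inr ((osucc_le_iff ha hyo).1 hay)
      exact ⟨col a y, col_mem_col hy hay', (key hyo hay').2 hay, (ih y hy hyo).symm⟩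

end Ordinals

end ClassTheory

namespace ClassTheory

open MemStructure (Atom IsClass)

set_option synthInstance.maxHeartbeats 1000000
set_option synthInstance.maxSize 2000
set_option maxHeartbeats 1000000
set_option linter.unusedSectionVars false

/-! #### Systems of components -/

/-- A universe with a distinguished individual in which the individuals form a set -/
class Marked (V : Type) [Universe V] where
  /-- The distinguished individual -/
  mark : V
  atom_mark : Atom mark
  small_atoms : Small {x : V | Atom x}

open Marked (mark atom_mark)

/-! ### Elements in which the distinguished individual does not occur -/

section Tame

variable {V : Type} [Universe V]

theorem mem_tc_iff [Founded V] {x z : V} : z ∊ tc x ↔ z ∊ x ∨ ∃ y, y ∊ x ∧ z ∊ tc y := by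
  have h := small_union x (mkSet {z | ∃ y, y ∊ x ∧ z ∊ tc y})
  simp only [mem_mkSet (small_biUnion x fun y => tc y), Set.mem_ofPred_eq] at h
  constructor
  · intro hz
    refine (mem_mkSet h).1 (mem_tc.1 hz _ ?_ fun y hy => (mem_mkSet h).2 (.inl hy))
    intro v w hv hw
    rw [mem_mkSet h] at hv ⊢
    rcases hv with hv | ⟨y, hy, hv⟩
    exacts [.inr ⟨v, hv, mem_tc_of_mem hw⟩, .inr ⟨y, hy, transitive_tc y v w hv hw⟩]
  · rintro (hz | ⟨y, hy, hz⟩)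
    · exact mem_tc_of_mem hz
    · exact mem_tc.1 hz _ (transitive_tc x) fun w hw => transitive_tc x y w (mem_tc_of_mem hy) hw

variable [Marked V]

/-- The distinguished individual does not occur in `x`. -/
def Tame (x : V) : Prop :=
  x ≠ mark ∧ ¬ mark ∊ tc x

instance {α : Type} [Coded V α] (f : α → V) [DefFun V f] : Def V (fun a => Tame (f a)) :=
  Def.comp (P := Tame) (by unfold Tame; infer_instance)

instance : Def V (Tame : V → Prop) :=
  inferInstanceAs (Def V fun x : V => Tame ((fun y => y) x))

variable [Founded V]

theorem tame_iff {x : V} : Tame x ↔ x ≠ mark ∧ ∀ y, y ∊ x → Tame y := by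
  unfold Tame
  rw [mem_tc_iff]
  refine and_congr_right fun _ => ⟨fun h y hy => ⟨?_, fun h' => h (.inr ⟨y, hy, h'⟩)⟩, ?_⟩
  · rintro rfl
    exact h (.inl hy)
  · rintro h (h' | ⟨y, hy, h'⟩)
    exacts [(h _ h').1 rfl, (h y hy).2 h']

theorem tame_iff_of_not_atom {x : V} (hx : ¬ Atom x) : Tame x ↔ ∀ y, y ∊ x → Tame y := by
  rw [tame_iff, and_iff_right]
  rintro rfl
  exact hx atom_mark

theorem Tame.of_mem {x y : V} (h : Tame x) (hy : y ∊ x) : Tame y :=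
  (tame_iff.1 h).2 y hy

theorem tame_mkSet {S : Set V} (hS : Small S) : Tame (mkSet S) ↔ ∀ y ∈ S, Tame y := by
  simp only [tame_iff_of_not_atom (not_atom_mkSet S), mem_mkSet hS]

theorem tame_pair {x y : V} : Tame (pair x y) ↔ Tame x ∧ Tame y := by
  rw [pair, tame_mkSet (small_pair x y)]
  simp only [Set.mem_ofPred_eq, forall_eq_or_imp, forall_eq, tame_mkSet (small_singleton x),
    tame_mkSet (Universe.pairing x y)]
  tauto

theorem IsOrd.tame {x : V} (hx : IsOrd x) : Tame x := by
  induction x using mem_induction with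
  | hP => infer_instance
  | h x ih => exact (tame_iff_of_not_atom hx.1).2 fun y hy => ih y hy (hx.of_mem hy)

/-- This separates the codes of skands from everything that may occur inside a component. -/
theorem not_tame_pair_mark (F : V) : ¬ Tame (pair mark F) := fun h =>
  (tame_pair.1 h).1.1 rfl

end Tame

/-! ### Systems, their tails and their normal forms -/

section System

variable {V : Type} [Universe V] [Founded V]

/-- The segment `{x | a ≤ x < c}` has length at least `ω`. -/
def Long (a c : V) : Prop :=
  ∃ l, IsOrd l ∧ a ∊ l ∧ (l = c ∨ l ∊ c) ∧ ∀ x, x ∊ l → ∃ y, y ∊ l ∧ x ∊ y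

instance {α : Type} [Coded V α] (f g : α → V) [DefFun V f] [DefFun V g] :
    Def V (fun a => Long (f a) (g a)) :=
  Def.comp₂ (P := Long) (by unfold Long; infer_instance) f g

/-- The system `f`, reindexed by the order type of its segment, which begins with `a` -/
noncomputable def hat (a f : V) : V :=
  mkSet {p | ∃ q, q ∊ f ∧ ∃ x y, q = pair x y ∧ p = pair (col a x) y}

/-- The restriction of `f` to the indices from `b` on -/
noncomputable def restr (f b : V) : V :=
  mkSet {p | p ∊ f ∧ ∃ x y, p = pair x y ∧ Le b x}

/-- The second component of a pair -/
noncomputable def second (p : V) : V :=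
  iota fun y => ∃ x, p = pair x y

instance {α : Type} [Coded V α] (f g : α → V) [DefFun V f] [DefFun V g] :
    DefFun V (fun a => restr (f a) (g a)) :=
  DefFun.comp₂ (F := restr) (by unfold restr; infer_instance) f g

instance : DefFun V (second : V → V) := by
  unfold second
  infer_instance

instance {α : Type} [Coded V α] (f : α → V) [DefFun V f] : DefFun V (fun a => second (f a)) :=
  DefFun.comp (g := second) inferInstance

theorem second_pair (x y : V) : second (pair x y) = y :=
  iota_eq ⟨x, rfl⟩ fun _ ⟨_, h⟩ => (pair_injective h).2.symm

theorem mem_restr {f b p : V} : p ∊ restr f b ↔ p ∊ f ∧ ∃ x y, p = pair x y ∧ Le b x :=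
  mem_mkSet (small_sep f fun p => ∃ x y, p = pair x y ∧ Le b x)

theorem pair_mem_restr {f b x y : V} : pair x y ∊ restr f b ↔ pair x y ∊ f ∧ Le b x := by
  rw [mem_restr]
  refine and_congr_right fun _ => ⟨?_, fun h => ⟨x, y, rfl, h⟩⟩
  rintro ⟨x', y', e, h⟩
  obtain ⟨rfl, rfl⟩ := pair_injective e
  exact h

/-- Two sets of pairs are equal if they contain the same pairs. -/
theorem ext_pair {f g : V} (hf : ¬ Atom f) (hg : ¬ Atom g) (hf' : ∀ p, p ∊ f → ∃ x y, p = pair x y)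
    (hg' : ∀ p, p ∊ g → ∃ x y, p = pair x y) (h : ∀ x y, pair x y ∊ f ↔ pair x y ∊ g) : f = g := by
  refine ext hf hg fun p => ⟨fun hp => ?_, fun hp => ?_⟩
  · obtain ⟨x, y, rfl⟩ := hf' p hp
    exact (h x y).1 hp
  · obtain ⟨x, y, rfl⟩ := hg' p hp
    exact (h x y).2 hp

instance {α : Type} [Coded V α] (f g : α → V) [DefFun V f] [DefFun V g] :
    DefFun V (fun a => hat (f a) (g a)) :=
  DefFun.comp₂ (F := hat) (by unfold hat; infer_instance) f g

theorem mem_hat {a f p : V} :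
    p ∊ hat a f ↔ ∃ q, q ∊ f ∧ ∃ x y, q = pair x y ∧ p = pair (col a x) y := by
  refine mem_mkSet (S := {p | ∃ q, q ∊ f ∧ ∃ x y, q = pair x y ∧ p = pair (col a x) y})
    (Interp.small_of_functional (a := f)
      (R := fun q p => ∃ x y, q = pair x y ∧ p = pair (col a x) y) inferInstance ?_)
  rintro q p p' ⟨x, y, rfl, rfl⟩ ⟨x', y', e, rfl⟩
  obtain ⟨rfl, rfl⟩ := pair_injective e
  rfl

theorem pair_mem_hat {a f z y : V} : pair z y ∊ hat a f ↔ ∃ x, z = col a x ∧ pair x y ∊ f := by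
  rw [mem_hat]
  constructor
  · rintro ⟨q, hq, x, y', rfl, e⟩
    obtain ⟨rfl, rfl⟩ := pair_injective e
    exact ⟨x, rfl, hq⟩
  · rintro ⟨x, rfl, h⟩
    exact ⟨_, h, x, y, rfl, rfl⟩

theorem exists_pair_of_mem_hat {a f p : V} (h : p ∊ hat a f) : ∃ x y, p = pair x y := by
  obtain ⟨-, -, x, y, -, rfl⟩ := mem_hat.1 h
  exact ⟨_, _, rfl⟩

theorem Long.col {a c : V} (h : Long a c) : Long (mkSet ∅) (col a c) := by
  obtain ⟨l, hl, hal, hlc, hlim⟩ := h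
  refine ⟨ClassTheory.col a l, isOrd_col hl, ?_, ?_, ?_⟩
  · rw [← col_self (a := a)]
    exact col_mem_col hal (.inl rfl)
  · rcases hlc with rfl | hlc
    exacts [.inl rfl, .inr (col_mem_col hlc (.inr hal))]
  · intro x hx
    obtain ⟨x, hx', hax, rfl⟩ := mem_col.1 hx
    obtain ⟨y, hy, hxy⟩ := hlim x hx'
    exact ⟨_, col_mem_col hy (.inr (hax.trans_mem (hl.of_mem hy) hxy)), col_mem_col hxy hax⟩

/-- A limit ordinal above `a` is also above the successor of `a`, so the tail of a long system is
long. -/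
theorem Long.osucc {a c : V} (h : Long a c) (ha : IsOrd a) (hc : IsOrd c) :
    Long (osucc a) c ∧ osucc a ∊ c := by
  obtain ⟨l, hl, hal, hlc, hlim⟩ := h
  have key : ClassTheory.osucc a ∊ l := by
    obtain ⟨y, hy, hay⟩ := hlim a hal
    exact ((osucc_le_iff ha (hl.of_mem hy)).2 hay).trans_mem hl hy
  refine ⟨⟨l, hl, key, hlc, hlim⟩, ?_⟩
  rcases hlc with rfl | hlc
  exacts [key, hc.2.1 l _ hlc key]

variable [Marked V]

/-- `f` is a system of components with the index segment `{x | a ≤ x < c}`. -/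
structure System (f a c : V) : Prop where
  not_atom : ¬ Atom f
  left : IsOrd a
  right : IsOrd c
  lt : a ∊ c
  exists_pair : ∀ p, p ∊ f → ∃ x y, p = pair x y
  functional : ∀ x y z, pair x y ∊ f → pair x z ∊ f → y = z
  domain : ∀ x, (Le a x ∧ x ∊ c) ↔ ∃ y, pair x y ∊ f
  value : ∀ x y, pair x y ∊ f → ¬ Atom y ∧ Tame y

instance {α : Type} [Coded V α] (f g k : α → V) [DefFun V f] [DefFun V g] [DefFun V k] :
    Def V (fun a => System (f a) (g a) (k a)) := by
  refine Def.comp₃ (P := System) ?_ f g k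
  refine Def.congr (P := fun p : V × V × V => ¬ Atom p.1 ∧ IsOrd p.2.1 ∧ IsOrd p.2.2 ∧
    p.2.1 ∊ p.2.2 ∧ (∀ q, q ∊ p.1 → ∃ x y, q = pair x y) ∧
    (∀ x y z, pair x y ∊ p.1 → pair x z ∊ p.1 → y = z) ∧
    (∀ x, (Le p.2.1 x ∧ x ∊ p.2.2) ↔ ∃ y, pair x y ∊ p.1) ∧
    ∀ x y, pair x y ∊ p.1 → ¬ Atom y ∧ Tame y) inferInstance fun p => ⟨?_, ?_⟩
  · exact fun ⟨h₁, h₂, h₃, h₄, h₅, h₆, h₇, h₈⟩ => ⟨h₁, h₂, h₃, h₄, h₅, h₆, h₇, h₈⟩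
  · exact fun ⟨h₁, h₂, h₃, h₄, h₅, h₆, h₇, h₈⟩ => ⟨h₁, h₂, h₃, h₄, h₅, h₆, h₇, h₈⟩

namespace System

variable {f a c : V}

theorem ord_of_mem (h : System f a c) {x y : V} (hx : pair x y ∊ f) : IsOrd x :=
  h.right.of_mem ((h.domain x).2 ⟨y, hx⟩).2

theorem le_of_mem (h : System f a c) {x y : V} (hx : pair x y ∊ f) : Le a x :=
  ((h.domain x).2 ⟨y, hx⟩).1

theorem ap_mem (h : System f a c) {x : V} (hx : Le a x) (hxc : x ∊ c) : pair x (ap f x) ∊ f := by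
  obtain ⟨y, hy⟩ := (h.domain x).1 ⟨hx, hxc⟩
  rwa [ap_eq hy fun z hz => h.functional x z y hz hy]

theorem ap_eq (h : System f a c) {x y : V} (hy : pair x y ∊ f) : ap f x = y :=
  ClassTheory.ap_eq hy fun z hz => h.functional x z y hz hy

theorem hat (h : System f a c) : System (hat a f) (mkSet ∅) (col a c) where
  not_atom := not_atom_mkSet _
  left := isOrd_zero
  right := isOrd_col h.right
  lt := by
    rw [← col_self (a := a)]
    exact col_mem_col h.lt (.inl rfl)
  exists_pair _ := exists_pair_of_mem_hat
  functional x y z hy hz := by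
    obtain ⟨v, rfl, hy'⟩ := pair_mem_hat.1 hy
    obtain ⟨w, e, hz'⟩ := pair_mem_hat.1 hz
    obtain rfl := col_injective (h.ord_of_mem hy') (h.ord_of_mem hz') (h.le_of_mem hy')
      (h.le_of_mem hz') e
    exact h.functional v y z hy' hz'
  domain x := by
    simp only [pair_mem_hat]
    constructor
    · rintro ⟨-, hx⟩
      obtain ⟨y, hy, hay, rfl⟩ := mem_col.1 hx
      obtain ⟨w, hw⟩ := (h.domain y).1 ⟨hay, hy⟩
      exact ⟨w, y, rfl, hw⟩
    · rintro ⟨w, y, rfl, hw⟩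
      obtain ⟨hay, hy⟩ := (h.domain y).2 ⟨w, hw⟩
      exact ⟨zero_le (isOrd_col (h.right.of_mem hy)), col_mem_col hy hay⟩
  value x y hy := by
    obtain ⟨w, rfl, hy'⟩ := pair_mem_hat.1 hy
    exact h.value w y hy'

theorem restr (h : System f a c) {b : V} (hb : b ∊ c) (hab : Le a b) : System (restr f b) b c where
  not_atom := not_atom_mkSet _
  left := h.right.of_mem hb
  right := h.right
  lt := hb
  exists_pair p hp := h.exists_pair p (mem_restr.1 hp).1
  functional x y z hy hz :=
    h.functional x y z (pair_mem_restr.1 hy).1 (pair_mem_restr.1 hz).1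
  domain x := by
    simp only [pair_mem_restr]
    constructor
    · rintro ⟨hbx, hxc⟩
      have hax : Le a x := by
        rcases hbx with rfl | hbx
        exacts [hab, .inr (hab.trans_mem (h.right.of_mem hxc) hbx)]
      obtain ⟨y, hy⟩ := (h.domain x).1 ⟨hax, hxc⟩
      exact ⟨y, hy, hbx⟩
    · rintro ⟨y, hy, hbx⟩
      exact ⟨hbx, ((h.domain x).2 ⟨y, hy⟩).2⟩
  value x y hy := h.value x y (pair_mem_restr.1 hy).1

/-- The axiom on the members of a skand describes the tail only as a system included in `f` with the
same right end; functionality of `f` leaves no choice. -/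
theorem eq_of_subset {g b : V} (h : System f a c) (hg : System g b c)
    (hsub : ∀ p, p ∊ g → p ∊ f) : g = ClassTheory.restr f b := by
  refine ext_pair hg.not_atom (not_atom_mkSet _) hg.exists_pair
    (fun p hp => h.exists_pair p (mem_restr.1 hp).1) fun x y => ?_
  rw [pair_mem_restr]
  refine ⟨fun hy => ⟨hsub _ hy, hg.le_of_mem hy⟩, fun ⟨hy, hbx⟩ => ?_⟩
  obtain ⟨z, hz⟩ := (hg.domain x).1 ⟨hbx, ((h.domain x).2 ⟨y, hy⟩).2⟩
  rwa [h.functional x y z hy (hsub _ hz)]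

/-- The segment is the domain of `f` and is not empty, so both ends can be read off from it. -/
theorem endpoints_unique {a' c' : V} (h : System f a c) (h' : System f a' c') :
    a = a' ∧ c = c' := by
  have key : ∀ x, (Le a x ∧ x ∊ c) ↔ (Le a' x ∧ x ∊ c') := fun x => by
    rw [h.domain, h'.domain]
  have ea : a = a' := by
    have h₁ := ((key a).1 ⟨.inl rfl, h.lt⟩).1
    have h₂ := ((key a').2 ⟨.inl rfl, h'.lt⟩).1
    rcases h₁ with h₁ | h₁
    · exact h₁
    · exact (not_mem_of_le h₂ h₁).elim
  subst ea
  refine ⟨rfl, ?_⟩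
  rcases h.right.trichotomy h'.right with hc | hc | hc
  · exact (not_mem_self c ((key c).2 ⟨.inr h.lt, hc⟩).2).elim
  · exact hc
  · exact (not_mem_self c' ((key c').1 ⟨.inr h'.lt, hc⟩).2).elim

theorem hat_zero (h : System f (mkSet ∅) c) : ClassTheory.hat (mkSet ∅) f = f := by
  refine ext_pair (not_atom_mkSet _) h.not_atom (fun _ => exists_pair_of_mem_hat) h.exists_pair
    fun x y => ?_
  rw [pair_mem_hat]
  constructor
  · rintro ⟨x, rfl, hy⟩
    rwa [col_zero (h.ord_of_mem hy)]
  · intro hy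
    exact ⟨x, (col_zero (h.ord_of_mem hy)).symm, hy⟩

theorem tame (h : System f a c) : Tame f := by
  refine (tame_iff_of_not_atom h.not_atom).2 fun p hp => ?_
  obtain ⟨x, y, rfl⟩ := h.exists_pair p hp
  exact tame_pair.2 ⟨(h.ord_of_mem hp).tame, (h.value x y hp).2⟩

end System

/-- The system that arises from `F`, whose segment begins with `0`, by dropping the first
component -/
noncomputable def shift (F : V) : V :=
  hat (osucc (mkSet ∅)) (restr F (osucc (mkSet ∅)))

instance : DefFun V (shift : V → V) := by
  unfold shift
  infer_instance

instance {α : Type} [Coded V α] (f : α → V) [DefFun V f] : DefFun V (fun a => shift (f a)) :=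
  DefFun.comp (g := shift) inferInstance

/-- The normal form of the tail depends only on the normal form of the system; this justifies
`shift` as the tail operation on codes. -/
theorem System.shift_hat {f a c : V} (h : System f a c) :
    shift (ClassTheory.hat a f) = ClassTheory.hat (osucc a) (ClassTheory.restr f (osucc a)) := by
  refine ext_pair (not_atom_mkSet _) (not_atom_mkSet _) (fun _ => exists_pair_of_mem_hat)
    (fun _ => exists_pair_of_mem_hat) fun x y => ?_
  rw [shift, pair_mem_hat, pair_mem_hat]
  simp only [pair_mem_restr, pair_mem_hat]
  have key : ∀ {x}, IsOrd x → Le a x → (Le (osucc (mkSet ∅)) (col a x) ↔ Le (osucc a) x) := by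
    intro x hx hax
    rw [osucc_le_iff isOrd_zero (isOrd_col hx), osucc_le_iff h.left hx, ← col_self (a := a),
      col_mem_col_iff h.left hx (.inl rfl) hax]
  constructor
  · rintro ⟨_, rfl, ⟨x, rfl, hx⟩, h1⟩
    have hxo := h.ord_of_mem hx
    exact ⟨x, col_one_col h.left hxo, hx, (key hxo (h.le_of_mem hx)).1 h1⟩
  · rintro ⟨x, rfl, hx, h1⟩
    have hxo := h.ord_of_mem hx
    exact ⟨col a x, (col_one_col h.left hxo).symm, ⟨x, rfl, hx⟩, (key hxo (h.le_of_mem hx)).2 h1⟩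

/-- `F` is a system of components of length at least `ω` whose segment begins with `0`. -/
def Norm (F : V) : Prop :=
  ∃ l, System F (mkSet ∅) l ∧ Long (mkSet ∅) l

instance : Def V (Norm : V → Prop) := by
  unfold Norm
  infer_instance

instance {α : Type} [Coded V α] (f : α → V) [DefFun V f] : Def V (fun a => Norm (f a)) :=
  Def.comp (P := Norm) inferInstance

theorem System.norm_hat {f a c : V} (h : System f a c) (hl : Long a c) :
    Norm (ClassTheory.hat a f) :=
  ⟨_, h.hat, hl.col⟩

theorem Norm.shift {F : V} (h : Norm F) : Norm (shift F) := by
  obtain ⟨l, h, hl⟩ := h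
  obtain ⟨hl', h1⟩ := hl.osucc isOrd_zero h.right
  exact (h.restr h1 (zero_le isOrd_zero.osucc)).norm_hat hl'

theorem Norm.value {F x y : V} (h : Norm F) (hx : pair x y ∊ F) : ¬ Atom y ∧ Tame y := by
  obtain ⟨l, h, -⟩ := h
  exact h.value x y hx

theorem Norm.ap_zero_mem {F : V} (h : Norm F) : pair (mkSet ∅) (ap F (mkSet ∅)) ∊ F := by
  obtain ⟨l, h, -⟩ := h
  exact h.ap_mem (.inl rfl) h.lt

theorem Norm.ap_zero {F : V} (h : Norm F) : ¬ Atom (ap F (mkSet ∅)) ∧ Tame (ap F (mkSet ∅)) :=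
  h.value h.ap_zero_mem

/-- A component with index at least 1 is found in the tail at the collapsed index, and the collapse
is injective. -/
theorem Norm.eq_of_shift_eq {F G : V} (hF : Norm F) (hG : Norm G)
    (h₀ : ap F (mkSet ∅) = ap G (mkSet ∅)) (h : ClassTheory.shift F = ClassTheory.shift G) :
    F = G := by
  have key : ∀ {F G : V}, Norm F → Norm G → ap F (mkSet ∅) = ap G (mkSet ∅) →
      ClassTheory.shift F = ClassTheory.shift G → ∀ x y, pair x y ∊ F → pair x y ∊ G := by
    intro F G hF hG h₀ h x y hx
    have hG₀ := hG.ap_zero_mem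
    obtain ⟨l, hF, -⟩ := hF
    obtain ⟨m, hG, -⟩ := hG
    have hxo := hF.ord_of_mem hx
    rcases zero_le hxo with rfl | hx0
    · rwa [← hF.ap_eq hx, h₀]
    · have hx1 := (osucc_le_iff isOrd_zero hxo).2 hx0
      have : pair (col (osucc (mkSet ∅)) x) y ∊ ClassTheory.shift F :=
        pair_mem_hat.2 ⟨x, rfl, pair_mem_restr.2 ⟨hx, hx1⟩⟩
      rw [h] at this
      obtain ⟨x', e, hx'⟩ := pair_mem_hat.1 this
      obtain ⟨hx', hx1'⟩ := pair_mem_restr.1 hx'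
      rwa [col_injective hxo (hG.ord_of_mem hx') hx1 hx1' e]
  have hF' := hF
  have hG' := hG
  obtain ⟨l, hF', -⟩ := hF'
  obtain ⟨m, hG', -⟩ := hG'
  exact ext_pair hF'.not_atom hG'.not_atom hF'.exists_pair hG'.exists_pair fun x y =>
    ⟨key hF hG h₀ h x y, key hG hF h₀.symm h.symm x y⟩

end System

end ClassTheory

namespace ClassTheory

open MemStructure (Atom IsClass)
open Marked (mark atom_mark)

set_option synthInstance.maxHeartbeats 1000000
set_option synthInstance.maxSize 2000
set_option maxHeartbeats 1000000
set_option linter.unusedSectionVars false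

/-! #### The interpretation with long skands -/

section SkandInterp

variable {V : Type} [Universe V] [Founded V] [Marked V]

/-- `x` codes a skand of length at least `ω`. -/
def SkandCode (x : V) : Prop :=
  ∃ F, Norm F ∧ x = pair mark F

instance {α : Type} [Coded V α] (f : α → V) [DefFun V f] : Def V (fun a => SkandCode (f a)) :=
  Def.comp (P := SkandCode) (by unfold SkandCode; infer_instance)

instance : Def V (SkandCode : V → Prop) :=
  inferInstanceAs (Def V fun x : V => SkandCode ((fun y => y) x))

/-- The members of the skand with the code `x` -/
noncomputable def unroll (x : V) : V :=
  mkSet {z | z ∊ ap (second x) (mkSet ∅) ∨ z = pair mark (shift (second x))}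

instance : DefFun V (unroll : V → V) := by
  unfold unroll
  infer_instance

instance {α : Type} [Coded V α] (f : α → V) [DefFun V f] : DefFun V (fun a => unroll (f a)) :=
  DefFun.comp (g := unroll) inferInstance

theorem mem_unroll {F z : V} :
    z ∊ unroll (pair mark F) ↔ z ∊ ap F (mkSet ∅) ∨ z = pair mark (shift F) := by
  rw [unroll, second_pair]
  exact mem_mkSet (small_insert _ _)

theorem Tame.not_skandCode {x : V} (h : Tame x) : ¬ SkandCode x := by
  rintro ⟨F, -, rfl⟩
  exact not_tame_pair_mark F h

/-- Extensionality among long skands. The members of the first component are tame and the code of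
the tail is not, so both can be told apart in the extension; `Norm.eq_of_shift_eq` then recovers the
system. -/
theorem unroll_injective {x y : V} (hx : SkandCode x) (hy : SkandCode y)
    (h : unroll x = unroll y) : x = y := by
  obtain ⟨F, hF, rfl⟩ := hx
  obtain ⟨G, hG, rfl⟩ := hy
  have key : ∀ z, z ∊ ap F (mkSet ∅) ∨ z = pair mark (shift F) ↔
      z ∊ ap G (mkSet ∅) ∨ z = pair mark (shift G) := fun z => by
    rw [← mem_unroll, h, mem_unroll]
  have hs : shift F = shift G := by
    rcases (key (pair mark (shift F))).1 (.inr rfl) with h' | h'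
    · exact (not_tame_pair_mark _ (hG.ap_zero.2.of_mem h')).elim
    · exact (pair_injective h').2
  have h₀ : ap F (mkSet ∅) = ap G (mkSet ∅) := by
    refine ext hF.ap_zero.1 hG.ap_zero.1 fun z => ⟨fun hz => ?_, fun hz => ?_⟩
    · refine ((key z).1 (.inl hz)).resolve_right ?_
      rintro rfl
      exact not_tame_pair_mark _ (hF.ap_zero.2.of_mem hz)
    · refine ((key z).2 (.inl hz)).resolve_right ?_
      rintro rfl
      exact not_tame_pair_mark _ (hG.ap_zero.2.of_mem hz)
  rw [hF.eq_of_shift_eq hG h₀ hs]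

/-- A set of codes that contains the members of its members other than codes of skands -/
def SkandClosed (t : V) : Prop :=
  ∀ y, y ∊ t → Tame y ∨ SkandCode y ∨
    (¬ Atom y ∧ (¬ ∃ x, SkandCode x ∧ y = unroll x) ∧ ∀ z, z ∊ y → z ∊ t)

instance {α : Type} [Coded V α] (f : α → V) [DefFun V f] : Def V (fun a => SkandClosed (f a)) :=
  Def.comp (P := SkandClosed) (by unfold SkandClosed; infer_instance)

/-- `x` is a code. -/
def IsCode (x : V) : Prop :=
  ∃ t, SkandClosed t ∧ x ∊ t

instance : Def V (IsCode : V → Prop) := by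
  unfold IsCode
  infer_instance

instance {α : Type} [Coded V α] (f : α → V) [DefFun V f] : Def V (fun a => IsCode (f a)) :=
  Def.comp (P := IsCode) inferInstance

theorem Tame.isCode {x : V} (h : Tame x) : IsCode x :=
  ⟨single x, fun _ hy => .inl (mem_single.1 hy ▸ h), mem_single.2 rfl⟩

theorem SkandCode.isCode {x : V} (h : SkandCode x) : IsCode x :=
  ⟨single x, fun _ hy => .inr (.inl (mem_single.1 hy ▸ h)), mem_single.2 rfl⟩

theorem IsCode.cases {x : V} (h : IsCode x) : Tame x ∨ SkandCode x ∨
    (¬ Atom x ∧ (¬ ∃ y, SkandCode y ∧ x = unroll y) ∧ ∀ z, z ∊ x → IsCode z) := by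
  obtain ⟨t, ht, hx⟩ := h
  refine (ht x hx).imp_right (Or.imp_right fun h => ⟨h.1, h.2.1, fun z hz => ?_⟩)
  exact ⟨t, ht, h.2.2 z hz⟩

/-- A pair with first entry `mark` has `single mark` as a member. Hence no set of codes is by
accident the code of a skand, in which case it would have been given other members. -/
theorem not_isCode_single_mark : ¬ IsCode (single (mark : V)) := by
  intro h
  have h₁ : ¬ IsCode (mark : V) := by
    intro h
    rcases h.cases with h | ⟨F, -, h⟩ | h
    · exact h.1 rfl
    · exact not_atom_pair _ _ (h ▸ atom_mark)
    · exact h.1 atom_mark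
  rcases h.cases with h | ⟨F, -, h⟩ | h
  · exact (h.of_mem (mem_single.2 rfl)).1 rfl
  · have : single mark ∊ single (mark : V) := by
      conv_rhs => rw [h]
      exact mem_pair.2 (.inl rfl)
    rw [mem_single] at this
    exact not_atom_mkSet _ (this ▸ atom_mark)
  · exact h₁ (h.2.2 _ (mem_single.2 rfl))

theorem isCode_of_subset {s : V} (hs : ¬ Atom s) (h : ∀ z, z ∊ s → IsCode z)
    (hu : ¬ ∃ x, SkandCode x ∧ s = unroll x) : IsCode s := by
  have h₁ := small_sep (tc s) fun z => IsCode z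
  have h₂ := small_insert (mkSet {z | z ∊ tc s ∧ IsCode z}) s
  simp only [mem_mkSet h₁, Set.mem_ofPred_eq] at h₂
  refine ⟨mkSet {z | (z ∊ tc s ∧ IsCode z) ∨ z = s}, ?_, (mem_mkSet h₂).2 (.inr rfl)⟩
  intro y hy
  rw [mem_mkSet h₂] at hy
  rcases hy with ⟨hy, hyC⟩ | rfl
  · refine hyC.cases.imp_right (Or.imp_right fun h' => ⟨h'.1, h'.2.1, fun z hz => ?_⟩)
    exact (mem_mkSet h₂).2 (.inl ⟨transitive_tc s y z hy hz, h'.2.2 z hz⟩)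
  · exact .inr (.inr ⟨hs, hu, fun z hz => (mem_mkSet h₂).2 (.inl ⟨mem_tc_of_mem hz, h z hz⟩)⟩)

theorem not_skandCode_of_subset {s : V} (h : ∀ z, z ∊ s → IsCode z) : ¬ SkandCode s := by
  rintro ⟨F, -, rfl⟩
  exact not_isCode_single_mark (h _ (mem_pair.2 (.inl rfl)))

open Classical in
/-- The set of the members of `x` -/
noncomputable def members (x : V) : V :=
  if SkandCode x then unroll x else x

instance {α : Type} [Coded V α] (f : α → V) [DefFun V f] : DefFun V (fun a => members (f a)) :=
  DefFun.comp (g := members) (by unfold members; infer_instance)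

instance : DefFun V (members : V → V) :=
  inferInstanceAs (DefFun V fun x : V => members ((fun y => y) x))

theorem members_of_skandCode {x : V} (h : SkandCode x) : members x = unroll x :=
  if_pos h

theorem members_of_not_skandCode {x : V} (h : ¬ SkandCode x) : members x = x :=
  if_neg h

theorem IsCode.not_atom {x : V} (h : IsCode x) (hA : ¬ (Atom x ∧ x ≠ mark)) : ¬ Atom x := by
  rintro hx
  rcases h.cases with h | ⟨F, -, rfl⟩ | h
  exacts [hA ⟨hx, h.1⟩, not_atom_pair _ _ hx, h.1 hx]

theorem IsCode.of_mem_members {x y : V} (h : IsCode x) (hy : y ∊ members x) : IsCode y := by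
  by_cases hx : SkandCode x
  · rw [members_of_skandCode hx] at hy
    obtain ⟨F, hF, rfl⟩ := hx
    rcases mem_unroll.1 hy with hy | rfl
    exacts [(hF.ap_zero.2.of_mem hy).isCode, SkandCode.isCode ⟨_, hF.shift, rfl⟩]
  · rw [members_of_not_skandCode hx] at hy
    rcases h.cases with h | h | h
    exacts [(h.of_mem hy).isCode, (hx h).elim, h.2.2 y hy]

/-- The extension `unroll y` is reserved for the skand `y`. A tame set lacks the code of the tail,
and the remaining sets are excluded in the definition of codes. -/
theorem IsCode.not_unroll {x : V} (h : IsCode x) (hx : ¬ SkandCode x) {y : V} (hy : SkandCode y) :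
    x ≠ unroll y := by
  rintro rfl
  rcases h.cases with h | h | h
  · obtain ⟨F, hF, rfl⟩ := hy
    exact not_tame_pair_mark _ (h.of_mem (mem_unroll.2 (.inr rfl)))
  · exact hx h
  · exact h.2.1 ⟨y, hy, rfl⟩

variable (V) in
/-- The interpretation in which the codes of skands are sets that have the members prescribed for
skands -/
noncomputable def skandInterp : Interp V where
  C := IsCode
  A x := Atom x ∧ x ≠ mark
  mem := members
  defC := inferInstance
  defA := inferInstance
  defMem := inferInstance
  not_atom {x} hx hA := by
    by_cases h : SkandCode x
    · rw [members_of_skandCode h]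
      exact not_atom_mkSet _
    · rw [members_of_not_skandCode h]
      exact hx.not_atom hA
  mem_C hx _ hy := hx.of_mem_members hy
  mem_inj {x y} hx hA hy hB h := by
    by_cases h₁ : SkandCode x <;> by_cases h₂ : SkandCode y
    · rw [members_of_skandCode h₁, members_of_skandCode h₂] at h
      exact unroll_injective h₁ h₂ h
    · rw [members_of_skandCode h₁, members_of_not_skandCode h₂] at h
      exact (hy.not_unroll h₂ h₁ h.symm).elim
    · rw [members_of_not_skandCode h₁, members_of_skandCode h₂] at h
      exact (hx.not_unroll h₁ h₂ h).elim
    · rwa [members_of_not_skandCode h₁, members_of_not_skandCode h₂] at h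
  mem_surj {s} hs h := by
    -- A set of codes that is the extension of a long skand is represented by the code of this
    -- skand, any other by itself.
    by_cases hu : ∃ x, SkandCode x ∧ s = unroll x
    · obtain ⟨x, hx, rfl⟩ := hu
      refine ⟨x, hx.isCode, ?_, members_of_skandCode hx⟩
      rintro ⟨h', -⟩
      obtain ⟨F, -, rfl⟩ := hx
      exact not_atom_pair _ _ h'
    · exact ⟨s, isCode_of_subset hs h hu, fun h' => hs h'.1,
        members_of_not_skandCode (not_skandCode_of_subset h)⟩

end SkandInterp

/-! #### Notions as they are expressed in the language -/

section Notions

variable {V : Type} [MemStructure V]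

/-- A transitive set of sets that is well-ordered by membership -/
def OrdIn (a : V) : Prop :=
  ¬ Atom a ∧ (∀ y, y ∊ a → ¬ Atom y ∧ ∀ z, z ∊ y → z ∊ a) ∧
    ∀ s, ¬ Atom s → (∀ z, z ∊ s → z ∊ a) → (∃ z, z ∊ s) →
      ∃ m, m ∊ s ∧ ∀ y, y ∊ s → ¬ y ∊ m ∧ (y = m ∨ m ∊ y)

/-- Every set to which `x` belongs has a membership-minimal member. -/
def WfIn (x : V) : Prop :=
  ∀ s, ¬ Atom s → x ∊ s → ∃ y, y ∊ s ∧ ∀ z, z ∊ s → ¬ z ∊ y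

/-- `f` is a system of components with the index segment `{x | a ≤ x < c}`. -/
def SystemIn (f a c : V) : Prop :=
  ¬ Atom f ∧ OrdIn a ∧ OrdIn c ∧ a ∊ c ∧ (∀ p, p ∊ f → ∃ x y, p = pair x y) ∧
    (∀ x y z, pair x y ∊ f → pair x z ∊ f → y = z) ∧
    (∀ x, ((x = a ∨ a ∊ x) ∧ x ∊ c) ↔ ∃ y, pair x y ∊ f) ∧
    ∀ x y, pair x y ∊ f → ¬ Atom y ∧ WfIn y

/-- The segment `{x | a ≤ x < c}` has length at least `ω`. -/
def LongIn (a c : V) : Prop :=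
  ∃ l, OrdIn l ∧ a ∊ l ∧ (l = c ∨ l ∊ c) ∧ ∀ x, x ∊ l → ∃ y, y ∊ l ∧ x ∊ y

end Notions

/-! ### Well-foundedness without the axiom of foundation -/

section WfIn

variable {V : Type} [Universe V]

instance : Def V (WfIn : V → Prop) := by
  unfold WfIn
  infer_instance

/-- Well-foundedness of `x` is applied to `s ∪ {x}`, where `x` is not minimal because of `y`. -/
theorem WfIn.of_mem {x y : V} (hx : WfIn x) (hy : y ∊ x) : WfIn y := by
  intro s hs hys
  obtain ⟨w, hw, hmin⟩ := hx (mkSet {z | z ∊ s ∨ z = x}) (not_atom_mkSet _)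
    ((mem_mkSet (small_insert s x)).2 (.inr rfl))
  simp only [mem_mkSet (small_insert s x), Set.mem_ofPred_eq] at hw hmin
  rcases hw with hw | rfl
  · exact ⟨w, hw, fun z hz => hmin z (.inl hz)⟩
  · exact (hmin y (.inl hys) hy).elim

/-- `OrdIn` only speaks of subsets of `a`. For a set `s` containing `a`, a least member of `s ∩ a`
is minimal in `s` by transitivity; if this intersection is empty, `a` is minimal. -/
theorem OrdIn.wfIn {a : V} (ha : OrdIn a) : WfIn a := by
  intro s hs has
  by_cases h : ∃ z, z ∊ s ∧ z ∊ a
  · have hsm := small_sep s fun z => z ∊ a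
    obtain ⟨z, hz⟩ := h
    obtain ⟨m, hm, hmin⟩ := ha.2.2 (mkSet {z | z ∊ s ∧ z ∊ a}) (not_atom_mkSet _)
      (fun z hz => ((mem_mkSet hsm).1 hz).2) ⟨z, (mem_mkSet hsm).2 hz⟩
    simp only [mem_mkSet hsm, Set.mem_ofPred_eq] at hm hmin
    exact ⟨m, hm.1, fun z hz hzm => (hmin z ⟨hz, (ha.2.1 m hm.2).2 z hzm⟩).1 hzm⟩
  · exact ⟨a, has, fun z hz hza => h ⟨z, hz, hza⟩⟩

end WfIn

end ClassTheory

namespace ClassTheory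

open MemStructure (Atom IsClass)
open Marked (mark atom_mark)

set_option synthInstance.maxHeartbeats 1000000
set_option synthInstance.maxSize 2000
set_option maxHeartbeats 1000000
set_option linter.unusedSectionVars false

/-! ### Notions of the universe with skands, computed in the ground universe -/

section SkandUniverse

variable {V : Type} [Universe V] [Founded V] [Marked V]

variable (V) in
/-- The universe with skands -/
abbrev SkandUniverse : Type :=
  (skandInterp V).Carrier

namespace SkandUniverse

theorem mem_iff {x y : SkandUniverse V} : y ∊ x ↔ y.1 ∊ members x.1 := by
  refine Interp.E_iff.trans ⟨fun h => h.2, fun h => ⟨fun hA => ?_, h⟩⟩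
  have hA : Atom x.1 ∧ x.1 ≠ mark := hA
  have : ¬ SkandCode x.1 := by
    rintro ⟨F, -, e⟩
    exact not_atom_pair _ _ (e ▸ hA.1)
  rw [members_of_not_skandCode this] at h
  exact not_atom_of_mem h hA.1

theorem mem_iff_of_not_skandCode {x y : SkandUniverse V} (hx : ¬ SkandCode x.1) :
    y ∊ x ↔ y.1 ∊ x.1 := by
  rw [mem_iff, members_of_not_skandCode hx]

theorem mem_iff_of_tame {x y : SkandUniverse V} (hx : Tame x.1) : y ∊ x ↔ y.1 ∊ x.1 :=
  mem_iff_of_not_skandCode hx.not_skandCode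

theorem mem_iff_of_norm {F : V} {x y : SkandUniverse V} (hF : Norm F) (hx : x.1 = pair mark F) :
    y ∊ x ↔ y.1 ∊ ap F (mkSet ∅) ∨ y.1 = pair mark (shift F) := by
  rw [mem_iff, members_of_skandCode ⟨F, hF, hx⟩, hx, mem_unroll]

theorem atom_iff {x : SkandUniverse V} : Atom x ↔ Atom x.1 := by
  refine ⟨fun h => And.left (h : Atom x.1 ∧ x.1 ≠ mark), fun h => ?_⟩
  by_contra h'
  exact x.2.not_atom h' h

/-- The tame elements as elements of the universe with skands -/
def ofTame (x : V) (hx : Tame x) : SkandUniverse V :=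
  ⟨x, Tame.isCode hx⟩

/-- A long skand has a member that is not tame, namely its tail. All other codes have their ground
members. -/
theorem tame_of_forall_mem {x : SkandUniverse V} (h : ∀ y, y ∊ x → Tame y.1) :
    Tame x.1 := by
  rcases IsCode.cases x.2 with hx' | ⟨F, hF, e⟩ | hx'
  · exact hx'
  · refine (not_tame_pair_mark (shift F) ?_).elim
    exact h ⟨_, SkandCode.isCode ⟨_, hF.shift, rfl⟩⟩ ((mem_iff_of_norm hF e).2 (.inr rfl))
  · by_cases hs : SkandCode x.1
    · obtain ⟨F, hF, e⟩ := hs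
      refine (not_tame_pair_mark (shift F) ?_).elim
      exact h ⟨_, SkandCode.isCode ⟨_, hF.shift, rfl⟩⟩ ((mem_iff_of_norm hF e).2 (.inr rfl))
    · exact (tame_iff_of_not_atom hx'.1).2 fun y hy =>
        h ⟨y, hx'.2.2 y hy⟩ ((mem_iff_of_not_skandCode hs).2 hy)

theorem tame_of_mem {x y : SkandUniverse V} (hx : Tame x.1) (hy : y ∊ x) : Tame y.1 :=
  hx.of_mem ((mem_iff_of_tame hx).1 hy)

/-- A set containing `x` and closed under forming tails exists by `exists_closed_set`. Its codes of
skands form a set in which each contains its tail, so that none is minimal. -/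
theorem not_wfIn_of_skandCode {x : SkandUniverse V} (hx : SkandCode x.1) : ¬ WfIn x := by
  intro hwf
  obtain ⟨s, hs, hcl⟩ := exists_closed_set x.1 fun p => pair mark (shift (second p))
  have hsm := small_sep s SkandCode
  have hsm' : Small {p : SkandUniverse V | p.1 ∊ s ∧ SkandCode p.1} := by
    rw [Interp.small_iff]
    convert hsm using 1
    ext p
    exact ⟨fun ⟨_, h⟩ => h, fun h => ⟨SkandCode.isCode h.2, h⟩⟩
  obtain ⟨y, hy, hmin⟩ := hwf _ (not_atom_mkSet {p : SkandUniverse V | p.1 ∊ s ∧ SkandCode p.1})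
    ((mem_mkSet hsm').2 ⟨hs, hx⟩)
  simp only [mem_mkSet hsm', Set.mem_ofPred_eq] at hy hmin
  obtain ⟨hys, F, hF, e⟩ := hy
  have hF' : SkandCode (pair mark (shift F)) := ⟨_, hF.shift, rfl⟩
  refine hmin ⟨_, hF'.isCode⟩ ⟨?_, hF'⟩ ((mem_iff_of_norm hF e).2 (.inr rfl))
  have := hcl _ hys
  rwa [e, second_pair] at this

/-- Forwards by ground induction: a well-founded code is no long skand, so it has its ground
members, which are tame by induction. Backwards, a ground-minimal one among the tame members of `s`
is minimal, since members of tame elements are tame. -/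
theorem wfIn_iff {x : SkandUniverse V} : WfIn x ↔ Tame x.1 := by
  constructor
  · have key : ∀ x : V, (∃ h : IsCode x, WfIn (⟨x, h⟩ : SkandUniverse V)) → Tame x := by
      -- Well-foundedness is definable in the interpretation, and classes there are ground classes
      -- of codes; so ground induction applies.
      have hD : Def V (fun x => ∃ h : IsCode x, WfIn (⟨x, h⟩ : SkandUniverse V)) :=
        Interp.def_iff.1 (inferInstance : Def (SkandUniverse V) WfIn)
      intro x
      induction x using mem_induction with
      | hP => infer_instance
      | h x ih =>
        rintro ⟨hx, hwf⟩
        by_cases hs : SkandCode x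
        · exact (not_wfIn_of_skandCode (x := ⟨x, hx⟩) hs hwf).elim
        · refine tame_of_forall_mem (x := ⟨x, hx⟩) fun y hy => ?_
          exact ih y.1 ((mem_iff_of_not_skandCode hs).1 hy) ⟨y.2, hwf.of_mem hy⟩
    exact fun h => key x.1 ⟨x.2, h⟩
  · intro hx s hs hxs
    obtain ⟨y, ⟨hyt, hy⟩, hmin⟩ := exists_minimal (P := fun z => Tame z ∧ z ∊ members s.1)
      ⟨x.1, hx, mem_iff.1 hxs⟩
    refine ⟨ofTame y hyt, mem_iff.2 hy, fun z hz hzy => ?_⟩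
    have hzy' : z.1 ∊ y := (mem_iff_of_tame (x := ofTame y hyt) hyt).1 hzy
    exact hmin z.1 hzy' ⟨hyt.of_mem hzy', mem_iff.1 hz⟩

/-- Ordinals in the sense of the language are well-founded, hence tame, and on tame elements the two
membership relations agree. -/
theorem ordIn_iff {a : SkandUniverse V} : OrdIn a ↔ IsOrd a.1 := by
  constructor
  · intro ha
    have ht := wfIn_iff.1 ha.wfIn
    have hm : ∀ {y : V}, y ∊ a.1 → ∃ h : Tame y, ofTame y h ∊ a := fun {y} hy =>
      ⟨ht.of_mem hy, (mem_iff_of_tame ht).2 hy⟩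
    refine ⟨fun h => ha.1 (atom_iff.2 h), fun y z hy hz => ?_, fun y hy => ?_⟩
    · obtain ⟨hyt, hya⟩ := hm hy
      have hzt := hyt.of_mem hz
      exact (mem_iff_of_tame ht).1 ((ha.2.1 _ hya).2 (ofTame z hzt)
        ((mem_iff_of_tame (x := ofTame y hyt) hyt).2 hz))
    · obtain ⟨hyt, hya⟩ := hm hy
      refine ⟨fun h => (ha.2.1 _ hya).1 (atom_iff.2 h), fun x w hx hw => ?_⟩
      have hxt := hyt.of_mem hx
      have hwt := hxt.of_mem hw
      have hxy : ofTame x hxt ∊ ofTame y hyt := (mem_iff_of_tame (x := ofTame y hyt) hyt).2 hx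
      have hwx : ofTame w hwt ∊ ofTame x hxt := (mem_iff_of_tame (x := ofTame x hxt) hxt).2 hw
      have hxa := (ha.2.1 _ hya).2 _ hxy
      have hwa := (ha.2.1 _ hxa).2 _ hwx
      -- Given `w ∈ x ∈ y`, the well-ordering is applied to the set `{w, y}`. Ground foundation
      -- excludes `y = w` and `y ∈ w`, which leaves `w ∈ y`.
      have hsm := Universe.pairing (ofTame w hwt) (ofTame y hyt)
      obtain ⟨m, hm, hmin⟩ := ha.2.2 (mkSet {z | z = ofTame w hwt ∨ z = ofTame y hyt})
        (not_atom_mkSet _) (fun z hz => by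
          rcases (mem_mkSet hsm).1 hz with rfl | rfl
          exacts [hwa, hya]) ⟨_, (mem_mkSet hsm).2 (.inl rfl)⟩
      simp only [mem_mkSet hsm, Set.mem_ofPred_eq] at hm hmin
      rcases hm with rfl | rfl
      · rcases (hmin _ (.inr rfl)).2 with e | h
        · have e : y = w := congrArg Interp.Carrier.val e
          subst e
          exact (mem_asymm hx hw).elim
        · exact (mem_iff_of_tame (x := ofTame y hyt) hyt).1 h
      · rcases (hmin _ (.inl rfl)).2 with e | h
        · have e : w = y := congrArg Interp.Carrier.val e
          subst e
          exact (mem_asymm hx hw).elim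
        · exact (not_mem_cycle ((mem_iff_of_tame (x := ofTame w hwt) hwt).1 h) hw hx).elim
  · intro ha
    have ht := ha.tame
    have hm : ∀ {y : SkandUniverse V}, y ∊ a ↔ y.1 ∊ a.1 := mem_iff_of_tame ht
    refine ⟨fun h => ha.1 (atom_iff.1 h), fun y hy => ?_, fun s hs hsa hne => ?_⟩
    · rw [hm] at hy
      refine ⟨fun h => (ha.of_mem hy).1 (atom_iff.1 h), fun z hz => ?_⟩
      rw [mem_iff_of_tame (ha.of_mem hy).tame] at hz
      exact hm.2 (ha.2.1 _ _ hy hz)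
    · obtain ⟨z, hz⟩ := hne
      have hord : ∀ {z : SkandUniverse V}, z ∊ s → IsOrd z.1 := fun hz =>
        ha.of_mem (hm.1 (hsa _ hz))
      obtain ⟨m, hmo, hms, hleast⟩ := exists_least (P := fun z => z ∊ members s.1)
        ⟨z.1, hord hz, mem_iff.1 hz⟩
      refine ⟨ofTame m hmo.tame, mem_iff.2 hms, fun y hy => ?_⟩
      have hle := hleast y.1 (hord hy) (mem_iff.1 hy)
      rw [mem_iff_of_tame (x := ofTame m hmo.tame) hmo.tame, mem_iff_of_tame (hord hy).tame]
      refine ⟨not_mem_of_le hle, ?_⟩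
      rcases hle with e | h
      exacts [.inl (Interp.Carrier.ext e), .inr h]

theorem val_mkSet {S : Set (SkandUniverse V)} {x : V} (hx : ¬ Atom x) (ht : Tame x)
    (h : ∀ z : SkandUniverse V, z ∈ S ↔ z.1 ∊ x) : (mkSet S).1 = x := by
  have key : ∀ z : SkandUniverse V, z ∊ ofTame x ht ↔ z ∈ S := fun z =>
    (mem_iff_of_tame (x := ofTame x ht) ht).trans (h z).symm
  have hs : Small S := ⟨ofTame x ht, fun h' => hx (atom_iff.1 h'), key⟩
  exact congrArg Interp.Carrier.val
    ((eq_mkSet_iff hs).2 ⟨fun h' => hx (atom_iff.1 h'), key⟩ : ofTame x ht = mkSet S).symm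

/-- Tameness matters here: the singleton of a long skand can be a long skand whose first component
is empty, and then its code is not the ground singleton. -/
theorem val_pair {x y : SkandUniverse V} (hx : Tame x.1) (hy : Tame y.1) :
    (pair x y).1 = pair x.1 y.1 := by
  refine val_mkSet (not_atom_pair _ _) (tame_pair.2 ⟨hx, hy⟩) fun z => ?_
  rw [mem_pair, Set.mem_ofPred_eq, Interp.Carrier.ext_iff, Interp.Carrier.ext_iff]
  have h₁ : (mkSet {w | w = x} : SkandUniverse V).1 = mkSet {w | w = x.1} := by
    refine val_mkSet (not_atom_mkSet _) ((tame_mkSet (small_singleton _)).2 ?_) fun w => ?_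
    · rintro _ rfl
      exact hx
    · rw [mem_mkSet (small_singleton _)]
      exact Interp.Carrier.ext_iff
  have h₂ : (mkSet {w | w = x ∨ w = y} : SkandUniverse V).1 = mkSet {w | w = x.1 ∨ w = y.1} := by
    refine val_mkSet (not_atom_mkSet _) ((tame_mkSet (Universe.pairing _ _)).2 ?_) fun w => ?_
    · rintro _ (rfl | rfl)
      exacts [hx, hy]
    · rw [mem_mkSet (Universe.pairing _ _)]
      exact or_congr Interp.Carrier.ext_iff Interp.Carrier.ext_iff
  rw [h₁, h₂]

theorem tame_of_tame_pair {x y : SkandUniverse V} (h : Tame (pair x y).1) :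
    Tame x.1 ∧ Tame y.1 := by
  have h₁ := tame_of_mem h (mem_pair.2 (.inr rfl))
  exact ⟨tame_of_mem h₁ ((mem_mkSet (Universe.pairing x y)).2 (.inl rfl)),
    tame_of_mem h₁ ((mem_mkSet (Universe.pairing x y)).2 (.inr rfl))⟩

theorem pair_mem_iff {x y h : SkandUniverse V} (hx : Tame x.1) (hy : Tame y.1) :
    pair x y ∊ h ↔ pair x.1 y.1 ∊ members h.1 := by
  rw [mem_iff, val_pair hx hy]

/-- Indices are ordinals and components are well-founded, so a system is tame as a whole. Every
clause then has the same meaning in both universes. -/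
theorem systemIn_iff {f a c : SkandUniverse V} : SystemIn f a c ↔ System f.1 a.1 c.1 := by
  constructor
  · rintro ⟨hf, ha, hc, hac, hp, hu, hd, hv⟩
    rw [ordIn_iff] at ha hc
    have htame : ∀ {x y}, pair x y ∊ f → Tame x.1 ∧ Tame y.1 := by
      intro x y h
      have hx := ((hd x).2 ⟨y, h⟩).2
      exact ⟨tame_of_mem hc.tame hx, wfIn_iff.1 (hv x y h).2⟩
    have ht : Tame f.1 := by
      refine tame_of_forall_mem fun p hpf => ?_
      obtain ⟨x, y, rfl⟩ := hp p hpf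
      obtain ⟨hx, hy⟩ := htame hpf
      rw [val_pair hx hy]
      exact tame_pair.2 ⟨hx, hy⟩
    have key : ∀ {x y : V} (h : pair x y ∊ f.1), ∃ (hx : Tame x) (hy : Tame y),
        pair (ofTame x hx) (ofTame y hy) ∊ f := by
      intro x y h
      obtain ⟨hx, hy⟩ := tame_pair.1 (ht.of_mem h)
      refine ⟨hx, hy, ?_⟩
      rw [mem_iff_of_tame ht, val_pair hx hy]
      exact h
    refine ⟨fun h => hf (atom_iff.2 h), ha, hc, (mem_iff_of_tame hc.tame).1 hac, ?_, ?_, ?_, ?_⟩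
    · intro p hpf
      obtain ⟨x, y, e⟩ := hp (ofTame p (ht.of_mem hpf)) ((mem_iff_of_tame ht).2 hpf)
      obtain ⟨hx, hy⟩ := tame_of_tame_pair (e ▸ (ht.of_mem hpf : Tame (ofTame p _).1))
      exact ⟨x.1, y.1, (congrArg Interp.Carrier.val e).trans (val_pair hx hy)⟩
    · intro x y z h h'
      obtain ⟨hx, hy, h⟩ := key h
      obtain ⟨_, hz, h'⟩ := key h'
      exact congrArg Interp.Carrier.val (hu _ _ _ h h')
    · intro x
      constructor
      · rintro ⟨hx, hxc⟩
        have hxt := hc.tame.of_mem hxc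
        have hax : ofTame x hxt = a ∨ a ∊ ofTame x hxt :=
          hx.imp Interp.Carrier.ext (mem_iff_of_tame (x := ofTame x hxt) hxt).2
        obtain ⟨y, hy⟩ := (hd (ofTame x hxt)).1 ⟨hax, (mem_iff_of_tame hc.tame).2 hxc⟩
        refine ⟨y.1, ?_⟩
        have := htame hy
        rwa [mem_iff_of_tame ht, val_pair this.1 this.2] at hy
      · rintro ⟨y, hy⟩
        obtain ⟨hx, hy, h⟩ := key hy
        obtain ⟨h₁, h₂⟩ := (hd _).2 ⟨_, h⟩
        rw [mem_iff_of_tame (x := ofTame x hx) hx] at h₁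
        rw [mem_iff_of_tame hc.tame] at h₂
        exact ⟨h₁.imp_left (congrArg Interp.Carrier.val), h₂⟩
    · intro x y h
      obtain ⟨hx, hy, h⟩ := key h
      exact ⟨fun h' => (hv _ _ h).1 (atom_iff.2 h'), hy⟩
  · intro h
    have ht := h.tame
    have htc := h.right.tame
    have htame : ∀ {x y}, pair x y ∊ f → Tame x.1 ∧ Tame y.1 := fun h =>
      tame_of_tame_pair (tame_of_mem ht h)
    have key : ∀ {x y}, pair x y ∊ f → pair x.1 y.1 ∊ f.1 := by
      intro x y h
      have := htame h
      rwa [mem_iff_of_tame ht, val_pair this.1 this.2] at h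
    have key' : ∀ {x y : V} (h : pair x y ∊ f.1), ∃ (hx : Tame x) (hy : Tame y),
        pair (ofTame x hx) (ofTame y hy) ∊ f := by
      intro x y h
      obtain ⟨hx, hy⟩ := tame_pair.1 (ht.of_mem h)
      refine ⟨hx, hy, ?_⟩
      rw [mem_iff_of_tame ht, val_pair hx hy]
      exact h
    refine ⟨fun h' => h.not_atom (atom_iff.1 h'), ordIn_iff.2 h.left, ordIn_iff.2 h.right,
      (mem_iff_of_tame htc).2 h.lt, ?_, ?_, ?_, ?_⟩
    · intro p hp
      rw [mem_iff_of_tame ht] at hp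
      obtain ⟨x, y, e⟩ := h.exists_pair _ hp
      obtain ⟨hx, hy⟩ := tame_pair.1 (ht.of_mem (e ▸ hp))
      exact ⟨ofTame x hx, ofTame y hy, Interp.Carrier.ext (e.trans
        (val_pair (x := ofTame x hx) (y := ofTame y hy) hx hy).symm)⟩
    · exact fun x y z hy hz => Interp.Carrier.ext (h.functional _ _ _ (key hy) (key hz))
    · intro x
      constructor
      · rintro ⟨hx, hxc⟩
        rw [mem_iff_of_tame htc] at hxc
        have hxt := htc.of_mem hxc
        rw [mem_iff_of_tame hxt] at hx
        obtain ⟨y, hy⟩ := (h.domain x.1).1 ⟨hx.imp_left (congrArg Interp.Carrier.val), hxc⟩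
        obtain ⟨_, hyt, hy⟩ := key' hy
        exact ⟨_, hy⟩
      · rintro ⟨y, hy⟩
        have hxt := (htame hy).1
        obtain ⟨h₁, h₂⟩ := (h.domain x.1).2 ⟨y.1, key hy⟩
        rw [mem_iff_of_tame htc, mem_iff_of_tame hxt]
        exact ⟨h₁.imp_left Interp.Carrier.ext, h₂⟩
    · intro x y hy
      obtain ⟨h₁, h₂⟩ := h.value _ _ (key hy)
      exact ⟨fun h' => h₁ (atom_iff.1 h'), wfIn_iff.2 h₂⟩

theorem longIn_iff {a c : SkandUniverse V} (hc : IsOrd c.1) : LongIn a c ↔ Long a.1 c.1 := by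
  constructor
  · rintro ⟨l, hl, hal, hlc, hlim⟩
    rw [ordIn_iff] at hl
    have hm : ∀ {y : SkandUniverse V}, y ∊ l ↔ y.1 ∊ l.1 := mem_iff_of_tame hl.tame
    rw [mem_iff_of_tame hc.tame] at hlc
    refine ⟨l.1, hl, hm.1 hal, hlc.imp_left (congrArg Interp.Carrier.val), fun x hx => ?_⟩
    obtain ⟨y, hy, hxy⟩ := hlim (ofTame x (hl.of_mem hx).tame) (hm.2 hx)
    rw [mem_iff_of_tame (hl.of_mem (hm.1 hy)).tame] at hxy
    exact ⟨y.1, hm.1 hy, hxy⟩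
  · rintro ⟨l, hl, hal, hlc, hlim⟩
    have hm : ∀ {y : SkandUniverse V}, y ∊ ofTame l hl.tame ↔ y.1 ∊ l :=
      mem_iff_of_tame (x := ofTame l hl.tame) hl.tame
    refine ⟨ofTame l hl.tame, ordIn_iff.2 hl, hm.2 hal, ?_, fun x hx => ?_⟩
    · rw [mem_iff_of_tame hc.tame]
      exact hlc.imp_left Interp.Carrier.ext
    · obtain ⟨y, hy, hxy⟩ := hlim x.1 (hm.1 hx)
      exact ⟨ofTame y (hl.of_mem hy).tame, hm.2 hy,
        (mem_iff_of_tame (x := ofTame y _) (hl.of_mem hy).tame).2 hxy⟩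

end SkandUniverse

end SkandUniverse

end ClassTheory

namespace ClassTheory

open MemStructure (Atom IsClass)
open Marked (mark atom_mark)

set_option synthInstance.maxHeartbeats 1000000
set_option synthInstance.maxSize 2000
set_option maxHeartbeats 1000000
set_option linter.unusedSectionVars false

/-! #### Skands -/

section Skand

variable {V : Type} [Universe V] [Founded V]

/-- In a segment of finite length every nonempty class of ordinals has a greatest element. -/
theorem exists_max {a c : V} (hc : IsOrd c) (hl : ¬ Long a c) {P : V → Prop} [hP : Def V P]
    (h : ∃ y, Le a y ∧ y ∊ c ∧ P y) :
    ∃ y, Le a y ∧ y ∊ c ∧ P y ∧ ∀ z, y ∊ z → z ∊ c → ¬ P z := by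
  by_contra hmax
  push Not at hmax
  have hP' {β : Type} [Coded V β] (f : β → V) [DefFun V f] : Def V (fun b => P (f b)) := hP.comp
  -- If the elements of the segment in `P` have no greatest one, their least strict upper bound is a
  -- limit ordinal, and the segment is long.
  obtain ⟨l, hl', hub, hleast⟩ := exists_least
    (P := fun l => ∀ y, Le a y → y ∊ c → P y → y ∊ l) ⟨c, hc, fun _ _ h _ => h⟩
  obtain ⟨y, hay, hyc, hy⟩ := h
  refine hl ⟨l, hl', hay.trans_mem hl' (hub y hay hyc hy), ?_, fun x hx => ?_⟩
  · exact (hleast c hc fun _ _ h _ => h).imp_left Eq.symm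
  · have hxo := hl'.of_mem hx
    have : ¬ ∀ y, Le a y → y ∊ c → P y → y ∊ x := fun h => not_mem_of_le (hleast x hxo h) hx
    push Not at this
    obtain ⟨w, haw, hwc, hw, hwx⟩ := this
    obtain ⟨z, hwz, hzc, hz⟩ := hmax w haw hwc hw
    have hzo := hc.of_mem hzc
    refine ⟨z, hub z (.inr (haw.trans_mem hzo hwz)) hzc hz, ?_⟩
    exact ((le_or_mem hxo (hc.of_mem hwc)).resolve_right hwx).trans_mem hzo hwz

/-- The skand that starts with the index `y`, if `g` gives the skands with greater indices -/
noncomputable def step (f c g y : V) : V :=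
  mkSet {z | z ∊ ap f y ∨ (osucc y ∊ c ∧ z = ap g (osucc y))}

theorem mem_step {f c g y z : V} :
    z ∊ step f c g y ↔ z ∊ ap f y ∨ (osucc y ∊ c ∧ z = ap g (osucc y)) := by
  refine mem_mkSet (small_of_subset
    (P := fun z => z ∊ ap f y ∨ (osucc y ∊ c ∧ z = ap g (osucc y))) inferInstance
    (a := mkSet {z | z ∊ ap f y ∨ z = ap g (osucc y)}) fun z hz => ?_)
  exact (mem_mkSet (small_insert _ _)).2 (hz.imp_right And.right)

/-- The function `g` gives the skands for the final segments of the system `f`. -/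
def Unfolds (f a c g : V) : Prop :=
  ∀ y, Le a y → y ∊ c → ap g y = step f c g y

instance {α : Type} [Coded V α] (f c g y : α → V) [DefFun V f] [DefFun V c] [DefFun V g]
    [DefFun V y] : DefFun V (fun x => step (f x) (c x) (g x) (y x)) := by
  have : DefFun V (fun p : (V × V) × V × V => step p.1.1 p.1.2 p.2.1 p.2.2) := by
    unfold step
    infer_instance
  exact this.comp (f := fun x => ((f x, c x), (g x, y x)))

instance {α : Type} [Coded V α] (f c g y : α → V) [DefFun V f] [DefFun V c] [DefFun V g]
    [DefFun V y] : Def V (fun x => Unfolds (f x) (c x) (g x) (y x)) := by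
  have : Def V (fun p : (V × V) × V × V => Unfolds p.1.1 p.1.2 p.2.1 p.2.2) := by
    unfold Unfolds
    infer_instance
  exact this.comp (f := fun x => ((f x, c x), (g x, y x)))

/-- This recursion runs downwards from the end of the segment, so it is not a recursion along
membership. Instead, let `b` be the greatest index from which on there is no solution: a solution
from the successor of `b` on, extended by one value at `b`, refutes this. -/
theorem exists_unfolds {f a c : V} (hc : IsOrd c) (hl : ¬ Long a c) (hac : a ∊ c) :
    ∃ g, Unfolds f a c g := by
  classical
  by_contra hcon
  obtain ⟨b, hab, hbc, hb, hmax⟩ := exists_max hc hl (P := fun b => ¬ ∃ g, Unfolds f b c g)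
    ⟨a, .inl rfl, hac, hcon⟩
  have hbo := hc.of_mem hbc
  obtain ⟨g, hg⟩ : ∃ g, osucc b ∊ c → Unfolds f (osucc b) c g := by
    by_cases h : osucc b ∊ c
    · obtain ⟨g, hg⟩ := not_not.1 (hmax (osucc b) (mem_osucc.2 (.inr rfl)) h)
      exact ⟨g, fun _ => hg⟩
    · exact ⟨f, fun h' => (h h').elim⟩
  have hD : DefFun V (fun y => if y = b then step f c g b else ap g y) := inferInstance
  have key : ∀ y, y ∊ c → ap (graphOn (fun y => if y = b then step f c g b else ap g y) c) y =
      if y = b then step f c g b else ap g y := fun y hy => ap_graphOn hy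
  have hstep : ∀ y, Le b y → y ∊ c →
      step f c (graphOn (fun y => if y = b then step f c g b else ap g y) c) y = step f c g y := by
    intro y hby hyc
    refine ext (not_atom_mkSet _) (not_atom_mkSet _) fun z => ?_
    rw [mem_step, mem_step]
    refine or_congr_right (and_congr_right fun h => ?_)
    have : osucc y ≠ b := by
      rintro rfl
      exact not_mem_of_le hby (mem_osucc.2 (.inr rfl))
    rw [key _ h, if_neg this]
  refine hb ⟨graphOn (fun y => if y = b then step f c g b else ap g y) c, fun y hby hyc => ?_⟩
  rw [key y hyc, hstep y hby hyc]
  by_cases h : y = b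
  · rw [if_pos h, h]
  · rw [if_neg h]
    have hby' : b ∊ y := hby.resolve_left h
    have hle := (osucc_le_iff hbo (hc.of_mem hyc)).2 hby'
    exact hg (hle.elim (fun e => e ▸ hyc) fun h' => hc.2.1 y _ hyc h') y hle hyc

theorem Unfolds.unique {f a c g g' : V} (hc : IsOrd c) (hl : ¬ Long a c) (hg : Unfolds f a c g)
    (hg' : Unfolds f a c g') {y : V} (hay : Le a y) (hyc : y ∊ c) : ap g y = ap g' y := by
  by_contra hcon
  obtain ⟨b, hab, hbc, hb, hmax⟩ := exists_max hc hl (P := fun y => ¬ ap g y = ap g' y)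
    ⟨y, hay, hyc, hcon⟩
  refine hb ?_
  rw [hg b hab hbc, hg' b hab hbc]
  refine ext (not_atom_mkSet _) (not_atom_mkSet _) fun z => ?_
  rw [mem_step, mem_step]
  refine or_congr_right (and_congr_right fun h => ?_)
  rw [not_not.1 (hmax (osucc b) (mem_osucc.2 (.inr rfl)) h)]

variable [Marked V]

/-- Skands of finite length are built from tame components in finitely many steps and need no new
codes. -/
theorem Unfolds.tame {f a c g : V} (hf : System f a c) (hl : ¬ Long a c) (hg : Unfolds f a c g)
    {y : V} (hay : Le a y) (hyc : y ∊ c) : ¬ Atom (ap g y) ∧ Tame (ap g y) := by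
  by_contra hcon
  obtain ⟨b, hab, hbc, hb, hmax⟩ := exists_max hf.right hl
    (P := fun y => ¬ (¬ Atom (ap g y) ∧ Tame (ap g y))) ⟨y, hay, hyc, hcon⟩
  refine hb ?_
  rw [hg b hab hbc]
  refine ⟨not_atom_mkSet _, (tame_iff_of_not_atom (not_atom_mkSet _)).2 fun z hz => ?_⟩
  rcases mem_step.1 hz with hz | ⟨hs, rfl⟩
  · exact (hf.value _ _ (hf.ap_mem hab hbc)).2.of_mem hz
  · exact (not_not.1 (hmax (osucc b) (mem_osucc.2 (.inr rfl)) hs)).2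

/-- `x` is the skand with the system of components `f`. -/
def IsSkand (f x : V) : Prop :=
  ∃ a c, System f a c ∧ ((Long a c ∧ x = pair mark (hat a f)) ∨
    (¬ Long a c ∧ ∃ g, Unfolds f a c g ∧ x = ap g a))

instance {α : Type} [Coded V α] (f g : α → V) [DefFun V f] [DefFun V g] :
    Def V (fun a => IsSkand (f a) (g a)) :=
  Def.comp₂ (P := IsSkand) (by unfold IsSkand; infer_instance) f g

theorem isSkand_iff_of_long {f a c x : V} (hf : System f a c) (hl : Long a c) :
    IsSkand f x ↔ x = pair mark (hat a f) := by
  constructor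
  · rintro ⟨a', c', hf', h⟩
    obtain ⟨rfl, rfl⟩ := hf.endpoints_unique hf'
    rcases h with h | h
    exacts [h.2, (h.1 hl).elim]
  · exact fun h => ⟨a, c, hf, .inl ⟨hl, h⟩⟩

theorem isSkand_iff_of_unfolds {f a c g x : V} (hf : System f a c) (hl : ¬ Long a c)
    (hg : Unfolds f a c g) : IsSkand f x ↔ x = ap g a := by
  constructor
  · rintro ⟨a', c', hf', h⟩
    obtain ⟨rfl, rfl⟩ := hf.endpoints_unique hf'
    rcases h with h | ⟨-, g', hg', rfl⟩
    exacts [(hl h.1).elim, hg'.unique hf.right hl hg (.inl rfl) hf.lt]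
  · exact fun h => ⟨a, c, hf, .inr ⟨hl, g, hg, h⟩⟩

theorem System.existsUnique_isSkand {f a c : V} (hf : System f a c) : ∃! x, IsSkand f x := by
  by_cases hl : Long a c
  · simp only [isSkand_iff_of_long hf hl, existsUnique_eq]
  · obtain ⟨g, hg⟩ := exists_unfolds (f := f) hf.right hl hf.lt
    simp only [isSkand_iff_of_unfolds hf hl hg, existsUnique_eq]

theorem IsSkand.isCode {f x : V} (h : IsSkand f x) : IsCode x ∧ ¬ Atom x := by
  obtain ⟨a, c, hf, ⟨hl, rfl⟩ | ⟨hl, g, hg, rfl⟩⟩ := h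
  · exact ⟨SkandCode.isCode ⟨_, hf.norm_hat hl, rfl⟩, not_atom_pair _ _⟩
  · have := hg.tame hf hl (.inl rfl) hf.lt
    exact ⟨this.2.isCode, this.1⟩

theorem System.ap_restr {f a c b y : V} (hf : System f a c) (hb : b ∊ c) (hab : Le a b)
    (hy : Le b y) (hyc : y ∊ c) : ap (ClassTheory.restr f b) y = ap f y := by
  have h := (hf.restr hb hab).ap_mem hy hyc
  exact (hf.ap_eq (pair_mem_restr.1 h).1).symm

/-- For a long system this is the definition of `unroll`, combined with `System.shift_hat`. For a
short one, the function `g` that unfolds `f` also unfolds its restriction. -/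
theorem IsSkand.mem_members {f a c x z : V} (hf : System f a c) (h : IsSkand f x) :
    z ∊ members x ↔ z ∊ ap f a ∨ (osucc a ∊ c ∧ IsSkand (restr f (osucc a)) z) := by
  have hle : Le a (osucc a) := .inr (mem_osucc.2 (.inr rfl))
  by_cases hl : Long a c
  · rw [isSkand_iff_of_long hf hl] at h
    obtain ⟨hl', hac⟩ := hl.osucc hf.left hf.right
    have hn := hf.norm_hat hl
    rw [isSkand_iff_of_long (hf.restr hac hle) hl', h, members_of_skandCode ⟨_, hn, rfl⟩,
      mem_unroll, hf.shift_hat, and_iff_right hac]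
    have : ap (hat a f) (mkSet ∅) = ap f a := by
      refine hf.hat.ap_eq (pair_mem_hat.2 ⟨a, col_self.symm, hf.ap_mem (.inl rfl) hf.lt⟩)
    rw [this]
  · obtain ⟨g, hg⟩ := exists_unfolds (f := f) hf.right hl hf.lt
    rw [isSkand_iff_of_unfolds hf hl hg] at h
    have ht := (hg.tame hf hl (.inl rfl) hf.lt).2
    rw [h, members_of_not_skandCode ht.not_skandCode, hg a (.inl rfl) hf.lt, mem_step]
    refine or_congr_right (and_congr_right fun hac => ?_)
    have hl' : ¬ Long (osucc a) c := by
      rintro ⟨l, hl₁, hal, h'⟩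
      exact hl ⟨l, hl₁, hl₁.2.1 _ _ hal (mem_osucc.2 (.inr rfl)), h'⟩
    have hf' := hf.restr hac hle
    rw [isSkand_iff_of_unfolds (g := g) hf' hl' ?_]
    intro y hay hyc
    have hay' : Le a y := .inr (mem_of_mem_le (hf.right.of_mem hyc) (mem_osucc.2 (.inr rfl)) hay)
    rw [hg y hay' hyc]
    refine ext (not_atom_mkSet _) (not_atom_mkSet _) fun z => ?_
    rw [mem_step, mem_step, hf.ap_restr hac hle hay hyc]

/-! #### Similarity -/

section Similar

variable {f a c g a' c' : V}

/-- By induction on the index, an isomorphism of segments preserves the order type below an index.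
The hypotheses speak of `h` on the segments only: it will be the set of members of an arbitrary set,
which may also contain elements that are not tame. -/
theorem hat_eq_of_similar (hf : System f a c) (hg : System g a' c') (h : V)
    (h₁ : ∀ x, Le a x → x ∊ c → ∃ y, Le a' y ∧ y ∊ c' ∧ pair x y ∊ h)
    (h₂ : ∀ y, Le a' y → y ∊ c' → ∃ x, Le a x ∧ x ∊ c ∧ pair x y ∊ h)
    (h₃ : ∀ x y x' y', Le a x → x ∊ c → Le a' y → y ∊ c' → Le a x' → x' ∊ c → Le a' y' → y' ∊ c' →
      pair x y ∊ h → pair x' y' ∊ h → (x ∊ x' ↔ y ∊ y'))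
    (h₄ : ∀ x y, Le a x → x ∊ c → Le a' y → y ∊ c' → pair x y ∊ h →
      ∀ w, pair x w ∊ f ↔ pair y w ∊ g) : hat a f = hat a' g := by
  have key : ∀ x, ∀ y, Le a x → x ∊ c → Le a' y → y ∊ c' → pair x y ∊ h → col a x = col a' y := by
    intro x
    induction x using mem_induction with
    | hP => infer_instance
    | h x ih =>
      intro y hax hxc hay hyc hxy
      refine ext (not_atom_col _ _) (not_atom_col _ _) fun z => ?_
      rw [mem_col, mem_col]
      constructor
      · rintro ⟨w, hw, haw, rfl⟩
        have hwc := hf.right.2.1 x w hxc hw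
        obtain ⟨v, hav, hvc, hwv⟩ := h₁ w haw hwc
        exact ⟨v, (h₃ w v x y haw hwc hav hvc hax hxc hay hyc hwv hxy).1 hw, hav,
          ih w hw v haw hwc hav hvc hwv⟩
      · rintro ⟨v, hv, hav, rfl⟩
        have hvc := hg.right.2.1 y v hyc hv
        obtain ⟨w, haw, hwc, hwv⟩ := h₂ v hav hvc
        have hw := (h₃ w v x y haw hwc hav hvc hax hxc hay hyc hwv hxy).2 hv
        exact ⟨w, hw, haw, (ih w hw v haw hwc hav hvc hwv).symm⟩
  refine ext_pair (not_atom_mkSet _) (not_atom_mkSet _) (fun _ => exists_pair_of_mem_hat)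
    (fun _ => exists_pair_of_mem_hat) fun z w => ?_
  rw [pair_mem_hat, pair_mem_hat]
  constructor
  · rintro ⟨x, rfl, hx⟩
    obtain ⟨hax, hxc⟩ := (hf.domain x).2 ⟨w, hx⟩
    obtain ⟨y, hay, hyc, hxy⟩ := h₁ x hax hxc
    exact ⟨y, key x y hax hxc hay hyc hxy, (h₄ x y hax hxc hay hyc hxy w).1 hx⟩
  · rintro ⟨y, rfl, hy⟩
    obtain ⟨hay, hyc⟩ := (hg.domain y).2 ⟨w, hy⟩
    obtain ⟨x, hax, hxc, hxy⟩ := h₂ y hay hyc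
    exact ⟨x, (key x y hax hxc hay hyc hxy).symm, (h₄ x y hax hxc hay hyc hxy w).2 hy⟩

/-- The similarity of systems with the same reindexed system -/
theorem exists_similar (hf : System f a c) (hg : System g a' c') (h : hat a f = hat a' g) :
    ∃ k, ¬ Atom k ∧ Tame k ∧
    (∀ x y, pair x y ∊ k ↔ (Le a x ∧ x ∊ c) ∧ (Le a' y ∧ y ∊ c') ∧ col a x = col a' y) ∧
    (∀ x, Le a x → x ∊ c → ∃ y, pair x y ∊ k) ∧ (∀ y, Le a' y → y ∊ c' → ∃ x, pair x y ∊ k) ∧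
    (∀ x y, pair x y ∊ k → ∀ w, pair x w ∊ f ↔ pair y w ∊ g) := by
  have hs : Small {p | ∃ x, x ∊ c ∧ ∃ y, Le a x ∧ (Le a' y ∧ y ∊ c') ∧ col a x = col a' y ∧
      p = pair x y} := by
    refine Interp.small_of_functional (R := fun x p => ∃ y, Le a x ∧ (Le a' y ∧ y ∊ c') ∧
      col a x = col a' y ∧ p = pair x y) inferInstance ?_
    rintro x p p' ⟨y, hx, hy, e, rfl⟩ ⟨y', -, hy', e', rfl⟩
    rw [col_injective (hg.right.of_mem hy.2) (hg.right.of_mem hy'.2) hy.1 hy'.1 (e.symm.trans e')]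
  have hk : ∀ x y, pair x y ∊ mkSet {p | ∃ x, x ∊ c ∧ ∃ y, Le a x ∧ (Le a' y ∧ y ∊ c') ∧
      col a x = col a' y ∧ p = pair x y} ↔
      (Le a x ∧ x ∊ c) ∧ (Le a' y ∧ y ∊ c') ∧ col a x = col a' y := by
    intro x y
    rw [mem_mkSet hs]
    constructor
    · rintro ⟨x', hx', y', hax, hy, e, e'⟩
      obtain ⟨rfl, rfl⟩ := pair_injective e'
      exact ⟨⟨hax, hx'⟩, hy, e⟩
    · rintro ⟨⟨hax, hx⟩, hy, e⟩
      exact ⟨x, hx, y, hax, hy, e, rfl⟩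
  -- Equal normal forms have equal lengths, so each index of one segment has a counterpart in the
  -- other.
  obtain ⟨-, ec⟩ := hf.hat.endpoints_unique (h ▸ hg.hat)
  refine ⟨_, not_atom_mkSet _, (tame_mkSet hs).2 ?_, hk, ?_, ?_, ?_⟩
  · rintro _ ⟨x, hx, y, -, hy, -, rfl⟩
    exact tame_pair.2 ⟨(hf.right.of_mem hx).tame, (hg.right.of_mem hy.2).tame⟩
  · intro x hax hx
    have : col a x ∊ col a' c' := ec ▸ col_mem_col hx hax
    obtain ⟨y, hy, hay, e⟩ := mem_col.1 this
    exact ⟨y, (hk x y).2 ⟨⟨hax, hx⟩, ⟨hay, hy⟩, e⟩⟩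
  · intro y hay hy
    have : col a' y ∊ col a c := ec ▸ col_mem_col hy hay
    obtain ⟨x, hx, hax, e⟩ := mem_col.1 this
    exact ⟨x, (hk x y).2 ⟨⟨hax, hx⟩, ⟨hay, hy⟩, e.symm⟩⟩
  · intro x y hxy w
    obtain ⟨⟨hax, hx⟩, ⟨hay, hy⟩, e⟩ := (hk x y).1 hxy
    constructor
    · intro hw
      have : pair (col a x) w ∊ hat a' g := h ▸ pair_mem_hat.2 ⟨x, rfl, hw⟩
      obtain ⟨y', e', hw'⟩ := pair_mem_hat.1 this
      rwa [col_injective (hg.right.of_mem hy) (hg.ord_of_mem hw') hay (hg.le_of_mem hw')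
        (e.symm.trans e')]
    · intro hw
      have : pair (col a' y) w ∊ hat a f := h ▸ pair_mem_hat.2 ⟨y, rfl, hw⟩
      obtain ⟨x', e', hw'⟩ := pair_mem_hat.1 this
      rwa [col_injective (hf.right.of_mem hx) (hf.ord_of_mem hw') hax (hf.le_of_mem hw')
        (e.trans e')]

end Similar

end Skand

end ClassTheory

namespace ClassTheory

open MemStructure (Atom IsClass)
open Marked (mark atom_mark)

set_option synthInstance.maxHeartbeats 1000000
set_option synthInstance.maxSize 2000
set_option maxHeartbeats 1000000
set_option linter.unusedSectionVars false

/-! #### The cumulative hierarchy and enumerations by ordinals -/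

section Enumeration

variable {V : Type} [Universe V] [Founded V]

/-- The cumulative hierarchy over the individuals, indexed by arbitrary elements as the recursion
yields it. A level is a set because the individuals form one. -/
theorem exists_hierarchy (hA : Small {x : V | Atom x}) : ∃ R : V → V, DefFun V R ∧
    ∀ x y, y ∊ R x ↔ Atom y ∨ ∃ z, z ∊ x ∧ ∀ w, w ∊ y → w ∊ R z := by
  obtain ⟨R, hR, h⟩ := exists_recursion (V := V) (α := V)
    fun _ x g => mkSet {y | Atom y ∨ ∃ z, z ∊ x ∧ ∀ w, w ∊ y → w ∊ ap g z}
  have hRa : DefFun V (R (mkSet ∅)) := hR.comp₂ (fun _ : V => mkSet ∅) fun x => x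
  refine ⟨R (mkSet ∅), hRa, fun x y => ?_⟩
  generalize (mkSet ∅ : V) = a at hRa ⊢
  have hRa' {β : Type} [Coded V β] (f : β → V) [DefFun V f] : DefFun V (fun b => R a (f b)) :=
    hRa.comp
  rw [h]
  have e : ({y | Atom y ∨ ∃ z, z ∊ x ∧ ∀ w, w ∊ y → w ∊ ap (graphOn (R a) x) z} : Set V) =
      {y | Atom y ∨ ∃ z, z ∊ x ∧ ∀ w, w ∊ y → w ∊ R a z} := by
    ext y
    refine or_congr_right (exists_congr fun z => and_congr_right fun hz => ?_)
    rw [ap_graphOn hz]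
  rw [e]
  have hb := small_biUnion x fun z => mkSet {y | ¬ Atom y ∧ ∀ w, w ∊ y → w ∊ R a z}
  have hu := small_union (mkSet {x : V | Atom x})
    (mkSet {y | ∃ z, z ∊ x ∧ y ∊ mkSet {y | ¬ Atom y ∧ ∀ w, w ∊ y → w ∊ R a z}})
  refine mem_mkSet (small_of_subset (P := fun y => Atom y ∨ ∃ z, z ∊ x ∧ ∀ w, w ∊ y → w ∊ R a z)
    inferInstance (a := mkSet _) fun y hy => (mem_mkSet hu).2 ?_)
  by_cases hya : Atom y
  · exact .inl ((mem_mkSet hA).2 hya)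
  · obtain ⟨z, hz, hw⟩ := hy.resolve_left hya
    exact .inr ((mem_mkSet hb).2 ⟨z, hz, (mem_mkSet (small_powerset _)).2 ⟨hya, hw⟩⟩)

/-- A definable hierarchy of sets, indexed by the ordinals, that exhausts the universe -/
theorem exists_exhaustion (hA : Small {x : V | Atom x}) : ∃ R : V → V, DefFun V R ∧
    (∀ a b x, IsOrd b → Le a b → x ∊ R a → x ∊ R b) ∧ ∀ x, ∃ a, IsOrd a ∧ x ∊ R a := by
  obtain ⟨R, hR, h⟩ := exists_hierarchy hA
  have hR' {β : Type} [Coded V β] (f : β → V) [DefFun V f] : DefFun V (fun b => R (f b)) :=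
    hR.comp
  have mono : ∀ a b x, IsOrd b → Le a b → x ∊ R a → x ∊ R b := by
    intro a b x hb hab hx
    rw [h] at hx ⊢
    exact hx.imp_right fun ⟨z, hz, hw⟩ => ⟨z, mem_of_mem_le hb hz hab, hw⟩
  refine ⟨R, hR, mono, fun x => ?_⟩
  induction x using mem_induction with
  | hP => infer_instance
  | h x ih =>
    -- The rank is the least level containing the element. By replacement the ranks of the members
    -- of `x` are bounded, and `x` appears one level above a bound.
    let rk : V → V := fun w => iota fun a => IsOrd a ∧ w ∊ R a ∧ ∀ b, IsOrd b → w ∊ R b → Le a b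
    have hrk : DefFun V rk := by
      dsimp only [rk]
      infer_instance
    have rk_spec : ∀ w, w ∊ x → IsOrd (rk w) ∧ w ∊ R (rk w) := by
      intro w hw
      obtain ⟨a, ha, hwa, hl⟩ := exists_least (P := fun a => w ∊ R a) (ih w hw)
      have : rk w = a := by
        refine iota_eq ⟨ha, hwa, hl⟩ ?_
        rintro b ⟨hb, hwb, hl'⟩
        rcases hl b hb hwb with e | h'
        · exact e
        · exact (not_mem_of_le (hl' a ha hwa) h').elim
      rw [this]
      exact ⟨ha, hwa⟩
    obtain ⟨b, hb, hub⟩ := exists_upper_bound x rk fun w hw => (rk_spec w hw).1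
    refine ⟨osucc b, hb.osucc, (h _ _).2 (.inr ⟨b, mem_osucc.2 (.inr rfl), fun w hw => ?_⟩)⟩
    exact mono _ _ w hb (.inr (hub w hw)) (rk_spec w hw).2

/-- A definable bijection of the ordinals with a proper class -/
theorem exists_enumeration (hA : Small {x : V | Atom x}) {P : V → Prop} (hP : Def V P)
    (hns : ¬ Small {x | P x}) : ∃ G : V → V, DefFun V G ∧ (∀ a, IsOrd a → P (G a)) ∧
      (∀ a b, IsOrd a → IsOrd b → G a = G b → a = b) ∧ ∀ x, P x → ∃ a, IsOrd a ∧ x = G a := by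
  have hP' {β : Type} [Coded V β] (f : β → V) [DefFun V f] : Def V (fun b => P (f b)) := hP.comp
  obtain ⟨R, hR, mono, hex⟩ := exists_exhaustion hA
  have hR' {β : Type} [Coded V β] (f : β → V) [DefFun V f] : DefFun V (fun b => R (f b)) :=
    hR.comp
  obtain ⟨ch, hch, hch_mem⟩ := exists_choice (V := V)
  have hch' {β : Type} [Coded V β] (f : β → V) [DefFun V f] : DefFun V (fun b => ch (f b)) :=
    hch.comp
  -- Choice selects from sets, not from classes. Therefore `G a` is chosen among the elements of `P`
  -- not enumerated so far (`Q`) in the least level of the hierarchy where there are any (`B`).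
  let Q : V → V → V → Prop := fun a g y => P y ∧ ∀ z, z ∊ a → y ≠ ap g z
  have hQ {β : Type} [Coded V β] (f g k : β → V) [DefFun V f] [DefFun V g] [DefFun V k] :
      Def V (fun b => Q (f b) (g b) (k b)) :=
    Def.comp₃ (P := Q) (by dsimp only [Q, ne_eq]; infer_instance) f g k
  let B : V → V → V → Prop := fun a g b =>
    IsOrd b ∧ (∃ y, y ∊ R b ∧ Q a g y) ∧ ∀ b', IsOrd b' → (∃ y, y ∊ R b' ∧ Q a g y) → Le b b'
  have hB {β : Type} [Coded V β] (f g k : β → V) [DefFun V f] [DefFun V g] [DefFun V k] :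
      Def V (fun b => B (f b) (g b) (k b)) :=
    Def.comp₃ (P := B) (by dsimp only [B]; infer_instance) f g k
  obtain ⟨G, hG, hrec⟩ := exists_recursion (V := V) (α := V)
    fun _ a g => ch (mkSet {y | y ∊ R (iota fun b => B a g b) ∧ Q a g y})
  have hGa : DefFun V (G (mkSet ∅)) := hG.comp₂ (fun _ : V => mkSet ∅) fun x => x
  replace hrec := hrec (mkSet ∅)
  generalize G (mkSet ∅) = G at hGa hrec
  have hG' {β : Type} [Coded V β] (f : β → V) [DefFun V f] : DefFun V (fun b => G (f b)) :=
    hGa.comp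
  have Q_iff : ∀ a y, Q a (graphOn G a) y ↔ P y ∧ ∀ z, z ∊ a → y ≠ G z := by
    intro a y
    refine and_congr_right fun _ => forall₂_congr fun z hz => ?_
    rw [ap_graphOn hz]
  have spec : ∀ a, ∃ b, B a (graphOn G a) b ∧ G a ∊ R b ∧ Q a (graphOn G a) (G a) := by
    intro a
    have hne : ∃ b, IsOrd b ∧ ∃ y, y ∊ R b ∧ Q a (graphOn G a) y := by
      by_contra hcon
      refine hns (small_of_subset hP (a := mkSet {y | ∃ z, z ∊ a ∧ y = G z}) fun y hy => ?_)
      rw [mem_mkSet (small_image a G)]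
      by_contra hy'
      obtain ⟨b, hb, hyb⟩ := hex y
      refine hcon ⟨b, hb, y, hyb, (Q_iff a y).2 ⟨hy, fun z hz e => hy' ⟨z, hz, e⟩⟩⟩
    obtain ⟨b, hb, hyb, hl⟩ := exists_least (P := fun b => ∃ y, y ∊ R b ∧ Q a (graphOn G a) y) hne
    have hBb : B a (graphOn G a) b := ⟨hb, hyb, hl⟩
    have e : (iota fun b => B a (graphOn G a) b) = b := by
      refine iota_eq hBb ?_
      rintro b' ⟨hb', hyb', hl'⟩
      rcases hl b' hb' hyb' with e | h'
      · exact e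
      · exact (not_mem_of_le (hl' b hb hyb) h').elim
    have hs := small_sep (R b) fun y => Q a (graphOn G a) y
    obtain ⟨y, hy⟩ := hyb
    have := hch_mem _ y ((mem_mkSet hs).2 hy)
    rw [mem_mkSet hs] at this
    refine ⟨b, hBb, ?_⟩
    rw [hrec a, e]
    exact this
  have inj : ∀ a b, IsOrd a → IsOrd b → G a = G b → a = b := by
    intro a b ha hb e
    obtain ⟨-, -, -, hQa⟩ := spec a
    obtain ⟨-, -, -, hQb⟩ := spec b
    rw [Q_iff] at hQa hQb
    rcases ha.trichotomy hb with h | h | h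
    exacts [(hQb.2 a h e.symm).elim, h, (hQa.2 b h e).elim]
  refine ⟨G, hGa, fun a _ => ?_, inj, fun x hx => ?_⟩
  · obtain ⟨-, -, -, hQa⟩ := spec a
    exact hQa.1
  -- An element of level `c` that is never enumerated would keep all values of `G` within `R c`.
  -- Then `G` would inject the ordinals into a set.
  · by_contra hcon
    push Not at hcon
    obtain ⟨c, hc, hxc⟩ := hex x
    have hmem : ∀ a, IsOrd a → G a ∊ R c := by
      intro a ha
      obtain ⟨b, hBb, hab, -⟩ := spec a
      have hle : Le b c := hBb.2.2 c hc ⟨x, hxc, (Q_iff a x).2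
        ⟨hx, fun z hz => hcon z (ha.of_mem hz)⟩⟩
      exact mono b c _ hc hle hab
    refine not_small_isOrd (V := V) ?_
    have := Interp.small_of_functional (a := R c) (R := fun y a => IsOrd a ∧ G a = y)
      inferInstance fun y a b ha hb => inj a b ha.1 hb.1 (ha.2.trans hb.2.symm)
    refine small_of_subset inferInstance (a := mkSet _) fun a ha => (mem_mkSet this).2 ?_
    exact ⟨G a, hmem a ha, ha, rfl⟩

end Enumeration

/-! ### Von Neumann's axiom in the universe with skands -/

section

variable {V : Type} [Universe V] [Founded V] [Marked V]

/-- The sets of the universe with skands are in bijection with the ordinals. -/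
theorem SkandUniverse.exists_bijection : ∃ R : SkandUniverse V → SkandUniverse V → Prop,
    Def (SkandUniverse V) (fun p : SkandUniverse V × SkandUniverse V => R p.1 p.2) ∧
    (∀ x a b, R x a → R x b → a = b) ∧ (∀ x y a, R x a → R y a → x = y) ∧
    (∀ x, ¬ Atom x ↔ ∃ a, R x a) ∧ ∀ a, OrdIn a ↔ ∃ x, R x a := by
  have hns : ¬ Small {x : V | IsCode x ∧ ¬ Atom x} := by
    rintro ⟨s, hs, h⟩
    exact not_small_isOrd (V := V) (small_of_subset inferInstance fun a ha =>
      (h a).2 ⟨ha.tame.isCode, ha.1⟩)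
  obtain ⟨G, hG, hGP, hinj, hsurj⟩ := exists_enumeration Marked.small_atoms
    (P := fun x : V => IsCode x ∧ ¬ Atom x) inferInstance hns
  have hG' {β : Type} [Coded V β] (f : β → V) [DefFun V f] : DefFun V (fun b => G (f b)) :=
    hG.comp
  refine ⟨fun x a => IsOrd a.1 ∧ x.1 = G a.1, ?_, ?_, ?_, ?_, ?_⟩
  · refine Interp.def₂_of (I := skandInterp V) (P := fun x a => IsOrd a.1 ∧ x.1 = G a.1)
      (Def.congr (P := fun p : V × V => IsCode p.1 ∧ IsOrd p.2 ∧ p.1 = G p.2)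
      inferInstance fun p => ⟨?_, ?_⟩)
    · rintro ⟨h, _, h'⟩
      exact ⟨h, h'⟩
    · rintro ⟨h, h'⟩
      exact ⟨h, h'.1.tame.isCode, h'⟩
  · rintro x a b ⟨ha, e⟩ ⟨hb, e'⟩
    exact Interp.Carrier.ext (hinj _ _ ha hb (e.symm.trans e'))
  · rintro x y a ⟨ha, e⟩ ⟨-, e'⟩
    exact Interp.Carrier.ext (e.trans e'.symm)
  · intro x
    rw [atom_iff]
    constructor
    · intro hx
      obtain ⟨a, ha, e⟩ := hsurj x.1 ⟨x.2, hx⟩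
      exact ⟨ofTame a ha.tame, ha, e⟩
    · rintro ⟨a, ha, e⟩
      rw [e]
      exact (hGP _ ha).2
  · intro a
    rw [ordIn_iff]
    exact ⟨fun ha => ⟨⟨G a.1, (hGP _ ha).1⟩, ha, rfl⟩, fun ⟨x, hx⟩ => hx.1⟩

end

end ClassTheory

namespace Skands

open FirstOrder FirstOrder.Language ClassTheory
open MemStructure (Atom IsClass)

/-! ### Two-sorted presentations of structures -/

section Relations

variable (b : Bool) {M : Type} [(lang b).Structure M]

/-- The membership relation of a structure -/
def Mem (x y : M) : Prop :=
  Structure.RelMap (L := lang b) (Sym.mem : (lang b).Relations 2) ![x, y]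

/-- The individuals of a structure -/
def Ind (x : M) : Prop :=
  Structure.RelMap (L := lang b) (Sym.ind : (lang b).Relations 1) ![x]

variable {b} {v : ℕ → M} {x y z f p s : ℕ}

theorem realize_mem : (mem x y : Fm b).Realize v ↔ Mem b (v x) (v y) := by
  exact Formula.realize_rel₂

theorem realize_eq : (eq x y : Fm b).Realize v ↔ v x = v y := by
  simp [eq, Formula.realize_equal]

theorem realize_ind : (ind x : Fm b).Realize v ↔ Ind b (v x) := by
  exact Formula.realize_rel₁

theorem realize_iff' {φ ψ : Fm b} : Formula.Realize (φ ⇔ ψ) v ↔ (φ.Realize v ↔ ψ.Realize v) :=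
  Formula.realize_iff

theorem realize_elem : (elem x : Fm b).Realize v ↔ ∃ m, Mem b (v x) m := by
  simp (disch := omega) only [elem, realize_ex_named, realize_mem, Function.update_self,
    Function.update_of_ne]

theorem realize_cls : (cls x : Fm b).Realize v ↔ ¬ Ind b (v x) := by
  rw [cls, Formula.realize_not, realize_ind]

theorem realize_set : (set x : Fm b).Realize v ↔ (∃ m, Mem b (v x) m) ∧ ¬ Ind b (v x) := by
  rw [set, Formula.realize_inf, realize_elem, realize_cls]

theorem realize_sub : (sub x y : Fm b).Realize v ↔ ∀ m, Mem b m (v x) → Mem b m (v y) := by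
  simp (disch := omega) only [sub, realize_all_named, Formula.realize_imp, realize_mem,
    Function.update_self, Function.update_of_ne]

theorem realize_nonempty : (nonempty x : Fm b).Realize v ↔ ∃ m, Mem b m (v x) := by
  simp (disch := omega) only [nonempty, realize_ex_named, realize_mem, Function.update_self,
    Function.update_of_ne]

theorem realize_upair :
    (upair z x y : Fm b).Realize v ↔ ∀ m, Mem b m (v z) ↔ m = v x ∨ m = v y := by
  simp (disch := omega) only [upair, realize_all_named, realize_iff', realize_mem, realize_eq,
    Formula.realize_sup, Function.update_self, Function.update_of_ne]

theorem realize_succ : (succ s x : Fm b).Realize v ↔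
    ¬ Ind b (v s) ∧ ∀ m, Mem b m (v s) ↔ Mem b m (v x) ∨ m = v x := by
  simp (disch := omega) only [succ, realize_all_named, realize_iff', realize_mem, realize_eq,
    Formula.realize_sup, Formula.realize_inf, realize_cls, Function.update_self,
    Function.update_of_ne]

end Relations

/-- The structure `M` is presented by its elements, which are given by `ι`, and its classes. -/
structure Presents (b : Bool) {M N : Type} [(lang b).Structure M] [MemStructure N] (ι : N → M) :
    Prop where
  inj : ∀ x y, ι x = ι y → x = y
  mem_iff : ∀ x y, Mem b (ι x) (ι y) ↔ x ∊ y
  ind_iff : ∀ x, Ind b (ι x) ↔ Atom x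
  exists_mem : ∀ x, ∃ m, Mem b (ι x) m
  of_mem : ∀ {m k : M}, Mem b m k → ∃ x, m = ι x
  of_ind : ∀ {m : M}, Ind b m → ∃ x, m = ι x
  not_mem : ∀ {m k : M}, Ind b m → ¬ Mem b k m
  ext : ∀ {m k : M}, ¬ Ind b m → ¬ Ind b k → (∀ x, Mem b (ι x) m ↔ Mem b (ι x) k) → m = k
  isClass_iff : ∀ X : Set N, IsClass X ↔ ∃ m, ¬ Ind b m ∧ ∀ x, x ∈ X ↔ Mem b (ι x) m
  small_pair : ∀ x y : N, ClassTheory.Small {z | z = x ∨ z = y}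

namespace Presents

variable {b : Bool} {M N : Type} [(lang b).Structure M] [MemStructure N] {ι : N → M}

theorem inj_iff (h : Presents b ι) {x y : N} : ι x = ι y ↔ x = y :=
  ⟨h.inj x y, congrArg ι⟩

theorem exists_mem_iff (h : Presents b ι) {m : M} : (∃ k, Mem b m k) ↔ ∃ x, m = ι x :=
  ⟨fun ⟨_, hk⟩ => h.of_mem hk, fun ⟨x, e⟩ => e ▸ h.exists_mem x⟩

theorem ext_of (h : Presents b ι) {x : N} {m : M} (hx : ¬ Atom x) (hm : ¬ Ind b m)
    (hxm : ∀ y, Mem b (ι y) m ↔ y ∊ x) : m = ι x :=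
  h.ext hm (mt (h.ind_iff x).1 hx) fun y => (hxm y).trans (h.mem_iff y x).symm

/-- The formula `upair` does not say that its first argument is a class. For a nonempty extension
this is automatic; for the empty one `m` might be an individual. -/
theorem eq_mkSet (h : Presents b ι) {S : Set N} (hS : ClassTheory.Small S) (hne : S.Nonempty)
    {m : M} : (∀ k, Mem b k m ↔ ∃ x ∈ S, k = ι x) ↔ m = ι (mkSet S) := by
  have hA : ¬ Atom (mkSet S) := by
    unfold mkSet
    rw [dif_pos hS]
    exact hS.choose_spec.1
  constructor
  · intro hm
    refine h.ext_of hA (fun hi => ?_) fun y => ?_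
    · obtain ⟨x, hx⟩ := hne
      exact h.not_mem hi ((hm _).2 ⟨x, hx, rfl⟩)
    · rw [hm, mem_mkSet hS]
      constructor
      · rintro ⟨x, hx, e⟩
        rwa [h.inj _ _ e]
      · exact fun hy => ⟨y, hy, rfl⟩
  · rintro rfl k
    constructor
    · intro hk
      obtain ⟨x, rfl⟩ := h.of_mem hk
      rw [h.mem_iff, mem_mkSet hS] at hk
      exact ⟨x, hk, rfl⟩
    · rintro ⟨x, hx, rfl⟩
      exact (h.mem_iff _ _).2 ((mem_mkSet hS).2 hx)

theorem forall_mem_iff (h : Presents b ι) {x : N} {P : M → Prop} :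
    (∀ m, Mem b m (ι x) → P m) ↔ ∀ y, y ∊ x → P (ι y) := by
  constructor
  · exact fun hP y hy => hP _ ((h.mem_iff y x).2 hy)
  · intro hP m hm
    obtain ⟨y, rfl⟩ := h.of_mem hm
    exact hP y ((h.mem_iff y x).1 hm)

theorem exists_mem_and_iff (h : Presents b ι) {x : N} {P : M → Prop} :
    (∃ m, Mem b m (ι x) ∧ P m) ↔ ∃ y, y ∊ x ∧ P (ι y) := by
  constructor
  · rintro ⟨m, hm, hP⟩
    obtain ⟨y, rfl⟩ := h.of_mem hm
    exact ⟨y, (h.mem_iff y x).1 hm, hP⟩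
  · exact fun ⟨y, hy, hP⟩ => ⟨_, (h.mem_iff y x).2 hy, hP⟩

theorem exists_mem_ι (h : Presents b ι) {x : N} : (∃ m, Mem b m (ι x)) ↔ ∃ y, y ∊ x := by
  simpa using h.exists_mem_and_iff (x := x) (P := fun _ => True)

/-- Sets with a prescribed extension -/
theorem small_iff (h : Presents b ι) {P : M → Prop} (hP : ∀ m, P m → ∃ x, m = ι x) :
    (∃ m, ((∃ k, Mem b m k) ∧ ¬ Ind b m) ∧ ∀ k, Mem b k m ↔ P k) ↔
      ClassTheory.Small {x | P (ι x)} := by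
  constructor
  · rintro ⟨m, ⟨hm, hi⟩, hk⟩
    obtain ⟨x, rfl⟩ := h.exists_mem_iff.1 hm
    exact ⟨x, mt (h.ind_iff x).2 hi, fun y => (h.mem_iff y x).symm.trans (hk _)⟩
  · rintro ⟨x, hx, hy⟩
    refine ⟨ι x, ⟨h.exists_mem x, mt (h.ind_iff x).1 hx⟩, fun k => ⟨fun hk => ?_, fun hk => ?_⟩⟩
    · obtain ⟨y, rfl⟩ := h.of_mem hk
      exact (hy y).1 ((h.mem_iff y x).1 hk)
    · obtain ⟨y, rfl⟩ := hP k hk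
      exact (h.mem_iff y x).2 ((hy y).2 hk)

variable {v : ℕ → M} {x y z f p s a c g : ℕ}

theorem realize_elem (h : Presents b ι) : (elem x : Fm b).Realize v ↔ ∃ d, v x = ι d := by
  rw [Skands.realize_elem, h.exists_mem_iff]

theorem realize_set (h : Presents b ι) : (set x : Fm b).Realize v ↔ ∃ d, v x = ι d ∧ ¬ Atom d := by
  rw [Skands.realize_set, h.exists_mem_iff]
  constructor
  · rintro ⟨⟨d, e⟩, hi⟩
    rw [e, h.ind_iff] at hi
    exact ⟨d, e, hi⟩
  · rintro ⟨d, e, hi⟩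
    rw [e, h.ind_iff]
    exact ⟨⟨d, rfl⟩, hi⟩

theorem forall_mem_iff_or (h : Presents b ι) {d e : N} {m : M} :
    (∀ k, Mem b k m ↔ k = ι d ∨ k = ι e) ↔ m = ι (mkSet {w | w = d ∨ w = e}) := by
  rw [← h.eq_mkSet (h.small_pair d e) ⟨d, .inl rfl⟩]
  refine forall_congr' fun k => iff_congr Iff.rfl ?_
  constructor
  · rintro (rfl | rfl)
    exacts [⟨d, .inl rfl, rfl⟩, ⟨e, .inr rfl, rfl⟩]
  · rintro ⟨_, rfl | rfl, rfl⟩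
    exacts [.inl rfl, .inr rfl]

theorem realize_opair (h : Presents b ι) : (opair p x y : Fm b).Realize v ↔
    ∃ d e, v x = ι d ∧ v y = ι e ∧ v p = ι (pair d e) := by
  simp (disch := omega) only [opair, realize_all_named, realize_iff', Skands.realize_mem,
    realize_upair, Formula.realize_sup, Formula.realize_inf, h.realize_elem, Function.update_self,
    Function.update_of_ne]
  constructor
  · rintro ⟨⟨⟨d, hd⟩, ⟨e, he⟩⟩, hp⟩
    refine ⟨d, e, hd, he, ?_⟩
    simp only [hd, he, h.forall_mem_iff_or] at hp
    simp only [or_self] at hp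
    exact hp
  · rintro ⟨d, e, hd, he, hp⟩
    refine ⟨⟨⟨d, hd⟩, ⟨e, he⟩⟩, ?_⟩
    simp only [hd, he, h.forall_mem_iff_or]
    simp only [or_self]
    exact hp

theorem realize_app (h : Presents b ι) : (app f x y : Fm b).Realize v ↔
    ∃ d e, v x = ι d ∧ v y = ι e ∧ Mem b (ι (pair d e)) (v f) := by
  simp (disch := omega) only [app, realize_ex_named, Formula.realize_inf, realize_mem,
    h.realize_opair, Function.update_self, Function.update_of_ne]
  constructor
  · rintro ⟨m, hm, d, e, hd, he, rfl⟩
    exact ⟨d, e, hd, he, hm⟩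
  · rintro ⟨d, e, hd, he, hm⟩
    exact ⟨_, hm, d, e, hd, he, rfl⟩

theorem realize_functional (h : Presents b ι) : (functional f : Fm b).Realize v ↔
    ∀ d e e', Mem b (ι (pair d e)) (v f) → Mem b (ι (pair d e')) (v f) → e = e' := by
  simp (disch := omega) only [functional, realize_all_named, Formula.realize_imp,
    Formula.realize_inf, h.realize_app, realize_eq, Function.update_self, Function.update_of_ne]
  constructor
  · exact fun hf d e e' h₁ h₂ => h.inj _ _
      (hf (ι d) (ι e) (ι e') ⟨⟨d, e, rfl, rfl, h₁⟩, ⟨d, e', rfl, rfl, h₂⟩⟩)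
  · rintro hf m k k' ⟨⟨d, e, rfl, rfl, h₁⟩, ⟨d', e', hd, rfl, h₂⟩⟩
    obtain rfl := h.inj _ _ hd
    rw [hf d e e' h₁ h₂]

theorem realize_injective (h : Presents b ι) : (injective f : Fm b).Realize v ↔
    ∀ d d' e, Mem b (ι (pair d e)) (v f) → Mem b (ι (pair d' e)) (v f) → d = d' := by
  simp (disch := omega) only [injective, realize_all_named, Formula.realize_imp,
    Formula.realize_inf, h.realize_app, realize_eq, Function.update_self, Function.update_of_ne]
  constructor
  · exact fun hf d d' e h₁ h₂ => h.inj _ _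
      (hf (ι d) (ι d') (ι e) ⟨⟨d, e, rfl, rfl, h₁⟩, ⟨d', e, rfl, rfl, h₂⟩⟩)
  · rintro hf m k k' ⟨⟨d, e, rfl, rfl, h₁⟩, ⟨d', e', rfl, he, h₂⟩⟩
    obtain rfl := h.inj _ _ he
    rw [hf d d' e h₁ h₂]

theorem realize_succ (h : Presents b ι) {d e : N} (hs : v s = ι d) (hx : v x = ι e) :
    (succ s x : Fm b).Realize v ↔ ¬ Atom d ∧ ∀ w, w ∊ d ↔ w ∊ e ∨ w = e := by
  rw [Skands.realize_succ, hs, hx, h.ind_iff]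
  refine and_congr_right fun _ => ⟨fun hw w => ?_, fun hw m => ⟨fun hm => ?_, fun hm => ?_⟩⟩
  · rw [← h.mem_iff, hw, h.mem_iff, h.inj_iff]
  · obtain ⟨w, rfl⟩ := h.of_mem hm
    rw [h.mem_iff] at hm
    rw [h.mem_iff, h.inj_iff]
    exact (hw w).1 hm
  · obtain ⟨w, rfl⟩ : ∃ w, m = ι w := hm.elim h.of_mem fun e => ⟨_, e⟩
    rw [h.mem_iff, h.inj_iff] at hm
    rw [h.mem_iff]
    exact (hw w).2 hm

/-! #### The axioms common to both theories -/

theorem realize_existence (h : Presents b ι) {u : Bool} :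
    (existence u : Fm b).Realize v ↔ ((∃ d : N, Atom d) ↔ u = true) := by
  have key : (∃ m : M, Ind b m) ↔ ∃ d : N, Atom d := by
    constructor
    · rintro ⟨m, hm⟩
      obtain ⟨d, rfl⟩ := h.of_ind hm
      exact ⟨d, (h.ind_iff d).1 hm⟩
    · exact fun ⟨d, hd⟩ => ⟨_, (h.ind_iff d).2 hd⟩
  cases u
  · simp [existence, realize_ex_named, realize_ind, Formula.realize_not, ← key]
  · simp [existence, realize_ex_named, realize_ind, key]

theorem realize_pairing (h : Presents b ι) : (pairing : Fm b).Realize v := by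
  simp (disch := omega) only [pairing, realize_all_named, realize_ex_named, Formula.realize_imp,
    Formula.realize_inf, h.realize_elem, Skands.realize_set, realize_upair, Function.update_self,
    Function.update_of_ne]
  rintro m k ⟨⟨d, rfl⟩, ⟨e, rfl⟩⟩
  refine (h.small_iff (P := fun m => m = ι d ∨ m = ι e) ?_).2 ?_
  · rintro m (e | e)
    exacts [⟨_, e⟩, ⟨_, e⟩]
  · simpa only [h.inj_iff] using h.small_pair d e

theorem realize_union (h : Presents b ι) : (union : Fm b).Realize v ↔
    ∀ d : N, ¬ Atom d → ClassTheory.Small {z | ∃ y, y ∊ d ∧ z ∊ y} := by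
  simp (disch := omega) only [union, realize_all_named, realize_ex_named, Formula.realize_imp,
    Formula.realize_inf, Skands.realize_set, realize_iff', realize_mem, Function.update_self,
    Function.update_of_ne]
  have key : ∀ m : M, (∃ k, ((∃ l, Mem b k l) ∧ ¬ Ind b k) ∧ ∀ l, Mem b l k ↔
      ∃ n, Mem b n m ∧ Mem b l n) ↔
      ClassTheory.Small {z | ∃ n, Mem b n m ∧ Mem b (ι z) n} := fun m =>
    h.small_iff fun l ⟨n, _, hl⟩ => h.of_mem hl
  simp only [key]
  constructor
  · intro H d hd
    have := H (ι d) ⟨h.exists_mem d, mt (h.ind_iff d).1 hd⟩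
    simpa only [h.exists_mem_and_iff, h.mem_iff] using this
  · rintro H m ⟨hm, hi⟩
    obtain ⟨d, rfl⟩ := h.exists_mem_iff.1 hm
    have := H d (mt (h.ind_iff d).2 hi)
    simpa only [h.exists_mem_and_iff, h.mem_iff] using this

theorem realize_power (h : Presents b ι) : (power : Fm b).Realize v ↔
    ∀ d : N, ¬ Atom d → ClassTheory.Small {y | ¬ Atom y ∧ ∀ z, z ∊ y → z ∊ d} := by
  simp (disch := omega) only [power, realize_all_named, realize_ex_named, Formula.realize_imp,
    Formula.realize_inf, Skands.realize_set, realize_iff', realize_mem, realize_sub,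
    Function.update_self, Function.update_of_ne]
  have key : ∀ m : M, (∃ k, ((∃ l, Mem b k l) ∧ ¬ Ind b k) ∧ ∀ l, Mem b l k ↔
      ((∃ n, Mem b l n) ∧ ¬ Ind b l) ∧ ∀ n, Mem b n l → Mem b n m) ↔
      ClassTheory.Small {z | ((∃ n, Mem b (ι z) n) ∧ ¬ Ind b (ι z)) ∧
        ∀ n, Mem b n (ι z) → Mem b n m} := fun m =>
    h.small_iff fun l hl => h.exists_mem_iff.1 hl.1.1
  simp only [key, h.exists_mem, h.ind_iff, true_and, h.forall_mem_iff]
  constructor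
  · intro H d hd
    have := H (ι d) ⟨h.exists_mem d, mt (h.ind_iff d).1 hd⟩
    simpa only [h.mem_iff] using this
  · rintro H m ⟨hm, hi⟩
    obtain ⟨d, rfl⟩ := h.exists_mem_iff.1 hm
    have := H d (mt (h.ind_iff d).2 hi)
    simpa only [h.mem_iff] using this

theorem realize_replacement (h : Presents b ι) : (replacement : Fm b).Realize v ↔
    ∀ (d : N) (F : Set N), ¬ Atom d → IsClass F →
      (∀ x y z, pair x y ∈ F → pair x z ∈ F → y = z) →
      ClassTheory.Small {z | ∃ y, y ∊ d ∧ pair y z ∈ F} := by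
  simp (disch := omega) only [replacement, realize_all_named, realize_ex_named,
    Formula.realize_imp, Formula.realize_inf, Skands.realize_set, realize_cls,
    h.realize_functional, realize_iff', realize_mem, h.realize_app, Function.update_self,
    Function.update_of_ne]
  have key : ∀ m k : M, (∃ l, ((∃ n, Mem b l n) ∧ ¬ Ind b l) ∧ ∀ n, Mem b n l ↔
      ∃ r, Mem b r m ∧ ∃ d e, r = ι d ∧ n = ι e ∧ Mem b (ι (pair d e)) k) ↔
      ClassTheory.Small {z | ∃ r, Mem b r m ∧
        ∃ d e, r = ι d ∧ ι z = ι e ∧ Mem b (ι (pair d e)) k} :=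
    fun m k => h.small_iff fun n ⟨_, _, _, e, _, he, _⟩ => ⟨e, he⟩
  have key' : ∀ (d : N) (k : M), ({z | ∃ r, Mem b r (ι d) ∧ ∃ d e, r = ι d ∧ ι z = ι e ∧
      Mem b (ι (pair d e)) k} : Set N) = {z | ∃ y, y ∊ d ∧ Mem b (ι (pair y z)) k} := by
    intro d k
    ext z
    constructor
    · rintro ⟨_, hr, y, e, rfl, he, hk⟩
      obtain rfl := h.inj _ _ he
      exact ⟨y, (h.mem_iff _ _).1 hr, hk⟩
    · rintro ⟨y, hy, hk⟩
      exact ⟨ι y, (h.mem_iff _ _).2 hy, y, z, rfl, rfl, hk⟩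
  simp only [key]
  constructor
  · intro H d F hd hF hu
    obtain ⟨k, hk, hF⟩ := (h.isClass_iff F).1 hF
    have := H (ι d) k ⟨⟨⟨h.exists_mem d, mt (h.ind_iff d).1 hd⟩, hk⟩,
      fun x y z => by simpa only [hF] using hu x y z⟩
    rw [key'] at this
    simpa only [hF] using this
  · rintro H m k ⟨⟨⟨hm, hi⟩, hk⟩, hu⟩
    obtain ⟨d, rfl⟩ := h.exists_mem_iff.1 hm
    rw [key']
    exact H d {p | Mem b (ι p) k} (mt (h.ind_iff d).2 hi)
      ((h.isClass_iff _).2 ⟨k, hk, fun _ => Iff.rfl⟩) hu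

theorem realize_infinity (h : Presents b ι) : (infinity : Fm b).Realize v ↔
    ∃ x : N, ¬ Atom x ∧ (∃ e, e ∊ x ∧ ¬ Atom e ∧ ∀ y, ¬ y ∊ e) ∧
      ∀ y, y ∊ x → ∃ z, z ∊ x ∧ ¬ Atom z ∧ ∀ w, w ∊ z ↔ w ∊ y ∨ w = y := by
  have hS : ∀ (d e : N) (w : ℕ → M), (succ 2 1 : Fm b).Realize
      (Function.update (Function.update w 1 (ι d)) 2 (ι e)) ↔
      ¬ Atom e ∧ ∀ w, w ∊ e ↔ w ∊ d ∨ w = d := fun d e w =>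
    h.realize_succ (by simp) (by simp)
  simp (disch := omega) only [infinity, realize_all_named, realize_ex_named,
    Formula.realize_imp, Formula.realize_inf, h.realize_set, realize_mem, realize_nonempty,
    Formula.realize_not, Function.update_self, Function.update_of_ne]
  constructor
  · rintro ⟨m, ⟨⟨x, rfl, hx⟩, k, ⟨hk, e, rfl, he⟩, hne⟩, hs⟩
    rw [h.exists_mem_ι] at hne
    refine ⟨x, hx, ⟨e, (h.mem_iff _ _).1 hk, he, fun y hy => hne ⟨y, hy⟩⟩, fun y hy => ?_⟩
    obtain ⟨l, hl, hl'⟩ := hs (ι y) ((h.mem_iff _ _).2 hy)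
    obtain ⟨z, rfl⟩ := h.of_mem hl
    rw [hS] at hl'
    exact ⟨z, (h.mem_iff _ _).1 hl, hl'⟩
  · rintro ⟨x, hx, ⟨e, hex, he, hne⟩, hs⟩
    refine ⟨ι x, ⟨⟨x, rfl, hx⟩, ι e, ⟨(h.mem_iff _ _).2 hex, e, rfl, he⟩, ?_⟩, fun k hk => ?_⟩
    · rw [h.exists_mem_ι]
      exact fun ⟨y, hy⟩ => hne y hy
    · obtain ⟨y, rfl⟩ := h.of_mem hk
      obtain ⟨z, hz, hz'⟩ := hs y ((h.mem_iff _ _).1 hk)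
      exact ⟨ι z, (h.mem_iff _ _).2 hz, (hS y z _).2 hz'⟩

theorem realize_choice (h : Presents b ι) : (choice : Fm b).Realize v ↔
    ∃ F : Set N, IsClass F ∧ (∀ x y z, pair x y ∈ F → pair x z ∈ F → y = z) ∧
      ∀ x, ¬ Atom x → (∃ y, y ∊ x) → ∃ y, y ∊ x ∧ pair x y ∈ F := by
  simp (disch := omega) only [choice, realize_all_named, realize_ex_named,
    Formula.realize_imp, Formula.realize_inf, h.realize_set, realize_mem, realize_nonempty,
    realize_cls, h.realize_functional, h.realize_app, Function.update_self,
    Function.update_of_ne]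
  constructor
  · rintro ⟨m, ⟨hm, hu⟩, hc⟩
    refine ⟨{p | Mem b (ι p) m}, (h.isClass_iff _).2 ⟨m, hm, fun _ => Iff.rfl⟩, hu,
      fun x hx hne => ?_⟩
    obtain ⟨k, hk, d, e, hd, rfl, hde⟩ := hc (ι x) ⟨⟨x, rfl, hx⟩, h.exists_mem_ι.2 hne⟩
    obtain rfl := h.inj _ _ hd
    exact ⟨e, (h.mem_iff _ _).1 hk, hde⟩
  · rintro ⟨F, hF, hu, hc⟩
    obtain ⟨m, hm, hF⟩ := (h.isClass_iff F).1 hF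
    refine ⟨m, ⟨hm, fun d e e' => by simpa only [hF] using hu d e e'⟩, ?_⟩
    rintro _ ⟨⟨x, rfl, hx⟩, hne⟩
    obtain ⟨y, hy, hxy⟩ := hc x hx (h.exists_mem_ι.1 hne)
    exact ⟨ι y, (h.mem_iff _ _).2 hy, x, y, rfl, rfl, (hF _).1 hxy⟩

end Presents

end Skands

namespace Skands

open FirstOrder FirstOrder.Language ClassTheory
open MemStructure (Atom IsClass)

/-! ### The universe of a model of class theory -/

instance (b : Bool) : (lang b).IsRelational :=
  fun _ => inferInstanceAs (IsEmpty Empty)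

instance (b : Bool) : Countable (lang b).Symbols := by
  have : ∀ n, Finite (Sym b n) := fun n => by
    refine Finite.of_injective (fun R : Sym b n => match R with
      | .mem => (0 : Fin 3)
      | .ind => 1
      | .skand _ => 2) ?_
    intro R S h
    cases R <;> cases S <;> first | rfl | simp at h
  have : ∀ n, Countable ((lang b).Relations n) := fun n => inferInstanceAs (Countable (Sym b n))
  have : ∀ n, Countable ((lang b).Functions n) := fun n => inferInstanceAs (Countable Empty)
  exact inferInstanceAs (Countable ((Σ n, (lang b).Functions n) ⊕ Σ n, (lang b).Relations n))

section

variable {b : Bool} {M : Type} [(lang b).Structure M]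

theorem realize_elemLast {n : ℕ} {v : ℕ → M} {xs : Fin n → M} {m : M} :
    (elemLast n : (lang b).BoundedFormula ℕ (n + 1)).Realize v (Fin.snoc xs m) ↔
      ∃ k, Mem b m k := by
  rw [elemLast, BoundedFormula.realize_ex]
  refine exists_congr fun k => ?_
  refine BoundedFormula.realize_rel₂.trans ?_
  simp [Mem]

theorem realize_boundedMem {n : ℕ} {v : ℕ → M} {xs : Fin n → M} {s t : ℕ ⊕ Fin n} :
    (Relations.boundedFormula₂ (L := lang b) Sym.mem (Term.var s) (Term.var t)).Realize v xs ↔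
      Mem b (Sum.elim v xs s) (Sum.elim v xs t) :=
  BoundedFormula.realize_rel₂

theorem realize_boundedInd {n : ℕ} {v : ℕ → M} {xs : Fin n → M} {s : ℕ ⊕ Fin n} :
    (Relations.boundedFormula₁ (L := lang b) Sym.ind (Term.var s)).Realize v xs ↔
      Ind b (Sum.elim v xs s) :=
  BoundedFormula.realize_rel₁

theorem freeVarFinset_restrict {n : ℕ} (φ : (lang b).BoundedFormula ℕ n) :
    (restrict φ).freeVarFinset ⊆ φ.freeVarFinset := by
  induction φ with
  | falsum => exact subset_rfl
  | equal => exact subset_rfl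
  | rel => exact subset_rfl
  | imp _ _ ih₁ ih₂ => exact Finset.union_subset_union ih₁ ih₂
  | @all n φ ih =>
    refine Finset.union_subset ?_ ih
    intro x hx
    simp [elemLast, BoundedFormula.ex, BoundedFormula.not, Relations.boundedFormula₂,
      Relations.boundedFormula, BoundedFormula.freeVarFinset] at hx

theorem realize_restrict_all {n : ℕ} {φ : (lang b).BoundedFormula ℕ (n + 1)} {v : ℕ → M}
    {xs : Fin n → M} : (restrict φ.all).Realize v xs ↔
      ∀ m, (∃ k, Mem b m k) → (restrict φ).Realize v (Fin.snoc xs m) := by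
  rw [restrict, BoundedFormula.realize_all]
  refine forall_congr' fun m => ?_
  rw [BoundedFormula.realize_imp, realize_elemLast]

/-- Every predicative predicate is defined by a formula with restricted quantifiers, whose
parameters are given by an enumeration `e` of the structure. -/
theorem Presents.exists_formula {N : Type} [MemStructure N] {ι : N → M} (h : Presents b ι)
    {e : ℕ → M} (he : Function.Surjective e) {n : ℕ} {P : (Fin n → N) → Prop}
    (hP : Predicative P) {k : ℕ} (σ : Fin n → ℕ ⊕ Fin k) :
    ∃ φ : (lang b).BoundedFormula ℕ k, ∀ (w : ℕ → M) (xs : Fin k → M) (ys : Fin n → N),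
      (∀ i, w (i + 1) = e i) → (∀ i, Sum.elim w xs (σ i) = ι (ys i)) →
      ((restrict φ).Realize w xs ↔ P ys) := by
  induction hP generalizing k with
  | falsum => exact ⟨⊥, fun w xs ys _ _ => Iff.rfl⟩
  | mem i j =>
    refine ⟨Relations.boundedFormula₂ (L := lang b) Sym.mem (Term.var (σ i)) (Term.var (σ j)),
      fun w xs ys _ hσ => ?_⟩
    refine realize_boundedMem.trans ?_
    rw [hσ, hσ]
    exact h.mem_iff _ _
  | eq i j =>
    refine ⟨.equal (Term.var (σ i)) (Term.var (σ j)), fun w xs ys _ hσ => ?_⟩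
    change Sum.elim w xs (σ i) = Sum.elim w xs (σ j) ↔ ys i = ys j
    rw [hσ, hσ, h.inj_iff]
  | atom i =>
    refine ⟨Relations.boundedFormula₁ (L := lang b) Sym.ind (Term.var (σ i)),
      fun w xs ys _ hσ => ?_⟩
    refine realize_boundedInd.trans ?_
    rw [hσ]
    exact h.ind_iff _
  | cls hX i =>
    obtain ⟨m, -, hm⟩ := (h.isClass_iff _).1 hX
    -- The class enters as a parameter, named by the variable `j + 1`; variable `0` is left for the
    -- element to be defined.
    obtain ⟨j, rfl⟩ := he m
    refine ⟨Relations.boundedFormula₂ (L := lang b) Sym.mem (Term.var (σ i))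
      (Term.var (Sum.inl (j + 1))), fun w xs ys hw hσ => ?_⟩
    refine realize_boundedMem.trans ?_
    rw [hσ, Sum.elim_inl, hw]
    exact (hm _).symm
  | imp _ _ ih₁ ih₂ =>
    obtain ⟨φ, hφ⟩ := ih₁ σ
    obtain ⟨ψ, hψ⟩ := ih₂ σ
    exact ⟨φ.imp ψ, fun w xs ys hw hσ => imp_congr (hφ w xs ys hw hσ) (hψ w xs ys hw hσ)⟩
  | all _ ih =>
    obtain ⟨φ, hφ⟩ := ih (Fin.snoc (fun i => (σ i).map id Fin.castSucc) (Sum.inr (Fin.last k)))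
    refine ⟨φ.all, fun w xs ys hw hσ => ?_⟩
    rw [realize_restrict_all]
    have key : ∀ y, (restrict φ).Realize w (Fin.snoc xs (ι y)) ↔ _ := fun y =>
      hφ w (Fin.snoc xs (ι y)) (Fin.snoc ys y) hw fun i => by
        refine Fin.lastCases ?_ (fun i => ?_) i
        · simp
        · rw [Fin.snoc_castSucc, Fin.snoc_castSucc, ← hσ]
          rcases σ i with j | j <;> simp
    constructor
    · exact fun H y => (key y).1 (H _ (h.exists_mem y))
    · intro H m hm
      obtain ⟨y, rfl⟩ := h.exists_mem_iff.1 hm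
      exact (key y).2 (H y)

/-- Since the model is countable, a single assignment names all possible parameters, and the
comprehension scheme can be applied to the formula found by `exists_formula`. -/
theorem Presents.isClass_of_predicative {N : Type} [MemStructure N] {ι : N → M}
    (h : Presents b ι) {e : ℕ → M} (he : Function.Surjective e)
    (hc : ∀ φ ∈ (comprehension : Set (Fm b)), ∀ v : ℕ → M, φ.Realize v)
    {P : (Fin 1 → N) → Prop} (hP : Predicative P) : IsClass {x | P fun _ => x} := by
  obtain ⟨φ, hφ⟩ := h.exists_formula he hP (fun _ => Sum.inl 0 : Fin 1 → ℕ ⊕ Fin 0)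
  obtain ⟨z, hz⟩ := Infinite.exists_notMem_finset (insert 0 φ.freeVarFinset)
  rw [Finset.mem_insert, not_or] at hz
  -- This gives `w (i + 1) = e i`; the value at `0` will be overwritten.
  let w : ℕ → M := fun i => e (i - 1)
  have H := hc _ ⟨φ, 0, z, hz.1, hz.2, rfl⟩ w
  simp only [realize_ex_named, realize_all_named, Formula.realize_inf, realize_cls, realize_iff',
    Skands.realize_mem, h.realize_elem, Function.update_self, Function.update_of_ne hz.1] at H
  obtain ⟨m, hm, H⟩ := H
  refine (h.isClass_iff _).2 ⟨m, hm, fun x => ?_⟩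
  rw [H (ι x), and_iff_right ⟨x, rfl⟩, Function.update_comm hz.1,
    realize_update_of_notMem fun h' => hz.2 (freeVarFinset_restrict φ h')]
  refine (hφ _ _ _ (fun i => ?_) fun i => ?_).symm
  · simp [w]
  · simp

end

section Elements

variable {M : Type} [(lang false).Structure M]

variable (M) in
/-- The elements of a structure -/
@[ext]
structure Elements where
  /-- The element -/
  val : M
  exists_mem : ∃ k, Mem false val k

/-- The membership structure of the elements -/
@[reducible]
def elementsStructure (h : Nonempty (Elements M)) : MemStructure (Elements M) where
  E x y := Mem false x.1 y.1
  Atom x := Ind false x.1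
  IsClass X := ∃ m : M, ¬ Ind false m ∧ ∀ x, x ∈ X ↔ Mem false x.1 m
  nonempty := h

/-- A countable model of class theory gives rise to a universe. -/
theorem exists_universe {u : Bool} (hM : ∀ φ ∈ NBG u, ∀ v : ℕ → M, φ.Realize v) {e : ℕ → M}
    (he : Function.Surjective e) : ∃ (V : Type) (_ : Universe V), Founded V := by
  have hc : ∀ φ ∈ (common u : Set (Fm false)), φ.Realize e := fun φ hφ => hM φ (.inl hφ) e
  have hi : (infinity : Fm false).Realize e := hc _ (by simp [common])
  have hI : (individuals : Fm false).Realize e := hc _ (by simp [common])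
  have hp : (pairing : Fm false).Realize e := hc _ (by simp [common])
  have hx : extensionality.Realize e := hM _ (by simp [NBG]) e
  have hf : foundation.Realize e := hM _ (by simp [NBG]) e
  have hne : Nonempty (Elements M) := by
    simp (disch := omega) only [infinity, realize_all_named, realize_ex_named,
      Formula.realize_imp, Formula.realize_inf, Skands.realize_set, realize_mem,
      Function.update_self, Function.update_of_ne] at hi
    obtain ⟨m, hm, -⟩ := hi
    exact ⟨⟨m, hm.1.1⟩⟩
  let _ := elementsStructure hne
  have h : Presents false (Elements.val : Elements M → M) := by
    simp (disch := omega) only [individuals, realize_all_named, Formula.realize_imp,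
      Formula.realize_inf, realize_ind, Skands.realize_elem, Formula.realize_not,
      realize_nonempty, Function.update_self] at hI
    simp (disch := omega) only [extensionality, realize_all_named, Formula.realize_imp,
      Formula.realize_inf, realize_cls, realize_iff', realize_mem, realize_eq,
      Function.update_self, Function.update_of_ne] at hx
    simp (disch := omega) only [pairing, realize_all_named, realize_ex_named, Formula.realize_imp,
      Formula.realize_inf, Skands.realize_elem, Skands.realize_set, realize_upair,
      Function.update_self, Function.update_of_ne] at hp
    refine ⟨fun _ _ => Elements.ext, fun _ _ => Iff.rfl, fun _ => Iff.rfl, fun x => x.2,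
      fun h => ⟨⟨_, _, h⟩, rfl⟩, fun h => ⟨⟨_, (hI _ h).1⟩, rfl⟩, fun h h' => (hI _ h).2 ⟨_, h'⟩,
      fun {m k} hm hk h => hx m k ⟨⟨hm, hk⟩, fun a => ⟨fun ha => ?_, fun ha => ?_⟩⟩,
      fun X => Iff.rfl, fun x y => ?_⟩
    · exact (h ⟨a, _, ha⟩).1 ha
    · exact (h ⟨a, _, ha⟩).2 ha
    · obtain ⟨m, ⟨hm, hm'⟩, hk⟩ := hp x.1 y.1 ⟨x.2, y.2⟩
      refine ⟨⟨m, hm⟩, hm', fun z => (hk z.1).trans ?_⟩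
      exact or_congr Elements.ext_iff.symm Elements.ext_iff.symm
  have hC : ∀ {P : (Fin 1 → Elements M) → Prop}, Predicative P → IsClass {x | P fun _ => x} :=
    h.isClass_of_predicative he fun φ hφ => hM φ (.inl (.inr hφ))
  let U : Universe (Elements M) :=
    { elementsStructure hne with
      not_mem_of_atom := fun hx => h.not_mem hx
      ext' := fun hx hy hz => h.inj _ _ (h.ext hx hy hz)
      isClass_mem := fun x => by
        -- An individual does not witness that its extension is a class; comprehension provides the
        -- empty class instead.
        by_cases hx : Ind false x.1
        · convert hC (P := fun _ => False) .falsum using 1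
          ext y
          exact ⟨h.not_mem hx, False.elim⟩
        · exact ⟨x.1, hx, fun _ => Iff.rfl⟩
      comprehension := hC
      pairing := h.small_pair
      union := fun {x} => h.realize_union.1 (hc _ (by simp [common])) x
      power := fun {x} => h.realize_power.1 (hc _ (by simp [common])) x
      replacement := fun {x F} => h.realize_replacement.1 (hc _ (by simp [common])) x F
      infinity := h.realize_infinity.1 hi
      choice := h.realize_choice.1 (hc _ (by simp [common])) }
  refine ⟨Elements M, U, ⟨?_⟩⟩
  rintro X ⟨m, hm, hX⟩ ⟨x, hx⟩
  simp (disch := omega) only [foundation, realize_all_named, realize_ex_named,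
    Formula.realize_imp, Formula.realize_inf, realize_nonempty, realize_mem, Formula.realize_not,
    Function.update_self, Function.update_of_ne] at hf
  obtain ⟨k, hk, hmin⟩ := hf m ⟨x.1, (hX x).1 hx⟩
  obtain ⟨y, rfl⟩ := h.of_mem hk
  exact ⟨y, (hX y).2 hk, fun z hz hzX => hmin z.1 hz ((hX z).1 hzX)⟩

end Elements

end Skands

namespace Skands

open FirstOrder FirstOrder.Language ClassTheory
open MemStructure (Atom IsClass)

/-! ### The structure of the classes and individuals of a universe -/

section Obj

variable {N : Type} [Universe N]

/-- The individuals and classes of a universe with a binary relation, which will interpret the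
symbol for skands -/
inductive Obj (_S : N → N → Prop) : Type
  | atom (x : N) (hx : Atom x) : Obj _S
  | cls (X : Set N) (hX : IsClass X) : Obj _S

variable {S : N → N → Prop}

open Classical in
/-- The elements of a universe as individuals or classes -/
noncomputable def toObj (S : N → N → Prop) (x : N) : Obj S :=
  if h : Atom x then .atom x h else .cls {y | y ∊ x} (Universe.isClass_mem x)

theorem toObj_of_atom {x : N} (h : Atom x) : toObj S x = .atom x h :=
  dif_pos h

theorem toObj_of_not_atom {x : N} (h : ¬ Atom x) :
    toObj S x = .cls {y | y ∊ x} (Universe.isClass_mem x) :=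
  dif_neg h

theorem toObj_injective : Function.Injective (toObj S) := by
  intro x y h
  by_cases hx : Atom x <;> by_cases hy : Atom y
  · rw [toObj_of_atom hx, toObj_of_atom hy] at h
    injection h
  · rw [toObj_of_atom hx, toObj_of_not_atom hy] at h
    cases h
  · rw [toObj_of_not_atom hx, toObj_of_atom hy] at h
    cases h
  · rw [toObj_of_not_atom hx, toObj_of_not_atom hy] at h
    injection h with h
    exact ClassTheory.ext hx hy fun z => Set.ext_iff.1 h z

/-- The members of an individual or class -/
def Obj.members : Obj S → Set N
  | .atom _ _ => ∅
  | .cls X _ => X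

/-- Being an individual -/
def Obj.IsAtom : Obj S → Prop
  | .atom _ _ => True
  | .cls _ _ => False

/-- A set is identified with the class of its members (`toObj`). Only images of elements can be
members or stand in the relation of a system to its skand, so proper classes do neither. -/
noncomputable instance : (lang true).Structure (Obj S) where
  funMap f := f.elim
  RelMap {n} (R : Sym true n) := match n, R with
    | _, .mem => fun v => ∃ x, v 0 = toObj S x ∧ x ∈ (v 1).members
    | _, .ind => fun v => (v 0).IsAtom
    | _, .skand _ => fun v => ∃ f x, v 0 = toObj S f ∧ v 1 = toObj S x ∧ S f x

theorem obj_mem_iff {m k : Obj S} : Mem true m k ↔ ∃ x, m = toObj S x ∧ x ∈ k.members :=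
  Iff.rfl

theorem obj_ind_iff {m : Obj S} : Ind true m ↔ m.IsAtom :=
  Iff.rfl

/-- The interpretation of the symbol for skands -/
def SkandRel {M : Type} [(lang true).Structure M] (f x : M) : Prop :=
  Structure.RelMap (L := lang true) (Sym.skand rfl : (lang true).Relations 2) ![f, x]

theorem skandRel_iff {m k : Obj S} :
    SkandRel m k ↔ ∃ f x, m = toObj S f ∧ k = toObj S x ∧ S f x :=
  Iff.rfl

theorem mem_members_toObj {x y : N} : y ∈ (toObj S x).members ↔ y ∊ x := by
  by_cases hx : Atom x
  · rw [toObj_of_atom hx]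
    exact ⟨False.elim, Universe.not_mem_of_atom hx⟩
  · rw [toObj_of_not_atom hx]
    rfl

theorem isAtom_toObj {x : N} : (toObj S x).IsAtom ↔ Atom x := by
  by_cases hx : Atom x
  · rw [toObj_of_atom hx]
    exact iff_of_true trivial hx
  · rw [toObj_of_not_atom hx]
    exact iff_of_false id hx

theorem toObj_mem_iff {x : N} {m : Obj S} : Mem true (toObj S x) m ↔ x ∈ m.members := by
  rw [obj_mem_iff]
  constructor
  · rintro ⟨y, e, hy⟩
    rwa [toObj_injective e]
  · exact fun h => ⟨x, rfl, h⟩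

theorem isClass_members (m : Obj S) : IsClass m.members := by
  cases m with
  | atom x hx =>
    convert Universe.isClass_mem x using 1
    ext y
    exact ⟨False.elim, Universe.not_mem_of_atom hx⟩
  | cls X hX => exact hX

variable (S) in
theorem presents_toObj : Presents true (toObj S) where
  inj _ _ h := toObj_injective h
  mem_iff x y := toObj_mem_iff.trans mem_members_toObj
  ind_iff x := isAtom_toObj
  exists_mem x := ⟨.cls {_x | True} isClass_univ, toObj_mem_iff.2 trivial⟩
  of_mem h := h.imp fun _ h => h.1
  of_ind {m} h := by
    cases m with
    | atom x hx => exact ⟨x, (toObj_of_atom hx).symm⟩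
    | cls X hX => exact h.elim
  not_mem {m k} h h' := by
    cases m with
    | atom x hx => exact h'.choose_spec.2
    | cls X hX => exact h
  ext {m k} hm hk h := by
    cases m with
    | atom x hx => exact (hm trivial).elim
    | cls X hX =>
      cases k with
      | atom x hx => exact (hk trivial).elim
      | cls Y hY =>
        have : X = Y := Set.ext fun x => toObj_mem_iff.symm.trans ((h x).trans toObj_mem_iff)
        subst this
        rfl
  isClass_iff X := by
    constructor
    · exact fun hX => ⟨.cls X hX, id, fun x => (toObj_mem_iff (m := .cls X hX)).symm⟩
    · rintro ⟨m, -, h⟩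
      convert isClass_members m using 1
      ext x
      exact (h x).trans toObj_mem_iff
  small_pair := Universe.pairing

/-! #### Comprehension -/

/-- A function to the objects that is constant or given by a definable function to the elements -/
def Tracked {α : Type} [Coded N α] (k : α → Obj S) : Prop :=
  (∃ m, ∀ a, k a = m) ∨ ∃ g : α → N, DefFun N g ∧ ∀ a, k a = toObj S (g a)

section

variable {α β : Type} [Coded N α] [Coded N β] {k l : α → Obj S}

theorem Tracked.comp (h : Tracked k) (f : β → α) [DefFun N f] : Tracked fun a => k (f a) := by
  rcases h with ⟨m, hm⟩ | ⟨g, hg, h⟩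
  · exact .inl ⟨m, fun a => hm _⟩
  · exact .inr ⟨fun a => g (f a), hg.comp, fun a => h _⟩

/-- The function is constant or runs through elements definably. A constant value may be a proper
class, and then the condition fails throughout. -/
theorem Tracked.def_exists (h : Tracked k) {P : α → N → Prop}
    (hP : Def N (fun p : α × N => P p.1 p.2)) : Def N (fun a => ∃ x, k a = toObj S x ∧ P a x) := by
  rcases h with ⟨m, hm⟩ | ⟨g, hg, h⟩
  · by_cases hx : ∃ x, m = toObj S x
    · obtain ⟨x, rfl⟩ := hx
      refine Def.congr (hP.comp₂ (fun a : α => a) fun _ => x) fun a => ?_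
      simp only [hm, toObj_injective.eq_iff, exists_eq_left']
    · refine Def.congr (Def.const False) fun a => ⟨?_, False.elim⟩
      rintro ⟨x, h, -⟩
      exact hx ⟨x, (hm a).symm.trans h⟩
  · refine Def.congr (hP.comp₂ (fun a : α => a) g) fun a => ?_
    simp only [h, toObj_injective.eq_iff, exists_eq_left']

theorem Tracked.def_mem_members (h : Tracked k) {g : α → N} (hg : DefFun N g) :
    Def N (fun a => g a ∈ (k a).members) := by
  rcases h with ⟨m, hm⟩ | ⟨g', hg', h⟩
  · simp only [hm]
    exact Def.of_isClass_mem (isClass_members m)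
  · simp only [h, mem_members_toObj]
    infer_instance

theorem Tracked.def_mem (hk : Tracked k) (hl : Tracked l) :
    Def N (fun a => Mem true (k a) (l a)) :=
  hk.def_exists (P := fun a x => x ∈ (l a).members)
    ((hl.comp (fun p : α × N => p.1)).def_mem_members inferInstance)

theorem Tracked.def_ind (hk : Tracked k) : Def N (fun a => Ind true (k a)) := by
  rcases hk with ⟨m, hm⟩ | ⟨g, hg, h⟩
  · simp only [hm]
    infer_instance
  · simp only [h, obj_ind_iff, isAtom_toObj]
    infer_instance

theorem Tracked.def_eq (hk : Tracked k) (hl : Tracked l) : Def N (fun a => k a = l a) := by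
  have key : ∀ {k l : α → Obj S}, Tracked k → (∃ g : α → N, DefFun N g ∧ ∀ a, l a = toObj S (g a)) →
      Def N (fun a => k a = l a) := by
    rintro k l hk ⟨g, hg, h⟩
    have hg' : DefFun N (fun p : α × N => g p.1) := hg.comp
    refine Def.congr (hk.def_exists (P := fun a x => x = g a) inferInstance) fun a => ?_
    simp [h]
  rcases hl with ⟨m, hm⟩ | hl
  · rcases hk with ⟨m', hm'⟩ | hk
    · simp only [hm, hm']
      infer_instance
    · exact (key (.inl ⟨m, hm⟩) hk).congr fun a => eq_comm
  · exact key hk hl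

theorem Tracked.def_skandRel (hS : Def N (fun p : N × N => S p.1 p.2)) (hk : Tracked k)
    (hl : Tracked l) : Def N (fun a => SkandRel (k a) (l a)) := by
  have h₁ : Def N (fun p : (α × N) × N => S p.1.2 p.2) :=
    hS.comp₂ (fun p : (α × N) × N => p.1.2) fun p => p.2
  have h₂ := (hl.comp (fun p : α × N => p.1)).def_exists (P := fun p x => S p.2 x) h₁
  refine (hk.def_exists (P := fun a f => ∃ x, l a = toObj S x ∧ S f x) h₂).congr fun a => ?_
  rw [skandRel_iff]
  simp only [exists_and_left]

end

/-- Formulas with restricted quantifiers define classes. -/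
theorem def_realize_restrict (hS : Def N (fun p : N × N => S p.1 p.2)) {n : ℕ}
    (φ : (lang true).BoundedFormula ℕ n) {α : Type} [Coded N α] (v : α → ℕ → Obj S)
    (xs : α → Fin n → Obj S) (hv : ∀ i, Tracked fun a => v a i)
    (hxs : ∀ i, Tracked fun a => xs a i) :
    Def N (fun a => (restrict φ).Realize (v a) (xs a)) := by
  induction φ generalizing α with
  | falsum => exact Def.const False
  | @equal n s t =>
    obtain ⟨s, rfl⟩ := term_eq_var s
    obtain ⟨t, rfl⟩ := term_eq_var t
    have hst : ∀ r : ℕ ⊕ Fin n, Tracked fun a => Sum.elim (v a) (xs a) r := by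
      rintro (i | i)
      exacts [hv i, hxs i]
    exact (hst s).def_eq (hst t)
  | @rel n l R ts =>
    choose r hr using fun i => term_eq_var (ts i)
    obtain rfl : ts = fun i => Term.var (r i) := funext hr
    have hst : ∀ r : ℕ ⊕ Fin n, Tracked fun a => Sum.elim (v a) (xs a) r := by
      rintro (i | i)
      exacts [hv i, hxs i]
    cases (R : Sym true l) with
    | mem => exact (hst (r 0)).def_mem (hst (r 1))
    | ind => exact (hst (r 0)).def_ind
    | skand _ => exact (hst (r 0)).def_skandRel hS (hst (r 1))
  | imp φ ψ ih₁ ih₂ =>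
    have h₁ := ih₁ v xs hv hxs
    have h₂ := ih₂ v xs hv hxs
    exact Def.imp _ _
  | @all n φ ih =>
    -- A restricted quantifier ranges over elements, so the new bound variable is tracked by the
    -- second projection.
    have h := ih (α := α × N) (fun p => v p.1) (fun p => Fin.snoc (xs p.1) (toObj S p.2))
      (fun i => (hv i).comp fun p : α × N => p.1) fun i => by
        refine Fin.lastCases ?_ (fun i => ?_) i
        · simp only [Fin.snoc_last]
          exact .inr ⟨fun p => p.2, inferInstance, fun _ => rfl⟩
        · simp only [Fin.snoc_castSucc]
          exact (hxs i).comp fun p : α × N => p.1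
    refine Def.congr (P := fun a => ∀ x, (restrict φ).Realize (v a) (Fin.snoc (xs a) (toObj S x)))
      (Def.forall _) fun a => ?_
    rw [realize_restrict_all]
    constructor
    · exact fun H x => H _ ((presents_toObj S).exists_mem x)
    · intro H m hm
      obtain ⟨x, rfl⟩ := (presents_toObj S).exists_mem_iff.1 hm
      exact H x

/-- Parameters, which may be proper classes, are tracked as constants; only the value of `x` varies,
and it varies over elements. -/
theorem obj_comprehension (hS : Def N (fun p : N × N => S p.1 p.2)) {ψ : Fm true}
    (hψ : ψ ∈ (comprehension : Set (Fm true))) (v : ℕ → Obj S) : ψ.Realize v := by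
  obtain ⟨φ, x, z, hzx, hz, rfl⟩ := hψ
  have h := presents_toObj S
  simp only [realize_ex_named, realize_all_named, Formula.realize_inf, realize_cls, realize_iff',
    realize_mem, h.realize_elem, Function.update_self, Function.update_of_ne hzx]
  have hD : Def N (fun y => (restrict φ).Realize (Function.update v x (toObj S y)) default) := by
    refine def_realize_restrict hS φ (fun y => Function.update v x (toObj S y)) (fun _ => default)
      (fun i => ?_) fun i => i.elim0
    by_cases hi : i = x
    · subst hi
      simp only [Function.update_self]
      exact .inr ⟨fun y => y, inferInstance, fun _ => rfl⟩
    · simp only [Function.update_of_ne hi]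
      exact .inl ⟨v i, fun _ => rfl⟩
  refine ⟨.cls _ hD.isClass, id, fun m => ?_⟩
  have key : ∀ y k, Formula.Realize (restrict φ)
      (Function.update (Function.update v z k) x (toObj S y)) ↔
      (restrict φ).Realize (Function.update v x (toObj S y)) default := fun y k => by
    rw [Function.update_comm hzx]
    exact realize_update_of_notMem fun h' => hz (freeVarFinset_restrict φ h')
  constructor
  · rintro ⟨y, rfl, hy⟩
    exact ⟨⟨y, rfl⟩, (key y _).2 hy⟩
  · rintro ⟨⟨y, rfl⟩, hy⟩
    exact ⟨y, rfl, (key y _).1 hy⟩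

theorem obj_common (hS : Def N (fun p : N × N => S p.1 p.2)) {u : Bool}
    (hu : (∃ x : N, Atom x) ↔ u = true) {φ : Fm true} (hφ : φ ∈ common u) (v : ℕ → Obj S) :
    φ.Realize v := by
  have h := presents_toObj S
  rcases hφ with hφ | hφ
  · simp only [Set.mem_insert_iff, Set.mem_singleton_iff] at hφ
    rcases hφ with rfl | rfl | rfl | rfl | rfl | rfl | rfl | rfl
    · exact h.realize_existence.2 hu
    · simp (disch := omega) only [individuals, realize_all_named, Formula.realize_imp,
        Formula.realize_inf, realize_ind, h.realize_elem, Formula.realize_not, realize_nonempty,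
        Function.update_self]
      exact fun m hm => ⟨h.of_ind hm, fun ⟨k, hk⟩ => h.not_mem hm hk⟩
    · exact h.realize_pairing
    · exact h.realize_union.2 fun _ => Universe.union
    · exact h.realize_power.2 fun _ => Universe.power
    · exact h.realize_replacement.2 fun _ _ => Universe.replacement
    · exact h.realize_infinity.2 Universe.infinity
    · exact h.realize_choice.2 Universe.choice
  · exact obj_comprehension hS hφ v

end Obj

end Skands

namespace Skands

open FirstOrder FirstOrder.Language ClassTheory
open MemStructure (Atom IsClass)

/-! ### The formulas about skands -/

theorem realize_skand {M : Type} [(lang true).Structure M] {v : ℕ → M} {f x : ℕ} :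
    (skand f x).Realize v ↔ SkandRel (v f) (v x) := by
  exact Formula.realize_rel₂

/-- The systems `f` and `g` agree along an isomorphism `k` of their index segments. -/
def SimilarIn {N : Type} [MemStructure N] (f g : N) : Prop :=
  ∃ a c a' c' k, SystemIn f a c ∧ SystemIn g a' c' ∧ ¬ Atom k ∧
    (∀ x y z, pair x y ∊ k → pair x z ∊ k → y = z) ∧
    (∀ x y z, pair x z ∊ k → pair y z ∊ k → x = y) ∧
    (∀ x, ((x = a ∨ a ∊ x) ∧ x ∊ c) ↔ ∃ y, pair x y ∊ k) ∧
    (∀ y, ((y = a' ∨ a' ∊ y) ∧ y ∊ c') ↔ ∃ x, pair x y ∊ k) ∧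
    (∀ x y x' y', pair x y ∊ k → pair x' y' ∊ k → (x ∊ x' ↔ y ∊ y')) ∧
    ∀ x y, pair x y ∊ k → ∀ w, pair x w ∊ f ↔ pair y w ∊ g

namespace Presents

variable {M N : Type} [(lang true).Structure M] [MemStructure N] {ι : N → M}
  {v : ℕ → M} {x y z f p s a c g : ℕ}

/-- Here and in the following lemmas, quantifiers over all objects become quantifiers over elements.
Nothing is lost: each quantified object is required to be a set, a member of something, or an entry
of an ordered pair. -/
theorem realize_ord (h : Presents true ι) :
    (ord a : Fm true).Realize v ↔ ∃ d, v a = ι d ∧ OrdIn d := by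
  simp (disch := omega) only [ord, realize_all_named, realize_ex_named, Formula.realize_imp,
    Formula.realize_inf, Formula.realize_sup, Formula.realize_not, h.realize_set, realize_mem,
    realize_nonempty, realize_sub, realize_eq, Function.update_self, Function.update_of_ne]
  constructor
  · rintro ⟨⟨⟨d, hd, hA⟩, ht⟩, hm⟩
    rw [hd] at ht hm
    simp only [h.forall_mem_iff, h.inj_iff, exists_eq_left', h.mem_iff] at ht
    refine ⟨d, hd, hA, ht, fun s hs hsd hne => ?_⟩
    obtain ⟨m, hm, hmin⟩ := hm (ι s) ⟨⟨⟨s, rfl, hs⟩, by simpa only [h.forall_mem_iff, h.mem_iff]⟩,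
      h.exists_mem_ι.2 hne⟩
    obtain ⟨m, rfl⟩ := h.of_mem hm
    simp only [h.forall_mem_iff, h.mem_iff, h.inj_iff] at hm hmin
    exact ⟨m, hm, hmin⟩
  · rintro ⟨d, hd, hA, ht, hm⟩
    rw [hd]
    simp only [h.forall_mem_iff, h.inj_iff, exists_eq_left', h.mem_iff]
    refine ⟨⟨hA, ht⟩, ?_⟩
    rintro _ ⟨⟨⟨s, rfl, hs⟩, hsd⟩, hne⟩
    simp only [h.forall_mem_iff, h.mem_iff, h.exists_mem_ι] at hsd hne
    simp only [h.exists_mem_and_iff, h.forall_mem_iff, h.mem_iff, h.inj_iff]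
    exact hm s hs hsd hne

theorem realize_wfSet (h : Presents true ι) :
    (wfSet x : Fm true).Realize v ↔ ∃ d, v x = ι d ∧ ¬ Atom d ∧ WfIn d := by
  simp (disch := omega) only [wfSet, wf, realize_all_named, realize_ex_named, Formula.realize_imp,
    Formula.realize_inf, Formula.realize_not, h.realize_set, realize_mem, Function.update_self,
    Function.update_of_ne]
  constructor
  · rintro ⟨⟨d, hd, hA⟩, hw⟩
    refine ⟨d, hd, hA, fun s hs hds => ?_⟩
    have := hw (ι s) ⟨⟨s, rfl, hs⟩, by rwa [hd, h.mem_iff]⟩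
    simpa only [h.exists_mem_and_iff, h.forall_mem_iff, h.mem_iff] using this
  · rintro ⟨d, hd, hA, hw⟩
    refine ⟨⟨d, hd, hA⟩, ?_⟩
    rintro _ ⟨⟨s, rfl, hs⟩, hds⟩
    rw [hd, h.mem_iff] at hds
    simpa only [h.exists_mem_and_iff, h.forall_mem_iff, h.mem_iff] using hw s hs hds

theorem forall_seg_iff (h : Presents true ι) {a c : N} {P : M → Prop}
    (hP : ∀ m, P m → ∃ x, m = ι x) :
    (∀ m, ((m = ι a ∨ Mem true (ι a) m) ∧ Mem true m (ι c)) ↔ P m) ↔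
      ∀ x, ((x = a ∨ a ∊ x) ∧ x ∊ c) ↔ P (ι x) := by
  constructor
  · intro H x
    simpa only [h.mem_iff, h.inj_iff] using H (ι x)
  · refine fun H m => ⟨fun hm => ?_, fun hm => ?_⟩
    · obtain ⟨x, rfl⟩ := h.of_mem hm.2
      simpa only [h.mem_iff, h.inj_iff, H] using hm
    · obtain ⟨x, rfl⟩ := hP m hm
      simpa only [h.mem_iff, h.inj_iff, H] using hm

theorem realize_system (h : Presents true ι) : (system f a c).Realize v ↔
    ∃ f' a' c', v f = ι f' ∧ v a = ι a' ∧ v c = ι c' ∧ SystemIn f' a' c' := by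
  simp (disch := omega) only [system, seg, realize_all_named, realize_ex_named,
    Formula.realize_imp, Formula.realize_inf, Formula.realize_sup, realize_iff', h.realize_set,
    h.realize_ord, realize_mem, h.realize_opair, h.realize_functional, realize_eq, h.realize_app,
    h.realize_wfSet, Function.update_self, Function.update_of_ne]
  have key : ∀ f' a' c' : N,
      (∀ m, ((m = ι a' ∨ Mem true (ι a') m) ∧ Mem true m (ι c')) ↔
        ∃ k, ∃ d e, m = ι d ∧ k = ι e ∧ Mem true (ι (pair d e)) (ι f')) ↔
      ∀ x, ((x = a' ∨ a' ∊ x) ∧ x ∊ c') ↔ ∃ y, pair x y ∊ f' := by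
    intro f' a' c'
    rw [h.forall_seg_iff fun m ⟨_, d, _, hd, _⟩ => ⟨d, hd⟩]
    simp [h.inj_iff, h.mem_iff]
  constructor
  · rintro ⟨⟨⟨⟨⟨⟨⟨⟨f', hf, hA⟩, a', ha, hoa⟩, c', hc, hoc⟩, hac⟩, hp⟩, hu⟩, hD⟩, hv⟩
    rw [hf, ha, hc, key] at hD
    simp only [hf, ha, hc, h.mem_iff, h.forall_mem_iff, h.inj_iff] at hac hp hu hv
    refine ⟨f', a', c', hf, ha, hc, hA, hoa, hoc, hac, fun p hp' => ?_, hu, hD, fun x y hxy => ?_⟩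
    · obtain ⟨_, _, d, e, -, -, rfl⟩ := hp p hp'
      exact ⟨d, e, rfl⟩
    · obtain ⟨d, hd, hd'⟩ := hv (ι x) (ι y) ⟨x, y, rfl, rfl, hxy⟩
      rwa [h.inj _ _ hd]
  · rintro ⟨f', a', c', hf, ha, hc, hA, hoa, hoc, hac, hp, hu, hD, hv⟩
    rw [hf, ha, hc, key]
    simp only [h.mem_iff, h.forall_mem_iff]
    refine ⟨⟨⟨⟨⟨⟨⟨⟨f', rfl, hA⟩, a', rfl, hoa⟩, c', rfl, hoc⟩, hac⟩, fun p hp' => ?_⟩, hu⟩, hD⟩, ?_⟩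
    · obtain ⟨d, e, rfl⟩ := hp p hp'
      exact ⟨_, _, d, e, rfl, rfl, rfl⟩
    · rintro _ _ ⟨x, y, rfl, rfl, hxy⟩
      exact ⟨y, rfl, hv x y hxy⟩

theorem realize_isSystem (h : Presents true ι) : (isSystem f).Realize v ↔
    ∃ f' a c, v f = ι f' ∧ SystemIn f' a c := by
  simp (disch := omega) only [isSystem, realize_ex_named, h.realize_system, Function.update_self,
    Function.update_of_ne]
  constructor
  · rintro ⟨_, _, f', a', c', hf, -, -, hs⟩
    exact ⟨f', a', c', hf, hs⟩
  · rintro ⟨f', a', c', hf, hs⟩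
    exact ⟨_, _, f', a', c', hf, rfl, rfl, hs⟩

theorem realize_longSystem (h : Presents true ι) : (longSystem f).Realize v ↔
    ∃ f' a c, v f = ι f' ∧ SystemIn f' a c ∧ LongIn a c := by
  simp (disch := omega) only [longSystem, realize_ex_named, realize_all_named, h.realize_system,
    Formula.realize_inf, Formula.realize_sup, Formula.realize_imp, realize_mem, realize_eq,
    h.realize_ord, Function.update_self, Function.update_of_ne]
  constructor
  · rintro ⟨_, _, ⟨f', a', c', hf, rfl, rfl, hs⟩, _, ⟨⟨⟨l, rfl, hl⟩, hal⟩, hlc⟩, hlim⟩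
    simp only [h.forall_mem_iff, h.exists_mem_and_iff, h.mem_iff, h.inj_iff] at hal hlc hlim
    exact ⟨f', a', c', hf, hs, l, hl, hal, hlc, hlim⟩
  · rintro ⟨f', a', c', hf, hs, l, hl, hal, hlc, hlim⟩
    refine ⟨_, _, ⟨f', a', c', hf, rfl, rfl, hs⟩, ι l, ⟨⟨⟨l, rfl, hl⟩, ?_⟩, ?_⟩, ?_⟩
    · exact (h.mem_iff _ _).2 hal
    · simpa only [h.mem_iff, h.inj_iff]
    · simpa only [h.forall_mem_iff, h.exists_mem_and_iff, h.mem_iff]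

theorem realize_similar (h : Presents true ι) : (similar f g).Realize v ↔
    ∃ f' g', v f = ι f' ∧ v g = ι g' ∧ SimilarIn f' g' := by
  simp (disch := omega) only [similar, seg, realize_ex_named, realize_all_named, h.realize_system,
    Formula.realize_inf, Formula.realize_sup, Formula.realize_imp, realize_mem, realize_eq,
    realize_iff', h.realize_set, h.realize_functional, h.realize_injective, h.realize_app,
    Function.update_self, Function.update_of_ne]
  have keyD : ∀ f' a' c' : N,
      (∀ m, ((m = ι a' ∨ Mem true (ι a') m) ∧ Mem true m (ι c')) ↔
        ∃ k, ∃ d e, m = ι d ∧ k = ι e ∧ Mem true (ι (pair d e)) (ι f')) ↔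
      ∀ x, ((x = a' ∨ a' ∊ x) ∧ x ∊ c') ↔ ∃ y, pair x y ∊ f' := by
    intro f' a' c'
    rw [h.forall_seg_iff fun m ⟨_, d, _, hd, _⟩ => ⟨d, hd⟩]
    simp [h.inj_iff, h.mem_iff]
  have keyR : ∀ f' a' c' : N,
      (∀ m, ((m = ι a' ∨ Mem true (ι a') m) ∧ Mem true m (ι c')) ↔
        ∃ k, ∃ d e, k = ι d ∧ m = ι e ∧ Mem true (ι (pair d e)) (ι f')) ↔
      ∀ x, ((x = a' ∨ a' ∊ x) ∧ x ∊ c') ↔ ∃ y, pair y x ∊ f' := by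
    intro f' a' c'
    rw [h.forall_seg_iff fun m ⟨_, _, e, _, he, _⟩ => ⟨e, he⟩]
    simp [h.inj_iff, h.mem_iff]
  constructor
  · rintro ⟨_, _, _, _, _, ⟨⟨⟨⟨⟨⟨⟨⟨f', a', c', hf, rfl, rfl, hs⟩, g', a'', c'', hg, rfl, rfl, hs'⟩,
      k, rfl, hA⟩, hu⟩, hi⟩, hD⟩, hR⟩, ho⟩, hc⟩
    rw [keyD] at hD
    rw [keyR] at hR
    simp only [h.mem_iff] at hu hi
    refine ⟨f', g', hf, hg, a', c', a'', c'', k, hs, hs', hA, hu, hi, hD, hR, ?_, ?_⟩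
    · intro x y x' y' hxy hxy'
      have := ho (ι x) (ι y) (ι x') (ι y') ⟨⟨x, y, rfl, rfl, (h.mem_iff _ _).2 hxy⟩,
        ⟨x', y', rfl, rfl, (h.mem_iff _ _).2 hxy'⟩⟩
      simpa only [h.mem_iff] using this
    · intro x y hxy w
      have := hc (ι x) (ι y) ⟨x, y, rfl, rfl, (h.mem_iff _ _).2 hxy⟩ (ι w)
      simpa [h.mem_iff, h.inj_iff, hf, hg] using this
  · rintro ⟨f', g', hf, hg, a', c', a'', c'', k, hs, hs', hA, hu, hi, hD, hR, ho, hc⟩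
    refine ⟨_, _, _, _, _, ⟨⟨⟨⟨⟨⟨⟨⟨f', a', c', hf, rfl, rfl, hs⟩, g', a'', c'', hg, rfl, rfl, hs'⟩,
      k, rfl, hA⟩, ?_⟩, ?_⟩, (keyD _ _ _).2 hD⟩, (keyR _ _ _).2 hR⟩, ?_⟩, ?_⟩
    · simpa only [h.mem_iff]
    · simpa only [h.mem_iff]
    · rintro _ _ _ _ ⟨⟨x, y, rfl, rfl, hxy⟩, ⟨x', y', rfl, rfl, hxy'⟩⟩
      rw [h.mem_iff] at hxy hxy'
      simpa only [h.mem_iff] using ho x y x' y' hxy hxy'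
    · rintro _ _ ⟨x, y, rfl, rfl, hxy⟩ m
      rw [h.mem_iff] at hxy
      rw [hf, hg]
      constructor
      · rintro ⟨d, e, hd, rfl, hde⟩
        obtain rfl := h.inj _ _ hd
        rw [h.mem_iff, hc _ _ hxy] at hde
        exact ⟨y, e, rfl, rfl, (h.mem_iff _ _).2 hde⟩
      · rintro ⟨d, e, hd, rfl, hde⟩
        obtain rfl := h.inj _ _ hd
        rw [h.mem_iff, ← hc _ _ hxy] at hde
        exact ⟨x, e, rfl, rfl, (h.mem_iff _ _).2 hde⟩

theorem realize_longSkand (h : Presents true ι) : (longSkand x).Realize v ↔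
    ∃ f a c, SystemIn f a c ∧ LongIn a c ∧ SkandRel (ι f) (v x) := by
  simp (disch := omega) only [longSkand, realize_ex_named, h.realize_longSystem,
    Formula.realize_inf, realize_skand, Function.update_self, Function.update_of_ne]
  constructor
  · rintro ⟨_, ⟨f, a, c, rfl, hs, hl⟩, hr⟩
    exact ⟨f, a, c, hs, hl, hr⟩
  · rintro ⟨f, a, c, hs, hl, hr⟩
    exact ⟨_, ⟨f, a, c, rfl, hs, hl⟩, hr⟩

end Presents

end Skands

namespace Skands

open FirstOrder FirstOrder.Language ClassTheory
open MemStructure (Atom IsClass)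
open Marked (mark atom_mark)

set_option synthInstance.maxHeartbeats 1000000
set_option synthInstance.maxSize 2000

section

variable {V : Type} [Universe V] [Founded V] [Marked V]

/-! ### Similarity in the universe with skands -/

theorem pair_mem_iff_of_tame {x y k : SkandUniverse V} (hk : Tame k.1) :
    pair x y ∊ k ↔ pair x.1 y.1 ∊ k.1 := by
  constructor
  · intro h
    obtain ⟨hx, hy⟩ := SkandUniverse.tame_of_tame_pair (SkandUniverse.tame_of_mem hk h)
    rwa [SkandUniverse.pair_mem_iff hx hy, members_of_not_skandCode hk.not_skandCode] at h
  · intro h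
    obtain ⟨hx, hy⟩ := tame_pair.1 (hk.of_mem h)
    rwa [SkandUniverse.pair_mem_iff hx hy, members_of_not_skandCode hk.not_skandCode]

theorem seg_iff {x a c : SkandUniverse V} (hc : IsOrd c.1) :
    ((x = a ∨ a ∊ x) ∧ x ∊ c) ↔ Le a.1 x.1 ∧ x.1 ∊ c.1 := by
  rw [SkandUniverse.mem_iff_of_tame hc.tame]
  refine and_congr_left fun hx => ?_
  rw [SkandUniverse.mem_iff_of_tame (hc.of_mem hx).tame]
  exact or_congr_left ⟨congrArg _, Interp.Carrier.ext⟩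

/-- Similarity is equality of normal forms. From left to right the isomorphism is an arbitrary set
of the universe with skands, of which only the pairs of indices matter. From right to left it is
built in the ground universe and is tame, hence a set of the new universe. -/
theorem similarIn_iff {f g a c a' c' : SkandUniverse V} (hf : SystemIn f a c)
    (hg : SystemIn g a' c') : SimilarIn f g ↔ hat a.1 f.1 = hat a'.1 g.1 := by
  have hf' := SkandUniverse.systemIn_iff.1 hf
  have hg' := SkandUniverse.systemIn_iff.1 hg
  constructor
  · rintro ⟨b, d, b', d', k, hs, hs', hA, hu, hi, hD, hR, ho, hc⟩
    obtain ⟨e₁, e₂⟩ := hf'.endpoints_unique (SkandUniverse.systemIn_iff.1 hs)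
    obtain ⟨e₃, e₄⟩ := hg'.endpoints_unique (SkandUniverse.systemIn_iff.1 hs')
    obtain rfl := Interp.Carrier.ext e₁
    obtain rfl := Interp.Carrier.ext e₂
    obtain rfl := Interp.Carrier.ext e₃
    obtain rfl := Interp.Carrier.ext e₄
    have tf : ∀ {x}, x ∊ c.1 → Tame x := fun hx => (hf'.right.of_mem hx).tame
    have tg : ∀ {x}, x ∊ c'.1 → Tame x := fun hx => (hg'.right.of_mem hx).tame
    have key : ∀ {x y} (hx : Tame x) (hy : Tame y), pair x y ∊ members k.1 ↔
        pair (SkandUniverse.ofTame x hx) (SkandUniverse.ofTame y hy) ∊ k := fun hx hy =>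
      (SkandUniverse.pair_mem_iff (x := SkandUniverse.ofTame _ hx)
        (y := SkandUniverse.ofTame _ hy) hx hy).symm
    refine hat_eq_of_similar hf' hg' (members k.1) ?_ ?_ ?_ ?_
    · intro x hax hxc
      obtain ⟨y, hy⟩ := (hD (SkandUniverse.ofTame x (tf hxc))).1
        ((seg_iff hf'.right).2 ⟨hax, hxc⟩)
      have := (seg_iff hg'.right).1 ((hR y).2 ⟨_, hy⟩)
      exact ⟨y.1, this.1, this.2, (key (tf hxc) (tg this.2)).2 hy⟩
    · intro y hay hyc
      obtain ⟨x, hx⟩ := (hR (SkandUniverse.ofTame y (tg hyc))).1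
        ((seg_iff hg'.right).2 ⟨hay, hyc⟩)
      have := (seg_iff hf'.right).1 ((hD x).2 ⟨_, hx⟩)
      exact ⟨x.1, this.1, this.2, (key (tf this.2) (tg hyc)).2 hx⟩
    · intro x y x' y' _ hx _ hy _ hx' _ hy' h h'
      have := ho _ _ _ _ ((key (tf hx) (tg hy)).1 h) ((key (tf hx') (tg hy')).1 h')
      rwa [SkandUniverse.mem_iff_of_tame (tf hx'), SkandUniverse.mem_iff_of_tame (tg hy')] at this
    · intro x y _ hx _ hy h w
      have := hc _ _ ((key (tf hx) (tg hy)).1 h)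
      simp only [pair_mem_iff_of_tame hf'.tame, pair_mem_iff_of_tame hg'.tame] at this
      exact ⟨fun hw => (this (SkandUniverse.ofTame w (hf'.value _ _ hw).2)).1 hw,
        fun hw => (this (SkandUniverse.ofTame w (hg'.value _ _ hw).2)).2 hw⟩
  · intro h
    obtain ⟨k, hA, hk, hkp, hD, hR, hc⟩ := exists_similar hf' hg' h
    refine ⟨a, c, a', c', SkandUniverse.ofTame k hk, hf, hg, mt SkandUniverse.atom_iff.1 hA, ?_⟩
    simp only [pair_mem_iff_of_tame (k := SkandUniverse.ofTame k hk) hk,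
      pair_mem_iff_of_tame hf'.tame, pair_mem_iff_of_tame hg'.tame, seg_iff hf'.right,
      seg_iff hg'.right]
    have of : ∀ {x}, x ∊ c.1 → IsOrd x := fun hx => hf'.right.of_mem hx
    have og : ∀ {x}, x ∊ c'.1 → IsOrd x := fun hx => hg'.right.of_mem hx
    refine ⟨fun x y z h₁ h₂ => ?_, fun x y z h₁ h₂ => ?_, fun x => ⟨fun hx => ?_, ?_⟩,
      fun y => ⟨fun hy => ?_, ?_⟩, fun x y x' y' h₁ h₂ => ?_, fun x y h w => hc _ _ h _⟩
    · obtain ⟨-, hy, e⟩ := (hkp _ _).1 h₁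
      obtain ⟨-, hz, e'⟩ := (hkp _ _).1 h₂
      exact Interp.Carrier.ext (col_injective (og hy.2) (og hz.2) hy.1 hz.1 (e.symm.trans e'))
    · obtain ⟨hx, -, e⟩ := (hkp _ _).1 h₁
      obtain ⟨hy, -, e'⟩ := (hkp _ _).1 h₂
      exact Interp.Carrier.ext (col_injective (of hx.2) (of hy.2) hx.1 hy.1 (e.trans e'.symm))
    · obtain ⟨y, hy⟩ := hD x.1 hx.1 hx.2
      exact ⟨SkandUniverse.ofTame y (og ((hkp _ _).1 hy).2.1.2).tame, hy⟩
    · exact fun ⟨y, hy⟩ => ((hkp _ _).1 hy).1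
    · obtain ⟨x, hx⟩ := hR y.1 hy.1 hy.2
      exact ⟨SkandUniverse.ofTame x (of ((hkp _ _).1 hx).1.2).tame, hx⟩
    · exact fun ⟨y, hy⟩ => ((hkp _ _).1 hy).2.1
    · obtain ⟨hx, hy, e⟩ := (hkp _ _).1 h₁
      obtain ⟨hx', hy', e'⟩ := (hkp _ _).1 h₂
      rw [SkandUniverse.mem_iff_of_tame (of hx'.2).tame,
        SkandUniverse.mem_iff_of_tame (og hy'.2).tame,
        ← col_mem_col_iff (of hx.2) (of hx'.2) hx.1 hx'.1,
        ← col_mem_col_iff (og hy.2) (og hy'.2) hy.1 hy'.1, e, e']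

/-! ### The axioms about skands -/

/-- Being the skand of a system of components in the universe with skands -/
def SkandOf (f x : SkandUniverse V) : Prop :=
  IsSkand f.1 x.1

/-- Needed because the symbol for skands may occur in comprehension formulas. -/
theorem def_skandOf :
    Def (SkandUniverse V) (fun p : SkandUniverse V × SkandUniverse V => SkandOf p.1 p.2) := by
  refine Interp.def₂_of (I := skandInterp V) (P := SkandOf)
    (Def.congr (P := fun p : V × V => IsCode p.1 ∧ IsCode p.2 ∧ IsSkand p.1 p.2) inferInstance
      fun p => ⟨?_, ?_⟩)
  · rintro ⟨h, h', h''⟩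
    exact ⟨h, h', h''⟩
  · rintro ⟨h, h', h''⟩
    exact ⟨h, h', h''⟩

theorem skandRel_toObj {f x : SkandUniverse V} :
    SkandRel (toObj SkandOf f) (toObj SkandOf x) ↔ IsSkand f.1 x.1 := by
  rw [skandRel_iff]
  constructor
  · rintro ⟨f', x', hf, hx, h⟩
    rw [toObj_injective hf, toObj_injective hx]
    exact h
  · exact fun h => ⟨f, x, rfl, rfl, h⟩

variable {v : ℕ → Obj (SkandOf (V := V))}

theorem realize_vonNeumann : vonNeumann.Realize v := by
  have h := presents_toObj (SkandOf (V := V))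
  obtain ⟨R, hR, hu, hi, hD, hO⟩ := SkandUniverse.exists_bijection (V := V)
  have hX : IsClass {p : SkandUniverse V | ∃ x a, R x a ∧ p = pair x a} := by
    have h₁ {α : Type} [Coded (SkandUniverse V) α] (f g : α → SkandUniverse V)
        [DefFun (SkandUniverse V) f] [DefFun (SkandUniverse V) g] :
        Def (SkandUniverse V) (fun a => R (f a) (g a)) := hR.comp₂ f g
    exact Def.isClass (P := fun p : SkandUniverse V => ∃ x a, R x a ∧ p = pair x a) inferInstance
  obtain ⟨m, hm, hmX⟩ := (h.isClass_iff _).1 hX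
  have hmR : ∀ x a, Mem true (toObj SkandOf (pair x a)) m ↔ R x a := by
    intro x a
    rw [← hmX]
    constructor
    · rintro ⟨x', a', hR, e⟩
      obtain ⟨rfl, rfl⟩ := pair_injective e
      exact hR
    · exact fun hR => ⟨x, a, hR, rfl⟩
  simp (disch := omega) only [vonNeumann, realize_ex_named, realize_all_named, Formula.realize_inf,
    realize_cls, h.realize_functional, h.realize_injective, realize_iff', h.realize_set,
    h.realize_ord, h.realize_app, Function.update_self, Function.update_of_ne]
  refine ⟨m, ⟨⟨⟨hm, ?_⟩, ?_⟩, fun k => ⟨?_, ?_⟩⟩, fun k => ⟨?_, ?_⟩⟩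
  · simpa only [hmR] using hu
  · simpa only [hmR] using hi
  · rintro ⟨x, rfl, hx⟩
    obtain ⟨a, ha⟩ := (hD x).1 hx
    exact ⟨_, x, a, rfl, rfl, (hmR _ _).2 ha⟩
  · rintro ⟨_, x, a, rfl, rfl, ha⟩
    exact ⟨x, rfl, (hD x).2 ⟨a, (hmR _ _).1 ha⟩⟩
  · rintro ⟨a, rfl, ha⟩
    obtain ⟨x, hx⟩ := (hO a).1 ha
    exact ⟨_, x, a, rfl, rfl, (hmR _ _).2 hx⟩
  · rintro ⟨_, x, a, rfl, rfl, ha⟩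
    exact ⟨a, rfl, (hO a).2 ⟨x, (hmR _ _).1 ha⟩⟩

theorem realize_skandExistence : skandExistence.Realize v := by
  have h := presents_toObj (SkandOf (V := V))
  simp (disch := omega) only [skandExistence, realize_ex_named, realize_all_named,
    Formula.realize_inf, Formula.realize_imp, h.realize_isSystem, realize_skand, h.realize_set,
    realize_eq, Function.update_self, Function.update_of_ne]
  refine ⟨⟨?_, ?_⟩, ?_⟩
  · rintro _ ⟨f, a, c, rfl, hf⟩
    obtain ⟨x, hx, -⟩ := (SkandUniverse.systemIn_iff.1 hf).existsUnique_isSkand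
    exact ⟨toObj SkandOf ⟨x, hx.isCode.1⟩, skandRel_toObj.2 hx⟩
  · rintro _ _ ⟨f, x, rfl, rfl, hx⟩
    refine ⟨?_, x, rfl, mt SkandUniverse.atom_iff.1 (IsSkand.isCode hx).2⟩
    have ⟨a, c, hf, _⟩ := hx
    exact ⟨f, SkandUniverse.ofTame a hf.left.tame, SkandUniverse.ofTame c hf.right.tame, rfl,
      SkandUniverse.systemIn_iff.2 hf⟩
  · rintro _ _ _ ⟨⟨f, x, rfl, rfl, hx⟩, ⟨f', x', hf, rfl, hx'⟩⟩
    obtain rfl := toObj_injective hf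
    have ⟨a, c, hf, _⟩ := hx
    rw [Interp.Carrier.ext (hf.existsUnique_isSkand.unique hx hx')]

theorem realize_skandMembers : skandMembers.Realize v := by
  have h := presents_toObj (SkandOf (V := V))
  simp (disch := omega) only [skandMembers, realize_ex_named, realize_all_named,
    Formula.realize_inf, Formula.realize_sup, Formula.realize_imp, h.realize_system, realize_skand,
    realize_iff', realize_mem, h.realize_app, realize_succ, realize_sub, Function.update_self,
    Function.update_of_ne]
  rintro _ _ _ _ ⟨⟨f, a, c, rfl, rfl, rfl, hs⟩, ⟨f', x, hf, rfl, hx⟩⟩ k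
  obtain rfl := toObj_injective hf
  have hs' := SkandUniverse.systemIn_iff.1 hs
  have hmem : ∀ z : SkandUniverse V, z ∊ x ↔ _ := fun z =>
    SkandUniverse.mem_iff.trans (IsSkand.mem_members (z := z.1) hs' hx)
  have ho := hs'.left.osucc
  have hle : Le a.1 (osucc a.1) := .inr (mem_osucc.2 (.inr rfl))
  have hap := hs'.ap_mem (.inl rfl) hs'.lt
  have hapt := hs'.value _ _ hap
  constructor
  · intro hk
    obtain ⟨z, rfl⟩ := h.of_mem hk
    rw [h.mem_iff, hmem] at hk
    refine hk.imp (fun hz => ?_) fun ⟨hac, hz⟩ => ?_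
    · refine ⟨toObj _ (SkandUniverse.ofTame _ hapt.2), ⟨a, _, rfl, rfl, ?_⟩, ?_⟩
      · exact (h.mem_iff _ _).2 ((pair_mem_iff_of_tame hs'.tame).2 hap)
      · exact (h.mem_iff _ _).2 ((SkandUniverse.mem_iff_of_tame hapt.2).2 hz)
    · have hr := hs'.restr hac hle
      refine ⟨toObj _ (SkandUniverse.ofTame _ ho.tame), toObj _ (SkandUniverse.ofTame _ hr.tame),
        ⟨⟨⟨?_, ?_⟩, ⟨_, _, _, rfl, rfl, rfl, SkandUniverse.systemIn_iff.2 hr⟩⟩, ?_⟩,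
        skandRel_toObj.2 hz⟩
      · exact mt (h.ind_iff _).1 (mt SkandUniverse.atom_iff.1 ho.1)
      · intro k
        constructor
        · intro hk
          obtain ⟨w, rfl⟩ := h.of_mem hk
          rw [h.mem_iff, SkandUniverse.mem_iff_of_tame ho.tame] at hk
          rw [h.mem_iff, SkandUniverse.mem_iff_of_tame hs'.left.tame, h.inj_iff]
          exact (mem_osucc.1 hk).imp id Interp.Carrier.ext
        · intro hk
          obtain ⟨w, rfl⟩ : ∃ w, k = toObj _ w := hk.elim h.of_mem fun e => ⟨_, e⟩
          rw [h.mem_iff, SkandUniverse.mem_iff_of_tame hs'.left.tame, h.inj_iff] at hk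
          rw [h.mem_iff, SkandUniverse.mem_iff_of_tame ho.tame]
          exact mem_osucc.2 (hk.imp id (congrArg _))
      · rw [h.forall_mem_iff]
        intro w hw
        rw [SkandUniverse.mem_iff_of_tame hr.tame] at hw
        rw [h.mem_iff, SkandUniverse.mem_iff_of_tame hs'.tame]
        exact (mem_restr.1 hw).1
  · rintro (⟨_, ⟨d, y, hd, rfl, hy⟩, hk⟩ | ⟨_, _, ⟨⟨⟨-, hsucc⟩, ⟨g, s, c', rfl, rfl, hc, hg⟩⟩,
      hsub⟩, ⟨g', z, hg', rfl, hz⟩⟩)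
    · obtain rfl := h.inj _ _ hd
      obtain ⟨z, rfl⟩ := h.of_mem hk
      rw [h.mem_iff, pair_mem_iff_of_tame hs'.tame] at hy
      rw [h.mem_iff, SkandUniverse.mem_iff_of_tame (hs'.value _ _ hy).2] at hk
      rw [h.mem_iff, hmem, hs'.ap_eq hy]
      exact .inl hk
    · obtain rfl := h.inj _ _ hc
      obtain rfl := h.inj _ _ hg'
      have hg' := SkandUniverse.systemIn_iff.1 hg
      -- The axiom fixes the new left end by its members only; it is an ordinal, so all its members
      -- are tame and ground extensionality identifies it.
      have es : s.1 = osucc a.1 := by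
        refine ClassTheory.ext hg'.left.1 ho.1 fun w => ?_
        have key : ∀ w : SkandUniverse V, w.1 ∊ s.1 ↔ w.1 ∊ a.1 ∨ w.1 = a.1 := fun w => by
          have := hsucc (toObj _ w)
          rw [h.mem_iff, h.mem_iff, h.inj_iff, SkandUniverse.mem_iff_of_tame hg'.left.tame,
            SkandUniverse.mem_iff_of_tame hs'.left.tame] at this
          exact this.trans (or_congr_right ⟨congrArg _, Interp.Carrier.ext⟩)
        rw [mem_osucc]
        constructor
        · exact fun hw => (key (SkandUniverse.ofTame w (hg'.left.tame.of_mem hw))).1 hw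
        · rintro (hw | rfl)
          · exact (key (SkandUniverse.ofTame w (hs'.left.tame.of_mem hw))).2 (.inl hw)
          · exact (key a).2 (.inr rfl)
      have eg : g.1 = restr f.1 s.1 := by
        refine hs'.eq_of_subset hg' fun p hp => ?_
        have hpt := hg'.tame.of_mem hp
        have := hsub (toObj _ (SkandUniverse.ofTame p hpt))
        rw [h.mem_iff, h.mem_iff, SkandUniverse.mem_iff_of_tame hg'.tame,
          SkandUniverse.mem_iff_of_tame hs'.tame] at this
        exact this hp
      rw [h.mem_iff, hmem, ← es, ← eg]
      exact .inr ⟨hg'.lt, hz⟩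

/-- Both skands are pairs of `mark` with the normal form of their system, so they are equal if and
only if the normal forms are. -/
theorem eq_iff_similarIn {f g a c a' c' x y : SkandUniverse V} (hf : SystemIn f a c)
    (hl : LongIn a c) (hg : SystemIn g a' c') (hl' : LongIn a' c') (hx : SkandOf f x)
    (hy : SkandOf g y) : x = y ↔ SimilarIn f g := by
  have hf' := SkandUniverse.systemIn_iff.1 hf
  have hg' := SkandUniverse.systemIn_iff.1 hg
  rw [SkandUniverse.longIn_iff hf'.right] at hl
  rw [SkandUniverse.longIn_iff hg'.right] at hl'
  rw [similarIn_iff hf hg]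
  have ex := (isSkand_iff_of_long hf' hl).1 hx
  have ey := (isSkand_iff_of_long hg' hl').1 hy
  constructor
  · rintro rfl
    exact (pair_injective (ex.symm.trans ey)).2
  · intro e
    exact Interp.Carrier.ext (by rw [ex, ey, e])

theorem realize_skandEquality : skandEquality.Realize v := by
  have h := presents_toObj (SkandOf (V := V))
  simp (disch := omega) only [skandEquality, realize_all_named, Formula.realize_inf,
    Formula.realize_imp, h.realize_longSystem, realize_skand, realize_iff', realize_eq,
    h.realize_similar, Function.update_self, Function.update_of_ne]
  rintro _ _ _ _ ⟨⟨⟨⟨f, a, c, rfl, hf, hl⟩, ⟨g, a', c', rfl, hg, hl'⟩⟩, ⟨f', x, e, rfl, hx⟩⟩,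
    ⟨g', y, e', rfl, hy⟩⟩
  obtain rfl := toObj_injective e
  obtain rfl := toObj_injective e'
  simp only [h.inj_iff, exists_and_left, exists_eq_left', eq_iff_similarIn hf hl hg hl' hx hy]

/-- Each clause of `sameMember` implies equality, the one on skands by `eq_iff_similarIn`.
Conversely every element is an individual or a set and so is the same as itself. The axiom thus
reduces to extensionality. -/
theorem realize_strongExtensionality : strongExtensionality.Realize v := by
  have h := presents_toObj (SkandOf (V := V))
  simp (disch := omega) only [strongExtensionality, sameMember, realize_all_named,
    realize_ex_named, Formula.realize_inf, Formula.realize_sup,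
    Formula.realize_imp, h.realize_longSystem, realize_skand, realize_iff', realize_eq,
    h.realize_similar, realize_cls, realize_mem, realize_ind, h.realize_wfSet, h.realize_set,
    Function.update_self, Function.update_of_ne]
  have same : ∀ {m k : Obj (SkandOf (V := V))}, (∃ n l, ((((∃ f' a c, n = toObj SkandOf f' ∧
      SystemIn f' a c ∧ LongIn a c) ∧ ∃ f' a c, l = toObj SkandOf f' ∧
      SystemIn f' a c ∧ LongIn a c) ∧ SkandRel n m) ∧ SkandRel l k) ∧
      ∃ f' g', n = toObj SkandOf f' ∧ l = toObj SkandOf g' ∧ SimilarIn f' g') → m = k := by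
    rintro m k ⟨_, _, ⟨⟨⟨⟨f, a, c, rfl, hf, hl⟩, ⟨g, a', c', rfl, hg, hl'⟩⟩, ⟨f', x, e, rfl, hx⟩⟩,
      ⟨g', y, e', rfl, hy⟩⟩, f'', g'', e₁, e₂, hfg⟩
    obtain rfl := toObj_injective e
    obtain rfl := toObj_injective e'
    obtain rfl := toObj_injective e₁
    obtain rfl := toObj_injective e₂
    rw [(eq_iff_similarIn hf hl hg hl' hx hy).2 hfg]
  rintro m k ⟨hm, hk⟩
  constructor
  · rintro rfl
    have refl : ∀ n, Mem true n m → ∃ x, n = toObj SkandOf x ∧ (Ind true n ∨ ¬ Atom x) := by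
      intro n hn
      obtain ⟨x, rfl⟩ := h.of_mem hn
      rw [h.ind_iff]
      exact ⟨x, rfl, em _⟩
    refine ⟨fun n hn => ⟨n, hn, ?_⟩, fun n hn => ⟨n, hn, ?_⟩⟩
    all_goals
      obtain ⟨x, e, hx | hx⟩ := refl n hn
      · exact .inl (.inl (.inl ⟨⟨hx, hx⟩, rfl⟩))
      · exact .inr ⟨⟨⟨x, e, hx⟩, ⟨x, e, hx⟩⟩, rfl⟩
  · rintro ⟨h₁, h₂⟩
    refine h.ext hm hk fun x => ⟨fun hx => ?_, fun hx => ?_⟩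
    · obtain ⟨n, hn, ((h' | h') | h') | h'⟩ := h₁ _ hx
      exacts [h'.2 ▸ hn, h'.2 ▸ hn, same h' ▸ hn, h'.2 ▸ hn]
    · obtain ⟨n, hn, ((h' | h') | h') | h'⟩ := h₂ _ hx
      exacts [h'.2 ▸ hn, h'.2 ▸ hn, same h' ▸ hn, h'.2 ▸ hn]

/-- If the class contains the code of a long skand, this is the required member; its system begins
with 0 and is its own normal form. Otherwise a ground-minimal code in the class works, because codes
other than those of skands have their ground members. -/
theorem realize_pseudoFoundation : pseudoFoundation.Realize v := by
  have h := presents_toObj (SkandOf (V := V))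
  simp (disch := omega) only [pseudoFoundation, realize_all_named, realize_ex_named,
    Formula.realize_inf, Formula.realize_sup, Formula.realize_imp, Formula.realize_not,
    realize_nonempty, h.realize_longSkand, realize_mem, Function.update_self,
    Function.update_of_ne]
  rintro m ⟨k, hk⟩
  obtain ⟨x₀, rfl⟩ := h.of_mem hk
  by_cases hs : ∃ x : SkandUniverse V, Mem true (toObj SkandOf x) m ∧ SkandCode x.1
  · obtain ⟨x, hx, F, ⟨l, hF, hl⟩, e⟩ := hs
    refine ⟨_, hx, .inl ⟨SkandUniverse.ofTame F hF.tame,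
      SkandUniverse.ofTame _ hF.left.tame, SkandUniverse.ofTame l hF.right.tame,
      SkandUniverse.systemIn_iff.2 hF, (SkandUniverse.longIn_iff hF.right).2 hl,
      skandRel_toObj.2 ((isSkand_iff_of_long hF hl).2 ?_)⟩⟩
    rw [e, hF.hat_zero]
  · have hD : IsClass {y : V | ∃ hy : IsCode y, (⟨y, hy⟩ : SkandUniverse V) ∈ m.members} :=
      Interp.isClass_iff.1 (isClass_members m)
    obtain ⟨y, ⟨hy, hym⟩, hmin⟩ := Founded.foundation hD ⟨x₀.1, x₀.2, toObj_mem_iff.1 hk⟩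
    have hm : Mem true (toObj SkandOf (⟨y, hy⟩ : SkandUniverse V)) m := toObj_mem_iff.2 hym
    refine ⟨_, hm, .inr ?_⟩
    rw [h.forall_mem_iff]
    intro z hz hzm
    rw [SkandUniverse.mem_iff_of_not_skandCode fun hc => hs ⟨_, hm, hc⟩] at hz
    exact hmin z.1 hz ⟨z.2, toObj_mem_iff.1 hzm⟩

theorem realize_nbg1 {u : Bool} (hu : (∃ x : V, Atom x ∧ x ≠ mark) ↔ u = true) {φ : Fm true}
    (hφ : φ ∈ NBG1 u) : φ.Realize v := by
  rcases hφ with hφ | hφ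
  · refine obj_common def_skandOf (Iff.trans ⟨?_, ?_⟩ hu) hφ v
    · exact fun ⟨x, hx⟩ => ⟨x.1, hx⟩
    · rintro ⟨x, hx, hne⟩
      have ht : Tame x := tame_iff.2 ⟨hne, fun y hy => (Universe.not_mem_of_atom hx hy).elim⟩
      exact ⟨SkandUniverse.ofTame x ht, SkandUniverse.atom_iff.2 hx⟩
  · simp only [Set.mem_insert_iff, Set.mem_singleton_iff] at hφ
    rcases hφ with rfl | rfl | rfl | rfl | rfl | rfl
    exacts [realize_vonNeumann, realize_skandExistence, realize_skandMembers,
      realize_skandEquality, realize_strongExtensionality, realize_pseudoFoundation]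

end

end Skands

theorem theorem1 (u : Bool) (h : Skands.Consistent (Skands.NBG u)) :
    Skands.Consistent (Skands.NBG1 u) := by
  obtain ⟨M, _, hM, e, he⟩ := Skands.exists_model_of_consistent h
  obtain ⟨V, _, _⟩ := Skands.exists_universe hM he
  -- The individuals of the given model, if any, might form a proper class. They are replaced by one
  -- individual to be reserved as `mark` and, if `u = true`, one genuine individual.
  obtain ⟨U, _, _, s, hs, hA, hu⟩ := ClassTheory.exists_universe_with_atoms (V := V) u
  let : ClassTheory.Marked U := ⟨s, hs, hA⟩
  have : Nonempty (Skands.Obj (Skands.SkandOf (V := U))) :=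
    ⟨Skands.toObj _ (ClassTheory.mkSet ∅)⟩
  exact Skands.consistent_of_model (M := Skands.Obj (Skands.SkandOf (V := U)))
    fun φ hφ v => Skands.realize_nbg1 hu hφ
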